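/- Let $\mathcal H=L^2(\mathbb R)$, let $|n\rangle$ ($n\ge 0$) be the $n$-th normalized Hermite function, $N$ the number operator, $a,a^*$ the ladder operators ($a|n\rangle=\sqrt n\,|n-1\rangle$, $a^*|n\rangle=\sqrt{n+1}\,|n+1\rangle$), $R(\alpha)=e^{i\alpha N}$, $|z\rangle=e^{-|z|^2/2}\sum_n \frac{z^n}{\sqrt{n!}}|n\rangle$ the coherent states, $Q$ and $P$ the position and momentum operators, and $C$ the complex conjugation $(C\psi)(x)=\overline{\psi(x)}$. Let $\mathsf Q_\theta$ be the spectral measure of (the closure of) $Q_\theta=\frac1{\sqrt2}(e^{i\theta}a^*+e^{-i\theta}a)$, $\mathsf Q=\mathsf Q_0$, and let $U_{12}$ be the unitary operator on $\mathcal H\otimes\mathcal H$ with $U_{12}|z\rangle\otimes|w\rangle=|\tfrac1{\sqrt2}(z-w)\rangle\otimes|\tfrac1{\sqrt2}(z+w)\rangle$ for all $z,w\in\mathbb C$. States are positive operators of trace one; observables are normalized positive operator measures on the Borel sets. Fix a phase shift $\theta\in(-\pi,0)\cup(0,\pi)$ and a state $\sigma$ on $\mathcal H$ (the parameter field). The high-amplitude-limit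 observable of eight-port homodyne detection is the observable $\mathsf E_{\theta,\sigma}$ on $\mathbb R^2$ determined by $$\operatorname{tr}[\rho\,\mathsf E_{\theta,\sigma}(X\times Y)]=\operatorname{tr}\big[U_{12}(\rho\otimes\sigma)U_{12}^*\;\mathsf Q(\tfrac1{\sqrt2}X)\otimes\mathsf Q_\theta(\tfrac1{\sqrt2}Y)\big]$$ for all states $\rho$ and all Borel sets $X,Y\subseteq\mathbb R$. Put $W(q,p)=e^{iqp/2}e^{-iqP}e^{ipQ}$, $f_\theta(q,p)=(q,\,q\cos\theta+p\sin\theta)$ and $W_\theta(q,p)=W(f_\theta^{-1}(q,p))$. Define $$(A_\theta\psi)(x)=\sqrt{\tfrac{|\sin\theta|}{1+\cos\theta}}\;\psi\Big(\sqrt{\tfrac{1-\cos\theta}{1+\cos\theta}}\,x\Big),$$ $$V_\theta=R(\tfrac12(\theta-\pi))A_\theta R(\tfrac\theta2)\ \text{ if }\theta\in(0,\pi),\qquad V_\theta=R(\tfrac12(\theta+\pi))A_\theta R(\tfrac\theta2)\ \text{ if }\theta\in(-\pi,0),$$ and $S_\theta(\sigma)=V_\theta\,C\sigma C^{-1}\,V_\theta^*$.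 Then $S_\theta(\sigma)$ is a state; there is exactly one observable $\mathsf E_{\theta,\sigma}$ satisfying the condition above; it is $\theta$-covariant, that is, $W_\theta(q,p)\mathsf E_{\theta,\sigma}(Z)W_\theta(q,p)^*=\mathsf E_{\theta,\sigma}(Z+(q,p))$ for all $(q,p)\in\mathbb R^2$ and all Borel sets $Z\subseteq\mathbb R^2$; and it equals $\mathsf G_\theta^{S_\theta(\sigma)}$, that is, $$\mathsf E_{\theta,\sigma}(Z)=\frac1{2\pi|\sin\theta|}\int_Z W_\theta(q,p)\,S_\theta(\sigma)\,W_\theta(q,p)^*\,dq\,dp$$ for every Borel set $Z\subseteq\mathbb R^2$, the integral being understood in the weak sense. -/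

import Mathlib

open MeasureTheory Polynomial
open scoped TensorProduct Pointwise

noncomputable section

namespace EightPort

/-- polynomial times Gaussian is integrable -/
theorem integrable_poly_gauss (p : ℝ[X]) {b : ℝ} (hb : 0 < b) :
    Integrable fun x : ℝ => p.eval x * Real.exp (-b * x ^ 2) := by
  induction p using Polynomial.induction_on' with
  | add p q hp hq => simpa [add_mul, Pi.add_def] using hp.add hq
  | monomial n a =>
    have := (integrable_rpow_mul_exp_neg_mul_sq hb (s := n)
      (by have := Nat.cast_nonneg (α := ℝ) n; linarith)).const_mul a
    simpa [mul_assoc] using this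

/-- Repeated integration by parts against a Hermite polynomial. -/
theorem integral_mul_hermite (n : ℕ) : ∀ p : ℝ[X],
    ∫ x : ℝ, p.eval x * (aeval x (hermite n) * Real.exp (-(1 / 2) * x ^ 2)) =
      ∫ x : ℝ, (derivative^[n] p).eval x * Real.exp (-(1 / 2) * x ^ 2) := by
  induction n with
  | zero => intro p; simp
  | succ n ih =>
    intro p
    have hd : ∀ x : ℝ, HasDerivAt (fun x : ℝ => aeval x (hermite n) * Real.exp (-(1 / 2) * x ^ 2))
        (-(aeval x (hermite (n + 1)) * Real.exp (-(1 / 2) * x ^ 2))) x := by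
      intro x
      have h1 : HasDerivAt (fun x : ℝ => aeval x (hermite n)) (aeval x (derivative (hermite n))) x :=
        Polynomial.hasDerivAt_aeval _ _
      have h2 : HasDerivAt (fun x : ℝ => Real.exp (-(1 / 2) * x ^ 2))
          (Real.exp (-(1 / 2) * x ^ 2) * (-(1 / 2) * (2 * x))) x := by
        have := ((hasDerivAt_pow 2 x).const_mul (-(1 / 2) : ℝ)).exp
        simpa using this
      refine (h1.mul h2).congr_deriv ?_
      simp only [hermite_succ, map_sub, map_mul, aeval_X]
      ring
    have hI : ∀ (q : ℝ[X]) (r : ℤ[X]),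
        Integrable fun x : ℝ => q.eval x * (aeval x r * Real.exp (-(1 / 2) * x ^ 2)) := by
      intro q r
      have := integrable_poly_gauss (q * r.map (Int.castRingHom ℝ)) (b := 1 / 2) (by norm_num)
      refine this.congr (Filter.Eventually.of_forall fun x => ?_)
      simp [aeval_def, eval_map, mul_assoc]
    have key := integral_mul_deriv_eq_deriv_mul_of_integrable
      (u := fun x : ℝ => p.eval x) (u' := fun x => (derivative p).eval x)
      (fun x _ => p.hasDerivAt x) (fun x _ => hd x)
      (by simpa [Pi.mul_def] using (hI p (hermite (n+1))).neg) (hI _ _) (hI _ _)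
    rw [Function.iterate_succ_apply, ← ih]
    simp only [mul_neg, integral_neg, neg_inj] at key
    exact key

theorem integral_hermite_mul_hermite (m n : ℕ) :
    ∫ x : ℝ, aeval x (hermite m) * (aeval x (hermite n) * Real.exp (-(1 / 2) * x ^ 2)) =
      if m = n then n.factorial * √(2 * Real.pi) else 0 := by
  have main : ∀ m n : ℕ, m ≤ n →
      ∫ x : ℝ, aeval x (hermite m) * (aeval x (hermite n) * Real.exp (-(1 / 2) * x ^ 2)) =
      if m = n then n.factorial * √(2 * Real.pi) else 0 := by
    intro m n hmn
    have h := integral_mul_hermite n ((hermite m).map (Int.castRingHom ℝ))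
    simp only [eval_map, ← algebraMap_int_eq, ← aeval_def] at h
    rw [h]
    rcases hmn.eq_or_lt with rfl | hlt
    · have : derivative^[m] ((hermite m).map (algebraMap ℤ ℝ)) = C (m.factorial : ℝ) := by
        apply Polynomial.ext
        intro k
        rw [Polynomial.coeff_iterate_derivative, coeff_map, coeff_C]
        rcases k with _ | k
        · simp [Nat.descFactorial_self]
        · rw [coeff_hermite_of_lt (by omega)]; simp
      rw [this]
      simp only [eval_C, if_true, integral_const_mul, integral_gaussian]
      congr 2; ring
    · rw [Polynomial.iterate_derivative_eq_zero]
      · simp [hlt.ne]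
      · exact lt_of_le_of_lt natDegree_map_le (by simpa using hlt)
  rcases le_total m n with h | h
  · exact main m n h
  · have := main n m h
    simp only [eq_comm (a := n)] at this
    rw [show (fun x : ℝ => aeval x (hermite m) * (aeval x (hermite n) * Real.exp (-(1 / 2) * x ^ 2)))
      = fun x => aeval x (hermite n) * (aeval x (hermite m) * Real.exp (-(1 / 2) * x ^ 2)) by
        ext; ring, this]
    split_ifs with h
    · rw [h]
    · rfl


/-- The one-mode Hilbert space in the coordinate representation: `L²(ℝ, ℂ)`. -/
abbrev Mode : Type := Lp ℂ 2 (volume : Measure ℝ)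

/-- Hermite function: `(n! √π)^(-1/2) He_n(√2 x) exp(-x²/2)`, with `He_n` the probabilists' Hermite
polynomial; this is the usual `(2ⁿ n! √π)^(-1/2) H_n(x) exp(-x²/2)`. -/
def hermiteFun (n : ℕ) (x : ℝ) : ℝ :=
  (√(n.factorial * √Real.pi))⁻¹ * (aeval (√2 * x) (hermite n) * Real.exp (-(x ^ 2 / 2)))

theorem continuous_hermiteFun (n : ℕ) : Continuous (hermiteFun n) := by
  unfold hermiteFun
  fun_prop

theorem hermiteFun_eq_poly (n : ℕ) :
    ∃ p : ℝ[X], ∀ x, hermiteFun n x = p.eval x * Real.exp (-(x ^ 2 / 2)) := by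
  refine ⟨C (√(n.factorial * √Real.pi))⁻¹ *
    ((hermite n).map (Int.castRingHom ℝ)).comp (C (√2) * X), fun x => ?_⟩
  simp [hermiteFun, eval_comp, eval_map, aeval_def, mul_assoc]

theorem memLp_poly_gauss (p : ℝ[X]) :
    MemLp (fun x : ℝ => ((p.eval x * Real.exp (-(x ^ 2 / 2)) : ℝ) : ℂ)) 2 volume := by
  rw [memLp_two_iff_integrable_sq_norm (by
    apply Continuous.aestronglyMeasurable; fun_prop)]
  refine (integrable_poly_gauss (p ^ 2) one_pos).congr (Filter.Eventually.of_forall fun x => ?_)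
  simp only [Complex.norm_real, Real.norm_eq_abs, sq_abs, mul_pow, ← Real.exp_nat_mul, eval_pow]
  congr 2; push_cast; ring

theorem memLp_hermiteFun (n : ℕ) : MemLp (fun x : ℝ => (hermiteFun n x : ℂ)) 2 volume := by
  obtain ⟨p, hp⟩ := hermiteFun_eq_poly n
  simpa only [hp] using memLp_poly_gauss p

/-- The number state `|n⟩`. -/
def numberState (n : ℕ) : Mode := (memLp_hermiteFun n).toLp _

theorem integral_hermiteFun_mul (m n : ℕ) :
    ∫ x, hermiteFun m x * hermiteFun n x = if m = n then 1 else 0 := by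
  have h2 : (0 : ℝ) < √2 := by positivity
  have h := Measure.integral_comp_mul_left
    (fun x : ℝ => aeval x (hermite m) * (aeval x (hermite n) * Real.exp (-(1 / 2) * x ^ 2))) (√2)
  rw [integral_hermite_mul_hermite] at h
  have e : (fun x => hermiteFun m x * hermiteFun n x) = fun x : ℝ =>
      ((√(m.factorial * √Real.pi))⁻¹ * (√(n.factorial * √Real.pi))⁻¹) *
      (aeval (√2 * x) (hermite m) * (aeval (√2 * x) (hermite n) *
        Real.exp (-(1 / 2) * (√2 * x) ^ 2))) := by
    ext x
    have : Real.exp (-(1 / 2) * (√2 * x) ^ 2) =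
        Real.exp (-(x ^ 2 / 2)) * Real.exp (-(x ^ 2 / 2)) := by
      rw [← Real.exp_add, mul_pow, Real.sq_sqrt (by norm_num)]; congr 1; ring
    rw [this]; unfold hermiteFun; ring
  rw [e, integral_const_mul, h]
  split_ifs with hmn
  · subst hmn
    have h3 : 0 < (m.factorial : ℝ) * √Real.pi := by positivity
    have h4 : √(2 * Real.pi) = √2 * √Real.pi := Real.sqrt_mul (by norm_num) _
    rw [← mul_inv, Real.mul_self_sqrt h3.le, h4, abs_of_pos (by positivity), smul_eq_mul]
    field_simp
  · simp

theorem orthonormal_numberState : Orthonormal ℂ numberState := by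
  rw [orthonormal_iff_ite]
  intro m n
  rw [L2.inner_def]
  have : (fun x => inner ℂ ((numberState m : Mode) x) ((numberState n : Mode) x)) =ᵐ[volume]
      fun x => ((hermiteFun m x * hermiteFun n x : ℝ) : ℂ) := by
    filter_upwards [(memLp_hermiteFun m).coeFn_toLp, (memLp_hermiteFun n).coeFn_toLp] with x h1 h2
    rw [numberState, numberState, h1, h2]
    simp [mul_comm]
  rw [integral_congr_ae this, integral_complex_ofReal, integral_hermiteFun_mul]
  split_ifs <;> simp


/-- The polynomials underlying the Hermite functions, as a polynomial sequence. -/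
def hermiteSeq : Polynomial.Sequence ℝ where
  elems' n := ((hermite n).map (Int.castRingHom ℝ)).comp (C (√2) * X)
  degree_eq' n := by
    have h2 : √(2 : ℝ) ≠ 0 := by positivity
    have hd : ((hermite n).map (Int.castRingHom ℝ)).natDegree = n := by
      rw [(hermite_monic n).natDegree_map, natDegree_hermite]
    have hne : ((hermite n).map (Int.castRingHom ℝ)).comp (C (√2) * X) ≠ 0 := by
      intro h
      have hl := congrArg Polynomial.leadingCoeff h
      rw [leadingCoeff_comp (by simp [natDegree_C_mul_X _ h2]),
        ((hermite_monic n).map (Int.castRingHom ℝ)).leadingCoeff] at hl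
      simp [h2] at hl
    rw [degree_eq_natDegree hne, natDegree_comp, hd, natDegree_C_mul_X _ h2, mul_one]

theorem eval_hermiteSeq (n : ℕ) (x : ℝ) :
    (hermiteSeq n).eval x = aeval (√2 * x) (hermite n) := by
  change (((hermite n).map (Int.castRingHom ℝ)).comp (C (√2) * X)).eval x = _
  simp [eval_comp, eval_map, aeval_def]

theorem integrable_exp_mul (f : Mode) (c : ℝ) :
    Integrable fun x : ℝ => Real.exp (c * |x|) * (Real.exp (-(x ^ 2 / 2)) * ‖f x‖) := by
  have h1 : MemLp (fun x : ℝ => Real.exp (c * |x|) * Real.exp (-(x ^ 2 / 2))) 2 volume := by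
    rw [memLp_two_iff_integrable_sq (by apply Continuous.aestronglyMeasurable; fun_prop)]
    have hg := (integrable_exp_neg_mul_sq (b := 1 / 2) (by norm_num)).const_mul
      (Real.exp (2 * c ^ 2))
    refine hg.mono' (by apply Continuous.aestronglyMeasurable; fun_prop)
      (Filter.Eventually.of_forall fun x => ?_)
    rw [Real.norm_eq_abs, abs_of_nonneg (by positivity), ← Real.exp_add, ← Real.exp_add,
      ← Real.exp_nat_mul]
    apply Real.exp_le_exp.2
    push_cast
    nlinarith [sq_nonneg (2 * c - |x|), sq_abs x]
  have := h1.integrable_mul (Lp.memLp f).norm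
  refine this.congr (Filter.Eventually.of_forall fun x => ?_)
  simp [mul_assoc]

/-- A square integrable function whose product with a Gaussian has vanishing moments is zero. -/
theorem eq_zero_of_moments (f : Mode)
    (hf : ∀ n : ℕ, ∫ x : ℝ, (x : ℂ) ^ n * ((Real.exp (-(x ^ 2 / 2)) : ℝ) * f x) = 0) : f = 0 := by
  set g : ℝ → ℂ := fun x => (Real.exp (-(x ^ 2 / 2)) : ℝ) * f x with hg
  have hgm : AEStronglyMeasurable g volume :=
    (Continuous.aestronglyMeasurable (by fun_prop)).mul (Lp.aestronglyMeasurable f)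
  have hgn : ∀ x, ‖g x‖ = Real.exp (-(x ^ 2 / 2)) * ‖f x‖ := fun x => by
    simp only [hg, norm_mul, Complex.norm_real, Real.norm_eq_abs, abs_of_pos (Real.exp_pos _)]
  have hgi : Integrable g := by
    have := integrable_exp_mul f 0
    refine this.mono' hgm (Filter.Eventually.of_forall fun x => ?_)
    rw [hgn]; simp
  have hF : ∀ t : ℝ, ∫ x : ℝ, Complex.exp (Complex.I * (t * x)) * g x = 0 := by
    intro t
    have hs := hasSum_integral_of_dominated_convergence (μ := (volume : Measure ℝ))
      (F := fun (n : ℕ) (x : ℝ) => ((Complex.I * (t * x)) ^ n / n.factorial) * g x)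
      (f := fun x : ℝ => Complex.exp (Complex.I * (t * x)) * g x)
      (fun n x => ((|t| * |x|) ^ n / n.factorial) * ‖g x‖)
      (fun n => (Continuous.aestronglyMeasurable (by fun_prop)).mul hgm)
      (fun n => Filter.Eventually.of_forall fun x => by simp)
      (Filter.Eventually.of_forall fun x =>
        (Real.summable_pow_div_factorial (|t| * |x|)).mul_right _)
      (by
        refine (integrable_exp_mul f |t|).congr (Filter.Eventually.of_forall fun x => ?_)
        simp only
        rw [tsum_mul_right, hgn, Real.exp_eq_exp_ℝ, NormedSpace.exp_eq_tsum_div])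
      (Filter.Eventually.of_forall fun x => by
        have := NormedSpace.expSeries_div_hasSum_exp (Complex.I * (t * x))
        rw [← Complex.exp_eq_exp_ℂ] at this
        exact this.mul_right _)
    have h0 : ∀ n : ℕ, ∫ x : ℝ, ((Complex.I * (t * x)) ^ n / n.factorial) * g x = 0 := by
      intro n
      have : (fun x : ℝ => ((Complex.I * (t * x)) ^ n / n.factorial) * g x) =
          fun x : ℝ => ((Complex.I * t) ^ n / n.factorial) * ((x : ℂ) ^ n * g x) := by
        ext x; ring
      rw [this, integral_const_mul, hf n, mul_zero]
    simp only [h0] at hs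
    exact hs.unique hasSum_zero
  have hφ : ∀ φ : SchwartzMap ℝ ℂ, ∫ x, φ x * g x = 0 := by
    intro φ
    have key := VectorFourier.integral_fourierIntegral_smul_eq_flip (L := innerₗ ℝ)
      (μ := (volume : Measure ℝ)) (ν := (volume : Measure ℝ)) Real.continuous_fourierChar
      continuous_inner (FourierTransform.fourierInv φ).integrable hgi
    have h1 : ∀ x, VectorFourier.fourierIntegral Real.fourierChar volume (innerₗ ℝ)
        (FourierTransform.fourierInv φ : SchwartzMap ℝ ℂ) x = φ x := by
      intro x
      have : FourierTransform.fourier (FourierTransform.fourierInv φ) = φ :=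
        FourierTransform.fourier_fourierInv_eq φ
      exact DFunLike.congr_fun this x
    have h2 : ∀ x, VectorFourier.fourierIntegral Real.fourierChar volume (innerₗ ℝ).flip g x = 0 := by
      intro x
      rw [← hF (-(2 * Real.pi * x))]
      simp only [VectorFourier.fourierIntegral]
      refine integral_congr_ae (Filter.Eventually.of_forall fun v => ?_)
      simp only [Circle.smul_def, Real.fourierChar_apply, smul_eq_mul]
      congr 2
      simp
      ring
    simpa only [h1, h2, smul_eq_mul, mul_zero, integral_zero] using key
  have hg0 : g =ᵐ[volume] 0 := by
    refine ae_eq_zero_of_integral_contDiff_smul_eq_zero hgi.locallyIntegrable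
      fun ψ hψ hc => ?_
    have hc' : HasCompactSupport fun x => (ψ x : ℂ) := hc.comp_left Complex.ofReal_zero
    have := hφ (hc'.toSchwartzMap (Complex.ofRealCLM.contDiff.comp hψ))
    simp only [Complex.real_smul]
    exact this
  rw [Lp.eq_zero_iff_ae_eq_zero]
  filter_upwards [hg0] with x hx
  have : (Real.exp (-(x ^ 2 / 2)) : ℂ) ≠ 0 := by exact_mod_cast (Real.exp_pos _).ne'
  simpa [hg, this] using hx

theorem orthogonal_numberState :
    (Submodule.span ℂ (Set.range numberState))ᗮ = ⊥ := by
  rw [Submodule.eq_bot_iff]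
  intro f hf
  have hint : ∀ p : ℝ[X], Integrable fun x : ℝ =>
      ((p.eval x * Real.exp (-(x ^ 2 / 2)) : ℝ) : ℂ) * f x := fun p =>
    (memLp_poly_gauss p).integrable_mul (Lp.memLp f)
  let L : ℝ[X] →ₗ[ℝ] ℂ :=
    { toFun := fun p => ∫ x : ℝ, ((p.eval x * Real.exp (-(x ^ 2 / 2)) : ℝ) : ℂ) * f x
      map_add' := fun p q => by
        rw [← integral_add (hint p) (hint q)]
        congr 1; ext x; simp; ring
      map_smul' := fun c p => by
        simp only [RingHom.id_apply]
        rw [← integral_smul]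
        congr 1; ext x; simp; ring }
  have hL0 : ∀ n, L (hermiteSeq n) = 0 := by
    intro n
    have h0 : inner ℂ (numberState n) f = 0 :=
      hf _ (Submodule.subset_span ⟨n, rfl⟩)
    rw [L2.inner_def] at h0
    have hc : (√(n.factorial * √Real.pi))⁻¹ ≠ 0 := by positivity
    have : ((√(n.factorial * √Real.pi))⁻¹ : ℝ) • L (hermiteSeq n) = 0 := by
      rw [← h0, ← map_smul]
      refine integral_congr_ae ?_
      filter_upwards [(memLp_hermiteFun n).coeFn_toLp] with x h1
      rw [numberState, h1]
      simp only [eval_smul, eval_hermiteSeq, hermiteFun, smul_eq_mul, RCLike.inner_apply,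
        Complex.conj_ofReal]
      rw [mul_comm, mul_assoc]
    exact (smul_eq_zero.1 this).resolve_left hc
  have hL : L = 0 := by
    refine LinearMap.ext_on_range (v := hermiteSeq) (hermiteSeq.span fun i => ?_) (by simpa using hL0)
    exact isUnit_iff_ne_zero.2 (leadingCoeff_ne_zero.2 (hermiteSeq.ne_zero i))
  refine eq_zero_of_moments f fun n => ?_
  have := LinearMap.congr_fun hL (X ^ n)
  rw [LinearMap.zero_apply] at this
  rw [← this]
  refine integral_congr_ae (Filter.Eventually.of_forall fun x => ?_)
  simp [mul_assoc]

/-- The number basis `{|n⟩}`. -/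
def numberBasis : HilbertBasis ℕ ℂ Mode :=
  HilbertBasis.mkOfOrthogonalEqBot orthonormal_numberState orthogonal_numberState


theorem coe_numberBasis : (numberBasis : ℕ → Mode) = numberState := by
  simp [numberBasis]

/-- The coherent state `|z⟩ = exp(-|z|²/2) ∑ₙ zⁿ/√(n!) |n⟩`. -/
def coherentState (z : ℂ) : Mode :=
  (Real.exp (-(‖z‖ ^ 2 / 2)) : ℂ) • ∑' n : ℕ, (z ^ n / (√(n.factorial : ℝ) : ℂ)) • numberState n

theorem orthonormal_rotated (θ : ℝ) :
    Orthonormal ℂ fun n : ℕ => Complex.exp (Complex.I * θ * n) • numberState n := by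
  have hn : ∀ n : ℕ, ‖Complex.exp (Complex.I * θ * n)‖ = 1 := fun n => by
    rw [Complex.norm_exp]; simp
  refine ⟨fun n => ?_, fun m n hmn => ?_⟩
  · rw [norm_smul, hn, orthonormal_numberState.1, mul_one]
  · beta_reduce
    rw [inner_smul_left, inner_smul_right, orthonormal_numberState.2 hmn, mul_zero, mul_zero]

theorem orthogonal_rotated (θ : ℝ) :
    (Submodule.span ℂ (Set.range fun n : ℕ =>
      Complex.exp (Complex.I * θ * n) • numberState n))ᗮ = ⊥ := by
  rw [eq_bot_iff, ← orthogonal_numberState]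
  refine Submodule.orthogonal_le (Submodule.span_le.2 ?_)
  rintro _ ⟨n, rfl⟩
  have := Submodule.smul_mem _ (Complex.exp (Complex.I * θ * n))⁻¹
    (Submodule.subset_span (R := ℂ) (Set.mem_range_self
      (f := fun n : ℕ => Complex.exp (Complex.I * θ * n) • numberState n) n))
  simp only [smul_smul, inv_mul_cancel₀ (Complex.exp_ne_zero _), one_smul] at this
  exact this

/-- The phase shifter `R(θ) = exp(iθN)`: the unitary operator that is diagonal in the number basis
with `R(θ)|n⟩ = exp(iθn)|n⟩`. -/
def phaseShifter (θ : ℝ) : Mode ≃ₗᵢ[ℂ] Mode :=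
  numberBasis.repr.trans
    (HilbertBasis.mkOfOrthogonalEqBot (orthonormal_rotated θ) (orthogonal_rotated θ)).repr.symm

theorem phaseShifter_numberState (θ : ℝ) (n : ℕ) :
    phaseShifter θ (numberState n) = Complex.exp (Complex.I * θ * n) • numberState n := by
  classical
  have h : numberBasis.repr (numberState n) = lp.single 2 n 1 := by
    rw [← numberBasis.repr_self, coe_numberBasis]
  rw [phaseShifter, LinearIsometryEquiv.trans_apply, h,
    HilbertBasis.repr_symm_single, HilbertBasis.coe_mkOfOrthogonalEqBot]

/-- The basis `{|n⟩}` of the space of finite linear combinations of number states. -/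
def finiteBasis : Module.Basis ℕ ℂ (Submodule.span ℂ (Set.range numberState)) :=
  Module.Basis.span orthonormal_numberState.linearIndependent

/-- The annihilation operator `a|n⟩ = √n |n-1⟩` on finite linear combinations of number states. -/
def annihilation : Mode →ₗ.[ℂ] Mode where
  domain := Submodule.span ℂ (Set.range numberState)
  toFun := finiteBasis.constr ℂ fun n => (√(n : ℝ) : ℂ) • numberState (n - 1)

/-- The creation operator `a*|n⟩ = √(n+1) |n+1⟩` on finite linear combinations of number states. -/
def creation : Mode →ₗ.[ℂ] Mode where
  domain := Submodule.span ℂ (Set.range numberState)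
  toFun := finiteBasis.constr ℂ fun n => (√((n : ℝ) + 1) : ℂ) • numberState (n + 1)

/-- The quadrature operator `Q_θ`, the closure of `(exp(iθ) a* + exp(-iθ) a)/√2`. -/
def quadrature (θ : ℝ) : Mode →ₗ.[ℂ] Mode :=
  ((1 / √2 : ℂ) • (Complex.exp (Complex.I * θ) • creation +
    Complex.exp (-(Complex.I * θ)) • annihilation)).closure

/-- An observable with outcome space `α` on the Hilbert space `K`: a normalized positive operator
measure (weakly countably additive), set to `0` on nonmeasurable sets. -/
structure Observable (α : Type*) [MeasurableSpace α] (K : Type*) [NormedAddCommGroup K]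
    [InnerProductSpace ℂ K] where
  toFun : Set α → K →L[ℂ] K
  isPositive : ∀ X, MeasurableSet X → (toFun X).IsPositive
  map_univ : toFun Set.univ = 1
  hasSum_iUnion : ∀ X : ℕ → Set α, (∀ n, MeasurableSet (X n)) → Pairwise (Function.onFun Disjoint X) →
    ∀ φ ψ : K, HasSum (fun n => inner ℂ φ (toFun (X n) ψ)) (inner ℂ φ (toFun (⋃ n, X n) ψ))
  not_measurable : ∀ X, ¬ MeasurableSet X → toFun X = 0

instance {α K : Type*} [MeasurableSpace α] [NormedAddCommGroup K] [InnerProductSpace ℂ K] :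
    CoeFun (Observable α K) fun _ => Set α → K →L[ℂ] K := ⟨Observable.toFun⟩

/-- The measure `X ↦ ⟨ψ, E(X) ψ⟩`. -/
def Observable.measure {α K : Type*} [MeasurableSpace α] [NormedAddCommGroup K]
    [InnerProductSpace ℂ K] (E : Observable α K) (ψ : K) : Measure α :=
  Measure.ofMeasurable (fun X _ => ENNReal.ofReal (inner ℂ ψ (E X ψ)).re)
    (by
      have h := E.hasSum_iUnion (fun _ => ∅) (fun _ => MeasurableSet.empty)
        (fun _ _ _ => disjoint_bot_left) ψ ψ
      have h0 := h.summable.tendsto_atTop_zero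
      rw [tendsto_const_nhds_iff] at h0
      simp [h0])
    (by
      intro X hX hd
      have h := Complex.hasSum_re (E.hasSum_iUnion X hX hd ψ ψ)
      rw [← h.tsum_eq, ENNReal.ofReal_tsum_of_nonneg _ h.summable]
      exact fun n => (E.isPositive _ (hX n)).re_inner_nonneg_right ψ)

/-- `E` is the spectral measure of the (unbounded) self-adjoint operator `T`: it is projection
valued, `dom T = {ψ | ∫ x² ⟨ψ, E(dx) ψ⟩ < ∞}`, and `⟨ψ, Tψ⟩ = ∫ x ⟨ψ, E(dx) ψ⟩` on `dom T`. -/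
def IsSpectralMeasure {K : Type*} [NormedAddCommGroup K] [InnerProductSpace ℂ K]
    (E : Observable ℝ K) (T : K →ₗ.[ℂ] K) : Prop :=
  (∀ X, E X * E X = E X) ∧
  (∀ ψ : K, ψ ∈ T.domain ↔ Integrable (fun x : ℝ => x ^ 2) (E.measure ψ)) ∧
  ∀ ψ : T.domain, inner ℂ (ψ : K) (T ψ) = ((∫ x : ℝ, x ∂(E.measure (ψ : K)) : ℝ) : ℂ)

open Classical in
/-- The spectral measure of a self-adjoint operator `T` (it is unique; `0` if there is none). -/
def spectralMeasure {K : Type*} [NormedAddCommGroup K] [InnerProductSpace ℂ K]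
    (T : K →ₗ.[ℂ] K) (X : Set ℝ) : K →L[ℂ] K :=
  if h : ∃ E : Observable ℝ K, IsSpectralMeasure E T then h.choose X else 0

/-- The trace `∑ᵢ ⟨eᵢ, T eᵢ⟩` over a Hilbert basis. It does not depend on the basis when `T` is
positive or trace class. -/
def trace {K : Type*} [NormedAddCommGroup K] [InnerProductSpace ℂ K] [CompleteSpace K]
    (T : K →L[ℂ] K) : ℂ :=
  ∑' i, inner ℂ ((exists_hilbertBasis ℂ K).choose_spec.choose i)
    (T ((exists_hilbertBasis ℂ K).choose_spec.choose i))

/-- A state: a positive operator of trace one. (A sum that diverges counts as `0`, so the second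
condition includes convergence.) -/
def IsState {K : Type*} [NormedAddCommGroup K] [InnerProductSpace ℂ K] [CompleteSpace K]
    (ρ : K →L[ℂ] K) : Prop :=
  ρ.IsPositive ∧ trace ρ = 1

/-- The Hilbert space tensor product of two modes. -/
abbrev TwoModes : Type := UniformSpace.Completion (Mode ⊗[ℂ] Mode)

/-- The simple tensor `φ ⊗ ψ`. -/
def tensorVec (φ ψ : Mode) : TwoModes := ((φ ⊗ₜ[ℂ] ψ : Mode ⊗[ℂ] Mode) : TwoModes)

/-- The tensor product `A ⊗ B` of bounded operators, acting on the completed tensor product. -/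
def tensorOp (A B : Mode →L[ℂ] Mode) : TwoModes →L[ℂ] TwoModes :=
  (TensorProduct.mapL A B).completion

/-- The 50:50 beam splitter: the (unique) unitary operator with
`U |z⟩ ⊗ |w⟩ = |(z - w)/√2⟩ ⊗ |(z + w)/√2⟩` for all `z, w`. -/
def beamSplitter : TwoModes ≃ₗᵢ[ℂ] TwoModes :=
  Classical.epsilon fun U : TwoModes ≃ₗᵢ[ℂ] TwoModes => ∀ z w : ℂ,
    U (tensorVec (coherentState z) (coherentState w)) =
      tensorVec (coherentState ((z - w) / (√2 : ℝ))) (coherentState ((z + w) / (√2 : ℝ)))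

/-- `E` is the high-amplitude limit observable of eight-port homodyne detection with phase shift
`θ` and parameter field `σ`: for every signal state `ρ` and all Borel sets `X`, `Y`,
`tr[ρ E(X × Y)] = tr[U (ρ ⊗ σ) U* (Q(X/√2) ⊗ Q_θ(Y/√2))]`. -/
def IsHighAmplitudeLimit (θ : ℝ) (σ : Mode →L[ℂ] Mode) (E : Observable (ℝ × ℝ) Mode) : Prop :=
  ∀ ρ : Mode →L[ℂ] Mode, IsState ρ → ∀ X Y : Set ℝ, MeasurableSet X → MeasurableSet Y →
    trace (ρ * E (X ×ˢ Y)) =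
      trace ((beamSplitter : TwoModes →L[ℂ] TwoModes) * tensorOp ρ σ *
        ContinuousLinearMap.adjoint (beamSplitter : TwoModes →L[ℂ] TwoModes) *
        tensorOp (spectralMeasure (quadrature 0) ((1 / √2 : ℝ) • X))
          (spectralMeasure (quadrature θ) ((1 / √2 : ℝ) • Y)))

/-- The translation `exp(-iqP)`: `ψ(x) ↦ ψ(x - q)`. -/
def translation (q : ℝ) : Mode →L[ℂ] Mode :=
  (Lp.compMeasurePreservingₗᵢ ℂ (fun x : ℝ => x - q)
    (measurePreserving_sub_right volume q)).toContinuousLinearMap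

theorem memLp_phase (p : ℝ) (ψ : Mode) :
    MemLp (fun x : ℝ => Complex.exp (Complex.I * p * x) * ψ x) 2 volume := by
  refine (Lp.memLp ψ).of_le
    ((Continuous.aestronglyMeasurable (by fun_prop)).mul (Lp.aestronglyMeasurable ψ))
    (Filter.Eventually.of_forall fun x => ?_)
  rw [norm_mul, Complex.norm_exp]
  simp

/-- The operator `exp(ipQ)`: `ψ(x) ↦ exp(ipx) ψ(x)`. -/
def phaseMul (p : ℝ) : Mode →L[ℂ] Mode :=
  LinearMap.mkContinuous
    { toFun := fun ψ => (memLp_phase p ψ).toLp _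
      map_add' := fun φ ψ => by
        rw [← MemLp.toLp_add]
        refine MemLp.toLp_congr _ _ ?_
        filter_upwards [Lp.coeFn_add φ ψ] with x hx
        simp only [hx, Pi.add_apply, mul_add]
      map_smul' := fun c ψ => by
        rw [RingHom.id_apply, ← MemLp.toLp_const_smul]
        refine MemLp.toLp_congr _ _ ?_
        filter_upwards [Lp.coeFn_smul c ψ] with x hx
        simp only [hx, Pi.smul_apply, smul_eq_mul, mul_left_comm] } 1
    (fun ψ => by
      rw [one_mul]
      refine Lp.norm_le_norm_of_ae_le ?_
      filter_upwards [(memLp_phase p ψ).coeFn_toLp] with x hx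
      change ‖((memLp_phase p ψ).toLp _ : Mode) x‖ ≤ _
      rw [hx, norm_mul, Complex.norm_exp]
      simp)

/-- The Weyl operator `W(q,p) = exp(iqp/2) exp(-iqP) exp(ipQ)`. -/
def weyl (z : ℝ × ℝ) : Mode →L[ℂ] Mode :=
  Complex.exp (Complex.I * (z.1 * z.2 / 2)) • (translation z.1 * phaseMul z.2)

/-- The linear map `f_θ(q,p) = (q, q cos θ + p sin θ)`. -/
def tilt (θ : ℝ) (z : ℝ × ℝ) : ℝ × ℝ :=
  (z.1, z.1 * Real.cos θ + z.2 * Real.sin θ)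

/-- The inverse of `f_θ`, for `sin θ ≠ 0`. -/
def tiltInv (θ : ℝ) (z : ℝ × ℝ) : ℝ × ℝ :=
  (z.1, (z.2 - z.1 * Real.cos θ) / Real.sin θ)

theorem tiltInv_tilt {θ : ℝ} (h : Real.sin θ ≠ 0) (z : ℝ × ℝ) : tiltInv θ (tilt θ z) = z := by
  ext <;> simp [tilt, tiltInv, h]

theorem tilt_tiltInv {θ : ℝ} (h : Real.sin θ ≠ 0) (z : ℝ × ℝ) : tilt θ (tiltInv θ z) = z := by
  ext <;> simp [tilt, tiltInv, h]

/-- The tilted Weyl operator `W_θ(q,p) = W(f_θ⁻¹(q,p))`. -/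
def tiltedWeyl (θ : ℝ) (z : ℝ × ℝ) : Mode →L[ℂ] Mode :=
  weyl (tiltInv θ z)

/-- `θ`-covariance: `W_θ(q,p) E(Z) W_θ(q,p)* = E(Z + (q,p))`. -/
def IsCovariant (θ : ℝ) (E : Observable (ℝ × ℝ) Mode) : Prop :=
  ∀ Z : Set (ℝ × ℝ), MeasurableSet Z → ∀ z : ℝ × ℝ,
    tiltedWeyl θ z * E Z * ContinuousLinearMap.adjoint (tiltedWeyl θ z) =
      E ((fun w => w + z) '' Z)

/-- `E = G_θ^S`, i.e. `E(Z) = (2π|sin θ|)⁻¹ ∫_Z W_θ(q,p) S W_θ(q,p)* dq dp` for all Borel sets `Z`,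
the integral being understood weakly. -/
def IsGeneratedBy (θ : ℝ) (S : Mode →L[ℂ] Mode) (E : Observable (ℝ × ℝ) Mode) : Prop :=
  ∀ Z : Set (ℝ × ℝ), MeasurableSet Z → ∀ φ ψ : Mode,
    IntegrableOn (fun z => inner ℂ φ
      ((tiltedWeyl θ z * S * ContinuousLinearMap.adjoint (tiltedWeyl θ z)) ψ)) Z volume ∧
    inner ℂ φ (E Z ψ) = ((1 / (2 * Real.pi * |Real.sin θ|) : ℝ) : ℂ) *
      ∫ z in Z, inner ℂ φ
        ((tiltedWeyl θ z * S * ContinuousLinearMap.adjoint (tiltedWeyl θ z)) ψ)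

/-- The conjugation `(Cψ)(x) = conj (ψ(x))`. -/
def conjugation : Mode ≃ₗᵢ⋆[ℂ] Mode where
  toFun ψ := star ψ
  invFun ψ := star ψ
  left_inv ψ := star_star ψ
  right_inv ψ := star_star ψ
  map_add' φ ψ := by
    refine Lp.ext ?_
    filter_upwards [Lp.coeFn_star (φ + ψ), Lp.coeFn_add φ ψ, Lp.coeFn_add (star φ) (star ψ),
      Lp.coeFn_star φ, Lp.coeFn_star ψ] with x h1 h2 h3 h4 h5
    simp only [h1, h2, h3, h4, h5, Pi.add_apply, Pi.star_apply, star_add]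
  map_smul' c ψ := by
    refine Lp.ext ?_
    filter_upwards [Lp.coeFn_star (c • ψ), Lp.coeFn_smul c ψ,
      Lp.coeFn_smul (starRingEnd ℂ c) (star ψ), Lp.coeFn_star ψ] with x h1 h2 h3 h4
    simp only [h1, h2, h3, h4, Pi.smul_apply, Pi.star_apply, smul_eq_mul, star_mul']
    rfl
  norm_map' ψ := by
    have h : ∀ᵐ x, ‖(star ψ : Mode) x‖ = ‖ψ x‖ := by
      filter_upwards [Lp.coeFn_star ψ] with x hx
      rw [hx, Pi.star_apply, norm_star]
    exact le_antisymm (Lp.norm_le_norm_of_ae_le (h.mono fun _ hx => hx.le))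
      (Lp.norm_le_norm_of_ae_le (h.mono fun _ hx => hx.ge))

theorem memLp_dilation {k : ℝ} (hk : k ≠ 0) (ψ : Mode) :
    MemLp (fun x : ℝ => ψ (k * x)) 2 volume := by
  have h : MemLp (ψ : ℝ → ℂ) 2 (Measure.map (k * ·) volume) := by
    rw [Real.map_volume_mul_left hk]
    exact (Lp.memLp ψ).smul_measure ENNReal.ofReal_ne_top
  exact h.comp_of_map (by fun_prop)

theorem ae_dilation {k : ℝ} (hk : k ≠ 0) {P : ℝ → Prop} (h : ∀ᵐ x, P x) : ∀ᵐ x, P (k * x) := by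
  have h' : ∀ᵐ x ∂(Measure.map (k * ·) volume), P x := by
    rw [Real.map_volume_mul_left hk]
    exact Measure.ae_smul_measure h _
  exact ae_of_ae_map (by fun_prop) h'

open Classical in
/-- The substitution operator `ψ(x) ↦ ψ(kx)` for `k ≠ 0` (and `0` for `k = 0`). -/
def dilation (k : ℝ) : Mode →L[ℂ] Mode :=
  if hk : k ≠ 0 then
    LinearMap.mkContinuous
      { toFun := fun ψ => (memLp_dilation hk ψ).toLp _
        map_add' := fun φ ψ => by
          rw [← MemLp.toLp_add]
          refine MemLp.toLp_congr _ _ ?_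
          filter_upwards [ae_dilation hk (Lp.coeFn_add φ ψ)] with x hx
          simp only [hx, Pi.add_apply]
        map_smul' := fun c ψ => by
          rw [RingHom.id_apply, ← MemLp.toLp_const_smul]
          refine MemLp.toLp_congr _ _ ?_
          filter_upwards [ae_dilation hk (Lp.coeFn_smul c ψ)] with x hx
          simp only [hx, Pi.smul_apply] }
      (ENNReal.ofReal |k⁻¹| ^ (1 / (2 : ENNReal)).toReal).toReal
      (fun ψ => by
        have h1 : AEStronglyMeasurable (ψ : ℝ → ℂ) (Measure.map (k * ·) volume) := by
          rw [Real.map_volume_mul_left hk]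
          exact (Lp.aestronglyMeasurable ψ).smul_measure _
        have h2 := eLpNorm_map_measure (p := 2) h1 (by fun_prop)
        rw [Real.map_volume_mul_left hk,
          eLpNorm_smul_measure_of_ne_top ENNReal.ofNat_ne_top] at h2
        change ‖(memLp_dilation hk ψ).toLp _‖ ≤ _
        rw [Lp.norm_toLp, Lp.norm_def, ← ENNReal.toReal_mul, ← smul_eq_mul, h2]
        rfl)
  else 0

/-- The unitary operator
`(A_θ ψ)(x) = √(|sin θ|/(1 + cos θ)) ψ(√((1 - cos θ)/(1 + cos θ)) x)`. -/
def squeeze (θ : ℝ) : Mode →L[ℂ] Mode :=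
  (√(|Real.sin θ| / (1 + Real.cos θ)) : ℂ) •
    dilation (√((1 - Real.cos θ) / (1 + Real.cos θ)))

/-- The unitary operator `V_θ`: `R((θ-π)/2) A_θ R(θ/2)` for `θ ∈ (0, π)`, and
`R((θ+π)/2) A_θ R(θ/2)` for `θ ∈ (-π, 0)`. -/
def tiltUnitary (θ : ℝ) : Mode →L[ℂ] Mode :=
  (phaseShifter (if 0 < θ then (θ - Real.pi) / 2 else (θ + Real.pi) / 2) : Mode →L[ℂ] Mode) *
    squeeze θ * (phaseShifter (θ / 2) : Mode →L[ℂ] Mode)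

/-- The operator `C σ C⁻¹`. -/
def conjugate (σ : Mode →L[ℂ] Mode) : Mode →L[ℂ] Mode :=
  (conjugation : Mode →L⋆[ℂ] Mode).comp (σ.comp (conjugation.symm : Mode →L⋆[ℂ] Mode))

/-- The generating operator `S_θ(σ) = V_θ C σ C⁻¹ V_θ*`. -/
def generator (θ : ℝ) (σ : Mode →L[ℂ] Mode) : Mode →L[ℂ] Mode :=
  tiltUnitary θ * conjugate σ * ContinuousLinearMap.adjoint (tiltUnitary θ)

end EightPort

end

/-! The measured operators have commuting components, so some isometry turns them into
multiplication by the coordinates of the plane. That isometry is `homodyneRep θ`: apply the beam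
splitter, rotate the second mode by R(-θ), and read the result as a function on ℝ². In this picture
Q(X) ⊗ Q_θ(Y) is multiplication by the indicator of X × Y, and only isometry is needed, not
surjectivity.

The heart of the matter is the image of φ ⊗ w. At almost every p it equals, up to a unimodular
phase, (π|sin θ|)^(-1/2) ⟨W_θ(√2 p) V_θ C w, φ⟩ (`homodyneRep_tensorVec`). Both sides are explicit
on the displaced Gaussians exp(-x²/2 + √2 ζ x), which are multiples of coherent states and hence
form a total family. Every operator involved sends such a vector to a multiple of one or has
explicit Gaussian overlaps, so the identity becomes an equality of two quadratic exponents
(`homodyneRep_gaussVec`, `inner_tiltedWeyl_gaussVec`). Density then gives all φ and w. The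
antilinear C appears because ⟨W_θ V_θ C w, φ⟩ must be linear in w.

Write σ = B² with B self-adjoint and w_l = B|l⟩. Then σ = ∑ |w_l⟩⟨w_l|, and likewise S_θ(σ) is the
sum of the projectors onto V_θ C w_l. Summing the squared moduli of the kernels over l produces the
density ⟨φ, W_θ S_θ(σ) W_θ* φ⟩ (`inner_homodyneOp`); the substitution z = √2 p contributes the
remaining factor 1/2. Covariance follows from the Weyl relations and translation invariance of
Lebesgue measure. Uniqueness holds because pure states and rectangles determine an observable.

A separate task is to identify `spectralMeasure (quadrature θ)`, which is defined through a choice.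
The closure of (e^{iθ}a* + e^{-iθ}a)/√2 is the maximal multiplication operator rotated by R(θ)
(`graph_quadrature`), since it is contained in that operator and the range of Q_θ + i is dense. Any
spectral measure of it in the sense of `IsSpectralMeasure` must be the rotated family of indicator
multiplications (`IsSpectralMeasure.eq_quadratureObservable`). -/

noncomputable section

namespace EightPort

/-! ### Gaussian vectors and coherent states -/

/-- The unnormalized displaced Gaussian `exp(-x²/2 + √2 ζ x)`. -/
def gaussFun (ζ : ℂ) (x : ℝ) : ℂ := Complex.exp (-(x ^ 2 / 2 : ℂ) + (√2 : ℝ) * ζ * x)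

theorem continuous_gaussFun (ζ : ℂ) : Continuous (gaussFun ζ) := by
  unfold gaussFun; fun_prop

theorem memLp_gaussFun (ζ : ℂ) : MemLp (gaussFun ζ) 2 volume := by
  rw [memLp_two_iff_integrable_sq_norm (continuous_gaussFun ζ).aestronglyMeasurable]
  have h := (integrable_cexp_quadratic' (b := -1) (by simp) (2 * (√2 : ℝ) * ζ) 0).norm
  refine h.congr (Filter.Eventually.of_forall fun x => ?_)
  simp only [gaussFun]
  rw [← norm_pow, ← Complex.exp_nat_mul]
  congr 2; push_cast; ring

/-- The vector `exp(-x²/2 + √2 ζ x)` of the one-mode space. -/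
def gaussVec (ζ : ℂ) : Mode := (memLp_gaussFun ζ).toLp _

theorem coeFn_gaussVec (ζ : ℂ) : gaussVec ζ =ᵐ[volume] gaussFun ζ :=
  (memLp_gaussFun ζ).coeFn_toLp

/-- Differentiating in t multiplies by y - t and subtracts the derivative of the polynomial, which
is exactly the recursion He_{n+1} = X He_n - He_n'. -/
theorem iteratedDeriv_hermite_generating (y : ℂ) (n : ℕ) :
    iteratedDeriv n (fun t : ℂ => Complex.exp (y * t - t ^ 2 / 2)) =
      fun t => aeval (y - t) (hermite n) * Complex.exp (y * t - t ^ 2 / 2) := by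
  induction n with
  | zero => simp
  | succ n ih =>
    rw [iteratedDeriv_succ, ih]
    funext t
    have h1 : HasDerivAt (fun t : ℂ => aeval (y - t) (hermite n))
        (aeval (y - t) (derivative (hermite n)) * -1) t :=
      HasDerivAt.comp t (Polynomial.hasDerivAt_aeval (hermite n) (y - t))
        ((hasDerivAt_id t).const_sub y)
    have h2 : HasDerivAt (fun t : ℂ => Complex.exp (y * t - t ^ 2 / 2))
        (Complex.exp (y * t - t ^ 2 / 2) * (y - t)) t := by
      have := ((((hasDerivAt_id t).const_mul y).sub ((hasDerivAt_pow 2 t).div_const 2))).cexp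
      refine this.congr_deriv ?_
      simp
    refine (h1.mul h2).deriv.trans ?_
    simp only [hermite_succ, map_sub, map_mul, aeval_X]
    ring

/-- The exponential generating function of the Hermite polynomials. -/
theorem hasSum_hermite_generating (y t : ℂ) :
    HasSum (fun n : ℕ => (n.factorial : ℂ)⁻¹ * (t ^ n * aeval y (hermite n)))
      (Complex.exp (y * t - t ^ 2 / 2)) := by
  have h := Complex.hasSum_taylorSeries_of_entire
    (f := fun t : ℂ => Complex.exp (y * t - t ^ 2 / 2)) (by fun_prop) 0 t
  simpa [iteratedDeriv_hermite_generating] using h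

theorem summable_coherent (z : ℂ) :
    Summable fun n : ℕ => (z ^ n / (√(n.factorial : ℝ) : ℂ)) • numberState n := by
  have hs : Summable fun n : ℕ => ‖z ^ n / (√(n.factorial : ℝ) : ℂ)‖ ^ 2 := by
    refine (Real.summable_pow_div_factorial (‖z‖ ^ 2)).congr fun n => ?_
    rw [norm_div, norm_pow, Complex.norm_real, Real.norm_eq_abs, div_pow, sq_abs,
      Real.sq_sqrt (by positivity), ← pow_mul, ← pow_mul, mul_comm]
  exact (orthonormal_numberState.orthogonalFamily.summable_iff_norm_sq_summable
    (fun n : ℕ => z ^ n / (√(n.factorial : ℝ) : ℂ))).2 hs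

/-- An L² limit is the almost everywhere limit along a subsequence, so it can be computed pointwise.
Series identities and closedness arguments below rest on this. -/
theorem ae_eq_of_tendsto_Lp {α : Type*} [MeasurableSpace α] {μ : Measure α} {f : ℕ → Lp ℂ 2 μ}
    {g : Lp ℂ 2 μ} (h : Filter.Tendsto f Filter.atTop (nhds g)) {F : α → ℂ}
    (hF : ∀ᵐ x ∂μ, Filter.Tendsto (fun n => f n x) Filter.atTop (nhds (F x))) :
    g =ᵐ[μ] F := by
  obtain ⟨ns, hns, h2⟩ := (tendstoInMeasure_of_tendsto_Lp h).exists_seq_tendsto_ae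
  filter_upwards [hF, h2] with x h3 h4
  exact tendsto_nhds_unique h4 (h3.comp hns.tendsto_atTop)

/-- The partial sums converge in L², and pointwise they are partial sums of the Hermite generating
function at √2 x; the two limits coincide. -/
theorem coherent_sum_eq (z : ℂ) :
    ∑' n : ℕ, (z ^ n / (√(n.factorial : ℝ) : ℂ)) • numberState n =
      (((√(√Real.pi))⁻¹ : ℝ) * Complex.exp (-(z ^ 2 / 2))) • gaussVec z := by
  refine Lp.ext ?_
  have h := (summable_coherent z).hasSum.tendsto_sum_nat
  refine (ae_eq_of_tendsto_Lp h (F := fun x =>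
    (((√(√Real.pi))⁻¹ : ℝ) * Complex.exp (-(z ^ 2 / 2))) * gaussFun z x) ?_).trans ?_
  · have h1 : ∀ᵐ x : ℝ, ∀ n : ℕ, (numberState n : Mode) x = hermiteFun n x :=
      ae_all_iff.2 fun n => (memLp_hermiteFun n).coeFn_toLp
    have h2 : ∀ᵐ x : ℝ, ∀ N : ℕ, (∑ n ∈ Finset.range N,
        (z ^ n / (√(n.factorial : ℝ) : ℂ)) • numberState n : Mode) x =
        ∑ n ∈ Finset.range N, (z ^ n / (√(n.factorial : ℝ) : ℂ)) * (numberState n : Mode) x := by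
      rw [ae_all_iff]
      intro N
      have h3 : ∀ᵐ x : ℝ, ∀ n : ℕ, ((z ^ n / (√(n.factorial : ℝ) : ℂ)) • numberState n : Mode) x =
          (z ^ n / (√(n.factorial : ℝ) : ℂ)) * (numberState n : Mode) x :=
        ae_all_iff.2 fun n => Lp.coeFn_smul _ _
      filter_upwards [Lp.coeFn_fun_finsetSum (Finset.range N)
        (fun n => (z ^ n / (√(n.factorial : ℝ) : ℂ)) • numberState n), h3] with x hx h3
      rw [hx]
      simp only [h3]
    filter_upwards [h1, h2] with x h1 h2
    simp only [h2, h1]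
    refine HasSum.tendsto_sum_nat ?_
    have h4 := (hasSum_hermite_generating ((√2 : ℝ) * x) z).mul_left
      (((√(√Real.pi))⁻¹ : ℝ) * Complex.exp (-(x ^ 2 / 2 : ℂ)))
    convert! h4 using 1
    · funext n
      have e1 : (√(n.factorial : ℝ) : ℂ) * (√(n.factorial : ℝ) : ℂ) = n.factorial := by
        rw [← Complex.ofReal_mul, Real.mul_self_sqrt (by positivity)]; simp
      have e2 : (√(n.factorial : ℝ) : ℂ) ≠ 0 := by
        norm_cast; positivity
      have e3 : ((aeval (√2 * x) (hermite n) : ℝ) : ℂ) = aeval ((√2 : ℝ) * x : ℂ) (hermite n) := by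
        rw [← Complex.ofReal_mul]
        exact (Polynomial.aeval_algebraMap_apply ℂ (√2 * x) (hermite n)).symm
      rw [hermiteFun, Real.sqrt_mul (by positivity)]
      push_cast
      rw [e3, ← e1]
      field_simp
    · have e : Complex.exp (-(z ^ 2 / 2)) * gaussFun z x = Complex.exp (-(x ^ 2 / 2 : ℂ)) *
          Complex.exp ((√2 : ℝ) * x * z - z ^ 2 / 2) := by
        rw [gaussFun, ← Complex.exp_add, ← Complex.exp_add]
        congr 1; ring
      rw [mul_assoc, e]
      ring
  · filter_upwards [Lp.coeFn_smul (((√(√Real.pi))⁻¹ : ℝ) * Complex.exp (-(z ^ 2 / 2)))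
      (gaussVec z), coeFn_gaussVec z] with x h1 h2
    rw [h1, Pi.smul_apply, h2, smul_eq_mul]

theorem coherentState_eq (z : ℂ) :
    coherentState z = ((Real.exp (-(‖z‖ ^ 2 / 2)) : ℂ) *
      (((√(√Real.pi))⁻¹ : ℝ) * Complex.exp (-(z ^ 2 / 2)))) • gaussVec z := by
  rw [coherentState, coherent_sum_eq, smul_smul]

theorem gaussVec_eq_sum (z : ℂ) : gaussVec z =
    ((√(√Real.pi) : ℝ) * Complex.exp (z ^ 2 / 2)) •
      ∑' n : ℕ, (z ^ n / (√(n.factorial : ℝ) : ℂ)) • numberState n := by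
  have h : ((√(√Real.pi) : ℝ) : ℂ) ≠ 0 := by
    have := Real.pi_pos
    norm_cast; positivity
  rw [coherent_sum_eq, smul_smul]
  push_cast
  rw [mul_mul_mul_comm, mul_inv_cancel₀ h, ← Complex.exp_add]
  simp

/-- Gaussian vectors are total. -/
theorem topologicalClosure_span_gaussVec :
    (Submodule.span ℂ (Set.range gaussVec)).topologicalClosure = ⊤ := by
  rw [Submodule.topologicalClosure_eq_top_iff, Submodule.eq_bot_iff]
  intro f hf
  -- Orthogonality to every `gaussVec z` makes an everywhere convergent power series in z vanish
  -- identically. Its coefficients are then zero, so f is orthogonal to all number states.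
  have h0 : ∀ z : ℂ, HasSum (fun n : ℕ =>
      z ^ n * (inner ℂ f (numberState n) / (√(n.factorial : ℝ) : ℂ))) 0 := by
    intro z
    have h1 : inner ℂ f (gaussVec z) = 0 :=
      (Submodule.mem_orthogonal' _ _).1 hf _ (Submodule.subset_span ⟨z, rfl⟩)
    rw [gaussVec_eq_sum, inner_smul_right] at h1
    have h2 := (mul_eq_zero.1 h1).resolve_left <| mul_ne_zero (by
      have := Real.pi_pos
      norm_cast; positivity) (Complex.exp_ne_zero _)
    have h3 := (innerSL ℂ f).hasSum (summable_coherent z).hasSum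
    simp only [innerSL_apply_apply, h2, inner_smul_right] at h3
    refine h3.congr_fun fun n => ?_
    ring
  have h1 : HasFPowerSeriesAt (0 : ℂ → ℂ) (FormalMultilinearSeries.ofScalars ℂ
      fun n : ℕ => inner ℂ f (numberState n) / (√(n.factorial : ℝ) : ℂ)) 0 := by
    rw [hasFPowerSeriesAt_iff']
    refine Filter.Eventually.of_forall fun z => ?_
    simpa only [sub_zero, FormalMultilinearSeries.coeff_ofScalars, smul_eq_mul, Pi.zero_apply]
      using h0 z
  have h2 : ∀ n, inner ℂ f (numberState n) = 0 := by
    intro n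
    have h3 := congrArg (fun p => FormalMultilinearSeries.coeff p n) h1.eq_zero
    simp only [FormalMultilinearSeries.coeff_ofScalars] at h3
    have e2 : (√(n.factorial : ℝ) : ℂ) ≠ 0 := by
      norm_cast; positivity
    exact (div_eq_zero_iff.1 h3).resolve_right e2
  have h3 : f ∈ (Submodule.span ℂ (Set.range numberState))ᗮ := by
    rw [Submodule.mem_orthogonal']
    intro u hu
    induction hu using Submodule.span_induction with
    | mem x hx => obtain ⟨n, rfl⟩ := hx; exact h2 n
    | zero => simp
    | add x y _ _ hx hy => rw [inner_add_right, hx, hy, add_zero]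
    | smul c x _ hx => rw [inner_smul_right, hx, mul_zero]
  rwa [orthogonal_numberState] at h3

/-- In the number expansion the phase e^{iβn} turns ζⁿ into (e^{iβ}ζ)ⁿ; the scalar corrects the
prefactor exp(ζ²/2) of that expansion. -/
theorem phaseShifter_gaussVec (β : ℝ) (ζ : ℂ) :
    phaseShifter β (gaussVec ζ) =
      Complex.exp (ζ ^ 2 / 2 * (1 - Complex.exp (2 * Complex.I * β))) •
        gaussVec (Complex.exp (Complex.I * β) * ζ) := by
  rw [gaussVec_eq_sum ζ, gaussVec_eq_sum (Complex.exp (Complex.I * β) * ζ), map_smul,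
    show ∀ f : ℕ → Mode, phaseShifter β (∑' n, f n) = ∑' n, phaseShifter β (f n) from
      fun f => (phaseShifter β).toContinuousLinearEquiv.map_tsum, smul_smul]
  congr 1
  · rw [mul_left_comm, ← Complex.exp_add, mul_pow, ← Complex.exp_nat_mul]
    congr 2
    push_cast
    ring_nf
  · congr 1; funext n
    rw [map_smul, phaseShifter_numberState, smul_smul, mul_pow, ← Complex.exp_nat_mul]
    congr 1; ring_nf

theorem phaseShifter_neg_phaseShifter (β : ℝ) (ψ : Mode) :
    phaseShifter (-β) (phaseShifter β ψ) = ψ := by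
  have h : ((phaseShifter β).trans (phaseShifter (-β))).toContinuousLinearEquiv.toContinuousLinearMap
      = ContinuousLinearMap.id ℂ Mode := by
    refine ContinuousLinearMap.ext_on (s := Set.range numberState) ?_ ?_
    · rw [← coe_numberBasis]
      have := numberBasis.dense_span
      rw [Submodule.dense_iff_topologicalClosure_eq_top]
      exact this
    · rintro _ ⟨n, rfl⟩
      change phaseShifter (-β) (phaseShifter β (numberState n)) = numberState n
      rw [phaseShifter_numberState, map_smul, phaseShifter_numberState, smul_smul,
        ← Complex.exp_add]
      push_cast
      simp
  exact DFunLike.congr_fun h ψ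

theorem phaseShifter_symm (β : ℝ) : (phaseShifter β).symm = phaseShifter (-β) := by
  ext1 ψ
  rw [LinearIsometryEquiv.symm_apply_eq]
  simpa using (phaseShifter_neg_phaseShifter (-β) ψ).symm

theorem inner_phaseShifter_left (β : ℝ) (φ ψ : Mode) :
    inner ℂ (phaseShifter β φ) ψ = inner ℂ φ (phaseShifter (-β) ψ) := by
  rw [← phaseShifter_symm, ← (phaseShifter β).inner_map_map φ, LinearIsometryEquiv.apply_symm_apply]

theorem inner_eq_integral {f g : Mode} {F G : ℝ → ℂ} (hf : f =ᵐ[volume] F) (hg : g =ᵐ[volume] G) :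
    inner ℂ f g = ∫ x, G x * starRingEnd ℂ (F x) := by
  rw [L2.inner_def]
  refine integral_congr_ae ?_
  filter_upwards [hf, hg] with x h1 h2
  rw [h1, h2]; rfl

/-- Overlap of a Gaussian vector with a rescaled one. -/
theorem integral_gaussFun_mul_conj (k : ℝ) (v ζ : ℂ) :
    ∫ x : ℝ, gaussFun ζ x * starRingEnd ℂ (gaussFun v (k * x)) =
      (√(2 * Real.pi / (1 + k ^ 2)) : ℝ) *
        Complex.exp ((k * starRingEnd ℂ v + ζ) ^ 2 / (1 + k ^ 2 : ℝ)) := by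
  have hk : (0 : ℝ) < 1 + k ^ 2 := by positivity
  have hk' : ((1 + k ^ 2 : ℝ) : ℂ) ≠ 0 := by exact_mod_cast hk.ne'
  have e : (fun x : ℝ => gaussFun ζ x * starRingEnd ℂ (gaussFun v (k * x))) = fun x : ℝ =>
      Complex.exp ((-((1 + k ^ 2) / 2) : ℝ) * x ^ 2 +
        ((√2 : ℝ) * (k * starRingEnd ℂ v + ζ)) * x + 0) := by
    funext x
    simp only [gaussFun]
    rw [← Complex.exp_conj, ← Complex.exp_add]
    congr 1
    simp only [map_add, map_neg, map_div₀, map_mul, map_pow, Complex.conj_ofReal, map_ofNat]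
    push_cast
    ring
  rw [e, integral_cexp_quadratic (by rw [Complex.ofReal_re]; linarith)]
  congr 1
  · rw [Real.sqrt_eq_rpow, Complex.ofReal_cpow (by positivity [Real.pi_pos])]
    congr 1
    · push_cast at hk' ⊢
      field_simp
    · norm_num
  · congr 1
    rw [mul_pow, ← Complex.ofReal_pow, Real.sq_sqrt (by norm_num)]
    push_cast at hk' ⊢
    field_simp
    ring

theorem inner_gaussVec (z w : ℂ) : inner ℂ (gaussVec z) (gaussVec w) =
    (√Real.pi : ℝ) * Complex.exp ((starRingEnd ℂ z + w) ^ 2 / 2) := by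
  rw [inner_eq_integral (coeFn_gaussVec z) (coeFn_gaussVec w)]
  have h := integral_gaussFun_mul_conj 1 z w
  simp only [one_mul] at h
  rw [h]
  norm_num

theorem conjugation_gaussVec (z : ℂ) : conjugation (gaussVec z) = gaussVec (starRingEnd ℂ z) := by
  refine Lp.ext ?_
  change (star (gaussVec z) : Mode) =ᵐ[volume] _
  filter_upwards [Lp.coeFn_star (gaussVec z), coeFn_gaussVec z,
    coeFn_gaussVec (starRingEnd ℂ z)] with x h1 h2 h3
  rw [h1, h3, Pi.star_apply, h2, gaussFun, gaussFun]
  change starRingEnd ℂ _ = _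
  rw [← Complex.exp_conj]
  simp [map_ofNat]

/-! ### Weyl operators -/

theorem coeFn_translation (q : ℝ) (ψ : Mode) :
    translation q ψ =ᵐ[volume] fun x => ψ (x - q) :=
  Lp.coeFn_compMeasurePreserving ψ (measurePreserving_sub_right volume q)

theorem coeFn_phaseMul (p : ℝ) (ψ : Mode) :
    phaseMul p ψ =ᵐ[volume] fun x => Complex.exp (Complex.I * p * x) * ψ x :=
  (memLp_phase p ψ).coeFn_toLp

theorem coeFn_weyl (z : ℝ × ℝ) (ψ : Mode) :
    weyl z ψ =ᵐ[volume] fun x =>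
      Complex.exp (Complex.I * (z.2 * x - z.1 * z.2 / 2)) * ψ (x - z.1) := by
  have h1 : ∀ᵐ x : ℝ, phaseMul z.2 ψ (x - z.1) =
      Complex.exp (Complex.I * z.2 * (x - z.1 : ℝ)) * ψ (x - z.1) :=
    (measurePreserving_sub_right volume z.1).quasiMeasurePreserving.ae (coeFn_phaseMul z.2 ψ)
  filter_upwards [Lp.coeFn_smul (Complex.exp (Complex.I * (z.1 * z.2 / 2)))
    (translation z.1 (phaseMul z.2 ψ)), coeFn_translation z.1 (phaseMul z.2 ψ), h1] with x h2 h3 h4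
  change (Complex.exp (Complex.I * (z.1 * z.2 / 2)) • translation z.1 (phaseMul z.2 ψ)) x = _
  rw [h2, Pi.smul_apply, h3, h4, smul_eq_mul, ← mul_assoc, ← Complex.exp_add]
  congr 2
  push_cast
  ring

/-- The Weyl relations. They supply inverses and adjoints of the Weyl operators here, and covariance
at the end. -/
theorem weyl_weyl_apply (a b : ℝ × ℝ) (ψ : Mode) :
    weyl a (weyl b ψ) =
      Complex.exp (Complex.I * ((b.1 * a.2 - a.1 * b.2) / 2)) • weyl (a + b) ψ := by
  refine Lp.ext ?_
  have h1 := (measurePreserving_sub_right volume a.1).quasiMeasurePreserving.ae (coeFn_weyl b ψ)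
  filter_upwards [coeFn_weyl a (weyl b ψ), h1, coeFn_weyl (a + b) ψ,
    Lp.coeFn_smul (Complex.exp (Complex.I * ((b.1 * a.2 - a.1 * b.2) / 2)))
      (weyl (a + b) ψ)] with x h2 h3 h4 h5
  rw [h2, h3, h5, Pi.smul_apply, h4, smul_eq_mul, ← mul_assoc, ← mul_assoc, ← Complex.exp_add,
    ← Complex.exp_add]
  have e : x - (a + b).1 = x - a.1 - b.1 := by rw [Prod.fst_add]; ring
  rw [e]
  congr 2
  simp only [Prod.fst_add, Prod.snd_add]
  push_cast
  ring

theorem weyl_zero_apply (ψ : Mode) : weyl 0 ψ = ψ := by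
  refine Lp.ext ?_
  filter_upwards [coeFn_weyl 0 ψ] with x h
  simp [h]

theorem norm_weyl_apply (a : ℝ × ℝ) (ψ : Mode) : ‖weyl a ψ‖ = ‖ψ‖ := by
  have hle : ∀ a ψ, ‖weyl a ψ‖ ≤ ‖ψ‖ := by
    intro a ψ
    have h1 : ‖weyl a ψ‖ ≤ ‖translation a.1 ψ‖ := by
      refine Lp.norm_le_norm_of_ae_le ?_
      filter_upwards [coeFn_weyl a ψ, coeFn_translation a.1 ψ] with x h1 h2
      rw [h1, h2, norm_mul, Complex.norm_exp]
      simp [Complex.sub_im]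
    refine h1.trans_eq ?_
    exact (Lp.compMeasurePreservingₗᵢ ℂ (fun x : ℝ => x - a.1)
      (measurePreserving_sub_right volume a.1)).norm_map ψ
  refine le_antisymm (hle a ψ) ?_
  -- The symplectic phase vanishes for the pair (-a, a), so `weyl (-a)` is a contractive left
  -- inverse.
  have h := hle (-a) (weyl a ψ)
  rw [weyl_weyl_apply] at h
  simpa [mul_comm, weyl_zero_apply] using h

theorem inner_weyl_weyl (a : ℝ × ℝ) (φ ψ : Mode) :
    inner ℂ (weyl a φ) (weyl a ψ) = inner ℂ φ ψ :=
  (LinearMap.norm_map_iff_inner_map_map (weyl a)).1 (norm_weyl_apply a) φ ψ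

theorem adjoint_weyl (a : ℝ × ℝ) : ContinuousLinearMap.adjoint (weyl a) = weyl (-a) := by
  symm
  rw [ContinuousLinearMap.eq_adjoint_iff]
  intro φ ψ
  rw [← inner_weyl_weyl a, weyl_weyl_apply]
  simp [mul_comm, weyl_zero_apply]

theorem weyl_gaussVec (a : ℝ × ℝ) (ζ : ℂ) :
    weyl a (gaussVec ζ) =
      Complex.exp (-(Complex.I * (a.1 * a.2 / 2)) - a.1 ^ 2 / 2 - (√2 : ℝ) * ζ * a.1) •
        gaussVec (ζ + (a.1 + Complex.I * a.2) / (√2 : ℝ)) := by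
  refine Lp.ext ?_
  have h1 := (measurePreserving_sub_right volume a.1).quasiMeasurePreserving.ae (coeFn_gaussVec ζ)
  filter_upwards [coeFn_weyl a (gaussVec ζ), h1, Lp.coeFn_smul
    (Complex.exp (-(Complex.I * (a.1 * a.2 / 2)) - a.1 ^ 2 / 2 - (√2 : ℝ) * ζ * a.1))
    (gaussVec (ζ + (a.1 + Complex.I * a.2) / (√2 : ℝ))),
    coeFn_gaussVec (ζ + (a.1 + Complex.I * a.2) / (√2 : ℝ))] with x h2 h3 h4 h5
  rw [h2, h3, h4, Pi.smul_apply, h5, smul_eq_mul, gaussFun, gaussFun, ← Complex.exp_add,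
    ← Complex.exp_add]
  have h6 : ((√2 : ℝ) : ℂ) ≠ 0 := by norm_num
  congr 1
  rw [mul_add (((√2 : ℝ)) : ℂ), mul_div_cancel₀ _ h6]
  push_cast
  ring

/-! ### Traces and ensembles -/

section Ensemble

variable {K : Type*} [NormedAddCommGroup K] [InnerProductSpace ℂ K] {ι κ : Type*}

/-- `ρ = ∑ₖ |vₖ⟩⟨vₖ|` with `∑ₖ ‖vₖ‖² < ∞`. -/
def IsEnsemble (ρ : K →L[ℂ] K) (v : ι → K) : Prop :=
  (Summable fun k => ‖v k‖ ^ 2) ∧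
    ∀ x y, HasSum (fun k => inner ℂ x (v k) * inner ℂ (v k) y) (inner ℂ x (ρ y))

theorem hasSum_norm_inner_sq (b : HilbertBasis ι ℂ K) (x : K) :
    HasSum (fun i => ‖inner ℂ (b i) x‖ ^ 2) (‖x‖ ^ 2) := by
  have h := Complex.hasSum_re (b.hasSum_inner_mul_inner x x)
  have e : (inner ℂ x x).re = ‖x‖ ^ 2 := (norm_sq_eq_re_inner (𝕜 := ℂ) x).symm
  rw [e] at h
  refine h.congr_fun fun i => ?_
  rw [← inner_conj_symm x, Complex.conj_mul', ← Complex.ofReal_pow, Complex.ofReal_re]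

theorem isEnsemble_rankOne (φ : K) :
    IsEnsemble (InnerProductSpace.rankOne ℂ φ φ) fun _ : Unit => φ := by
  refine ⟨(hasSum_fintype _).summable, fun x y => ?_⟩
  simp [mul_comm]

variable [CompleteSpace K]

/-- The trace of `ρA` can be computed from any Hilbert basis, or from an ensemble of `ρ`. -/
theorem IsEnsemble.hasSum_trace {ρ : K →L[ℂ] K} {v : ι → K} (h : IsEnsemble ρ v)
    (A : K →L[ℂ] K) (b : HilbertBasis κ ℂ K) :
    ∃ S : ℂ, HasSum (fun i => inner ℂ (b i) (ρ (A (b i)))) S ∧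
      HasSum (fun k => inner ℂ (v k) (A (v k))) S := by
  set A' := ContinuousLinearMap.adjoint A
  -- Parseval sums these squares over the basis to at most (1 + ‖A*‖²)‖v_k‖². They dominate the
  -- double family ⟨b_i, v_k⟩⟨v_k, A b_i⟩, which may therefore be summed in either order.
  have hG : Summable fun p : ι × κ =>
      ‖inner ℂ (b p.2) (v p.1)‖ ^ 2 + ‖inner ℂ (b p.2) (A' (v p.1))‖ ^ 2 := by
    rw [summable_prod_of_nonneg fun p => by positivity]
    have h1 : ∀ k, HasSum (fun i => ‖inner ℂ (b i) (v k)‖ ^ 2 + ‖inner ℂ (b i) (A' (v k))‖ ^ 2)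
        (‖v k‖ ^ 2 + ‖A' (v k)‖ ^ 2) := fun k =>
      (hasSum_norm_inner_sq b _).add (hasSum_norm_inner_sq b _)
    refine ⟨fun k => (h1 k).summable, ?_⟩
    simp only [fun k => (h1 k).tsum_eq]
    refine Summable.of_nonneg_of_le (fun k => by positivity) (fun k => ?_)
      (h.1.mul_left (1 + ‖A'‖ ^ 2))
    have := A'.le_opNorm (v k)
    have h2 : ‖A' (v k)‖ ^ 2 ≤ (‖A'‖ * ‖v k‖) ^ 2 := by gcongr
    linarith [mul_pow ‖A'‖ ‖v k‖ 2]
  have hF : Summable fun p : ι × κ => inner ℂ (b p.2) (v p.1) * inner ℂ (v p.1) (A (b p.2)) := by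
    refine Summable.of_norm_bounded hG fun p => ?_
    rw [norm_mul, ← ContinuousLinearMap.adjoint_inner_left, norm_inner_symm (A' (v p.1))]
    nlinarith [sq_nonneg (‖inner ℂ (b p.2) (v p.1)‖ - ‖inner ℂ (b p.2) (A' (v p.1))‖),
      sq_nonneg ‖inner ℂ (b p.2) (v p.1)‖, sq_nonneg ‖inner ℂ (b p.2) (A' (v p.1))‖]
  obtain ⟨S, hS⟩ := hF
  have hS' : HasSum (fun p : κ × ι => inner ℂ (b p.1) (v p.2) * inner ℂ (v p.2) (A (b p.1))) S :=
    (Equiv.prodComm κ ι).hasSum_iff.2 hS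
  refine ⟨S, hS'.prod_fiberwise fun i => h.2 (b i) (A (b i)), hS.prod_fiberwise fun k => ?_⟩
  have h3 := b.hasSum_inner_mul_inner (A' (v k)) (v k)
  rw [ContinuousLinearMap.adjoint_inner_left] at h3
  refine h3.congr_fun fun i => ?_
  rw [ContinuousLinearMap.adjoint_inner_left, mul_comm]

/-- Frees `trace` from the arbitrary basis in its definition: every trace below is evaluated through
an ensemble. -/
theorem IsEnsemble.trace_mul {ρ : K →L[ℂ] K} {v : ι → K} (h : IsEnsemble ρ v)
    (A : K →L[ℂ] K) : HasSum (fun k => inner ℂ (v k) (A (v k))) (trace (ρ * A)) := by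
  obtain ⟨S, h1, h2⟩ := h.hasSum_trace A (exists_hilbertBasis ℂ K).choose_spec.choose
  have : trace (ρ * A) = S := h1.tsum_eq
  rwa [this]

theorem IsEnsemble.isState {ρ : K →L[ℂ] K} {v : ι → K} (h : IsEnsemble ρ v)
    (h1 : HasSum (fun k => ‖v k‖ ^ 2) 1) : IsState ρ := by
  constructor
  · rw [ContinuousLinearMap.isPositive_iff_complex]
    intro x
    have h3 : HasSum (fun k => ((‖inner ℂ (v k) x‖ ^ 2 : ℝ) : ℂ)) (inner ℂ x (ρ x)) := by
      refine (h.2 x x).congr_fun fun k => ?_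
      rw [← inner_conj_symm x, Complex.conj_mul', Complex.ofReal_pow]
    obtain ⟨r, hr⟩ := Complex.summable_ofReal.1 h3.summable
    have h4 : inner ℂ x (ρ x) = (r : ℂ) := h3.unique (Complex.hasSum_ofReal.2 hr)
    have h5 : inner ℂ (ρ x) x = (r : ℂ) := by rw [← inner_conj_symm, h4, Complex.conj_ofReal]
    rw [h5]
    exact ⟨rfl, hr.nonneg fun k => by positivity⟩
  · have h2 := h.trace_mul 1
    rw [mul_one] at h2
    refine h2.unique ?_
    have h3 := Complex.hasSum_ofReal.2 h1
    refine h3.congr_fun fun k => ?_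
    simp [inner_self_eq_norm_sq_to_K]

theorem exists_root {ρ : K →L[ℂ] K} (hρ : ρ.IsPositive) :
    ∃ B : K →L[ℂ] K, IsSelfAdjoint B ∧ B * B = ρ := by
  have h : 0 ≤ ρ := (ContinuousLinearMap.nonneg_iff_isPositive ρ).2 hρ
  exact ⟨CFC.sqrt ρ, (CFC.sqrt_nonneg ρ).isSelfAdjoint, CFC.sqrt_mul_sqrt_self ρ h⟩

theorem hasSum_inner_root {B : K →L[ℂ] K} (hB : IsSelfAdjoint B) (b : HilbertBasis ι ℂ K)
    (x y : K) :
    HasSum (fun k => inner ℂ x (B (b k)) * inner ℂ (B (b k)) y) (inner ℂ x ((B * B) y)) := by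
  have hs : ∀ x y, inner ℂ (B x) y = inner ℂ x (B y) := hB.isSymmetric
  have h := b.hasSum_inner_mul_inner (B x) (B y)
  simp only [hs x, ← hs _ y] at h
  exact h

/-- For ρ = B² the vectors B b_k form an ensemble in any Hilbert basis. The basis chosen in `trace`
is used first; exchanging sums transports the total weight 1 to the basis b. -/
theorem IsState.summable_root {ρ : K →L[ℂ] K} (hρ : IsState ρ) {B : K →L[ℂ] K}
    (hB : IsSelfAdjoint B) (h : B * B = ρ) (b : HilbertBasis ι ℂ K) :
    IsEnsemble ρ (fun k => B (b k)) ∧ HasSum (fun k => ‖B (b k)‖ ^ 2) 1 := by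
  set c := (exists_hilbertBasis ℂ K).choose_spec.choose with hc
  have hs : ∀ x y, inner ℂ (B x) y = inner ℂ x (B y) := hB.isSymmetric
  have hn : ∀ x, inner ℂ x (ρ x) = ((‖B x‖ ^ 2 : ℝ) : ℂ) := fun x => by
    rw [← h, mul_apply_eq_comp, ← hs, inner_self_eq_norm_sq_to_K]
    simp
  have h1 : ∑' i, inner ℂ (c i) (ρ (c i)) = 1 := hρ.2
  -- A divergent series has sum 0 by convention, so trace one already contains convergence.
  have h2 : Summable fun i => inner ℂ (c i) (ρ (c i)) := by
    by_contra hcon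
    rw [tsum_eq_zero_of_not_summable hcon] at h1
    exact zero_ne_one h1
  have h3 : HasSum (fun i => inner ℂ (c i) (ρ (c i))) 1 := h1 ▸ h2.hasSum
  simp only [hn] at h2 h3
  have hE : IsEnsemble ρ fun k => B (c k) :=
    ⟨Complex.summable_ofReal.1 h2, fun x y => h ▸ hasSum_inner_root hB c x y⟩
  obtain ⟨S, h4, h5⟩ := hE.hasSum_trace 1 b
  have hS : S = 1 := by
    refine h5.unique (h3.congr_fun fun k => ?_)
    simp [inner_self_eq_norm_sq_to_K]
  have h6 : HasSum (fun k => ‖B (b k)‖ ^ 2) 1 := by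
    rw [← Complex.hasSum_ofReal, Complex.ofReal_one, ← hS]
    refine h4.congr_fun fun k => ?_
    rw [← hn]; rfl
  exact ⟨⟨h6.summable, fun x y => h ▸ hasSum_inner_root hB b x y⟩, h6⟩

theorem IsEnsemble.conj {L : Type*} [NormedAddCommGroup L] [InnerProductSpace ℂ L]
    [CompleteSpace L] {ρ : K →L[ℂ] K} {v : ι → K} (h : IsEnsemble ρ v) (T : K →L[ℂ] L) :
    IsEnsemble (T.comp (ρ.comp (ContinuousLinearMap.adjoint T))) (fun k => T (v k)) := by
  refine ⟨Summable.of_nonneg_of_le (fun k => by positivity) (fun k => ?_)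
    (h.1.mul_left (‖T‖ ^ 2)), fun x y => ?_⟩
  · rw [← mul_pow]
    have := T.le_opNorm (v k)
    gcongr
  · have := h.2 (ContinuousLinearMap.adjoint T x) (ContinuousLinearMap.adjoint T y)
    simp only [ContinuousLinearMap.adjoint_inner_left, ContinuousLinearMap.adjoint_inner_right]
      at this
    exact this

/-- The rank one projection on a unit vector is a state. -/
theorem isState_rankOne {φ : K} (hφ : ‖φ‖ = 1) : IsState (InnerProductSpace.rankOne ℂ φ φ) := by
  refine (isEnsemble_rankOne φ).isState ?_
  simp [hφ]

end Ensemble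

/-! ### The two-mode space -/

theorem tensorOp_tensorVec (A B : Mode →L[ℂ] Mode) (φ ψ : Mode) :
    tensorOp A B (tensorVec φ ψ) = tensorVec (A φ) (B ψ) := by
  rw [tensorOp, tensorVec, ContinuousLinearMap.completion_apply_coe]
  rfl

theorem inner_tensorVec (φ ψ φ' ψ' : Mode) :
    inner ℂ (tensorVec φ ψ) (tensorVec φ' ψ') = inner ℂ φ φ' * inner ℂ ψ ψ' := by
  rw [tensorVec, tensorVec, UniformSpace.Completion.inner_coe, TensorProduct.inner_tmul]

theorem norm_tensorVec (φ ψ : Mode) : ‖tensorVec φ ψ‖ = ‖φ‖ * ‖ψ‖ := by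
  rw [tensorVec, UniformSpace.Completion.norm_coe, TensorProduct.norm_tmul]

/-- `φ ⊗ ψ` as a continuous bilinear map. -/
def tensorVecL : Mode →L[ℂ] Mode →L[ℂ] TwoModes :=
  (ContinuousLinearMap.compL ℂ Mode (Mode ⊗[ℂ] Mode) TwoModes
    UniformSpace.Completion.toComplL).comp (TensorProduct.mkL ℂ Mode Mode)

theorem tensorVecL_apply (φ ψ : Mode) : tensorVecL φ ψ = tensorVec φ ψ := rfl

/-- The density principle that is applied in one tensor factor at a time to obtain total families of
simple tensors. -/
theorem apply_mem_of_total {E F ι : Type*} [NormedAddCommGroup E] [NormedSpace ℂ E]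
    [NormedAddCommGroup F] [NormedSpace ℂ F] {e : ι → E}
    (he : (Submodule.span ℂ (Set.range e)).topologicalClosure = ⊤) (T : E →L[ℂ] F)
    {S : Submodule ℂ F} (hS : IsClosed (S : Set F)) (h : ∀ i, T (e i) ∈ S) (x : E) : T x ∈ S := by
  have h1 : (Submodule.span ℂ (Set.range e)).topologicalClosure ≤ S.comap T.toLinearMap := by
    refine Submodule.topologicalClosure_minimal _ (Submodule.span_le.2 ?_) ?_
    · rintro _ ⟨i, rfl⟩; exact h i
    · exact hS.preimage T.continuous
  exact h1 (he ▸ Submodule.mem_top)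

theorem eq_top_of_tensorVec_mem {S : Submodule ℂ TwoModes} (hS : IsClosed (S : Set TwoModes))
    (h : ∀ φ ψ, tensorVec φ ψ ∈ S) : S = ⊤ := by
  rw [Submodule.eq_top_iff']
  intro t
  induction t using UniformSpace.Completion.induction_on with
  | hp => exact hS
  | ih a =>
    induction a using TensorProduct.induction_on with
    | zero => rw [UniformSpace.Completion.coe_zero]; exact S.zero_mem
    | tmul φ ψ => exact h φ ψ
    | add x y hx hy =>
      rw [UniformSpace.Completion.coe_add]
      exact S.add_mem hx hy

/-- A family of simple tensors built from two total families is total. -/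
theorem topologicalClosure_span_tensorVec {ι κ : Type*} {e : ι → Mode} {f : κ → Mode}
    (he : (Submodule.span ℂ (Set.range e)).topologicalClosure = ⊤)
    (hf : (Submodule.span ℂ (Set.range f)).topologicalClosure = ⊤) :
    (Submodule.span ℂ (Set.range fun p : ι × κ => tensorVec (e p.1) (f p.2))).topologicalClosure
      = ⊤ := by
  have hc := Submodule.isClosed_topologicalClosure
    (Submodule.span ℂ (Set.range fun p : ι × κ => tensorVec (e p.1) (f p.2)))
  refine eq_top_of_tensorVec_mem hc fun φ ψ => ?_
  refine apply_mem_of_total he (tensorVecL.flip ψ) hc (fun i => ?_) φ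
  refine apply_mem_of_total hf (tensorVecL (e i)) hc (fun k => ?_) ψ
  exact Submodule.le_topologicalClosure _ (Submodule.subset_span ⟨(i, k), rfl⟩)

theorem topologicalClosure_span_numberState :
    (Submodule.span ℂ (Set.range numberState)).topologicalClosure = ⊤ := by
  rw [← coe_numberBasis]; exact numberBasis.dense_span

theorem topologicalClosure_span_id {E : Type*} [NormedAddCommGroup E] [NormedSpace ℂ E] :
    (Submodule.span ℂ (Set.range (id : E → E))).topologicalClosure = ⊤ := by
  rw [Submodule.eq_top_iff']
  exact fun x => Submodule.le_topologicalClosure _ (Submodule.subset_span ⟨x, rfl⟩)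

/-- Bounded operators on the two-mode space are determined by their values on simple tensors. -/
theorem ext_tensorVec {F : Type*} [NormedAddCommGroup F] [NormedSpace ℂ F]
    {S T : TwoModes →L[ℂ] F} (h : ∀ φ ψ, S (tensorVec φ ψ) = T (tensorVec φ ψ)) : S = T := by
  refine ContinuousLinearMap.ext_on (Submodule.dense_iff_topologicalClosure_eq_top.2
    (topologicalClosure_span_tensorVec topologicalClosure_span_id topologicalClosure_span_id)) ?_
  rintro _ ⟨p, rfl⟩
  exact h _ _

theorem tensorOp_mul (A B A' B' : Mode →L[ℂ] Mode) :
    tensorOp A B * tensorOp A' B' = tensorOp (A * A') (B * B') := by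
  refine ext_tensorVec fun φ ψ => ?_
  rw [mul_apply_eq_comp, tensorOp_tensorVec, tensorOp_tensorVec, tensorOp_tensorVec]
  rfl

theorem adjoint_tensorOp (A B : Mode →L[ℂ] Mode) :
    ContinuousLinearMap.adjoint (tensorOp A B) =
      tensorOp (ContinuousLinearMap.adjoint A) (ContinuousLinearMap.adjoint B) := by
  refine ext_tensorVec fun φ ψ => ?_
  refine ext_inner_left ℂ fun t => ?_
  have h : (innerSL ℂ (tensorVec φ ψ)).comp (tensorOp A B) =
      innerSL ℂ (tensorVec (ContinuousLinearMap.adjoint A φ) (ContinuousLinearMap.adjoint B ψ)) := by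
    refine ext_tensorVec fun φ' ψ' => ?_
    simp [tensorOp_tensorVec, inner_tensorVec, ContinuousLinearMap.adjoint_inner_left]
  have h2 := DFunLike.congr_fun h t
  simp only [ContinuousLinearMap.comp_apply, innerSL_apply_apply] at h2
  rw [ContinuousLinearMap.adjoint_inner_right, tensorOp_tensorVec, ← inner_conj_symm, h2,
    inner_conj_symm]

/-- The product basis of the two-mode space. -/
def tensorBasis : HilbertBasis (ℕ × ℕ) ℂ TwoModes :=
  HilbertBasis.mk (v := fun p : ℕ × ℕ => tensorVec (numberState p.1) (numberState p.2))
    (by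
      rw [orthonormal_iff_ite]
      intro p q
      rw [inner_tensorVec, orthonormal_iff_ite.1 orthonormal_numberState,
        orthonormal_iff_ite.1 orthonormal_numberState]
      rcases p with ⟨a, b⟩
      rcases q with ⟨c, d⟩
      by_cases h1 : a = c <;> by_cases h2 : b = d <;> simp [h1, h2])
    (topologicalClosure_span_tensorVec topologicalClosure_span_numberState
      topologicalClosure_span_numberState).ge

theorem tensorBasis_apply (p : ℕ × ℕ) :
    tensorBasis p = tensorVec (numberState p.1) (numberState p.2) := by
  simp [tensorBasis]

/-- Product ensembles. -/
theorem isEnsemble_tensorOp {A B : Mode →L[ℂ] Mode} (hA : IsSelfAdjoint A) (hB : IsSelfAdjoint B)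
    (h1 : Summable fun n => ‖A (numberState n)‖ ^ 2)
    (h2 : Summable fun n => ‖B (numberState n)‖ ^ 2) :
    IsEnsemble (tensorOp (A * A) (B * B))
      fun p : ℕ × ℕ => tensorVec (A (numberState p.1)) (B (numberState p.2)) := by
  constructor
  · simp only [norm_tensorVec, mul_pow]
    exact h1.mul_of_nonneg h2 (fun _ => by positivity) (fun _ => by positivity)
  · intro x y
    have hs : IsSelfAdjoint (tensorOp A B) := by
      rw [ContinuousLinearMap.isSelfAdjoint_iff', adjoint_tensorOp]
      rw [ContinuousLinearMap.isSelfAdjoint_iff'.1 hA, ContinuousLinearMap.isSelfAdjoint_iff'.1 hB]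
    have := hasSum_inner_root hs tensorBasis x y
    simpa only [tensorOp_mul, tensorBasis_apply, tensorOp_tensorVec] using this

/-! ### The beam splitter -/

/-- Two total families with the same Gram matrix are related by a unitary operator. -/
theorem exists_unitary_of_gram {K L ι : Type*} [NormedAddCommGroup K] [InnerProductSpace ℂ K]
    [CompleteSpace K] [NormedAddCommGroup L] [InnerProductSpace ℂ L] [CompleteSpace L]
    {e : ι → K} {f : ι → L} (h : ∀ i j, inner ℂ (e i) (e j) = inner ℂ (f i) (f j))
    (he : (Submodule.span ℂ (Set.range e)).topologicalClosure = ⊤)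
    (hf : (Submodule.span ℂ (Set.range f)).topologicalClosure = ⊤) :
    ∃ U : K ≃ₗᵢ[ℂ] L, ∀ i, U (e i) = f i := by
  have hd1 : DenseRange (Finsupp.linearCombination ℂ e) := by
    rw [DenseRange, ← LinearMap.coe_range, Finsupp.range_linearCombination,
      Submodule.dense_iff_topologicalClosure_eq_top]
    exact he
  have hd2 : DenseRange (Finsupp.linearCombination ℂ f) := by
    rw [DenseRange, ← LinearMap.coe_range, Finsupp.range_linearCombination,
      Submodule.dense_iff_topologicalClosure_eq_top]
    exact hf
  -- Equal Gram matrices give equal norms to finite combinations with the same coefficients, so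
  -- identifying coefficients is isometric; density of both families makes the extension bijective.
  have hn : ∀ c : ι →₀ ℂ, ‖Finsupp.linearCombination ℂ f (LinearEquiv.refl ℂ _ c)‖ =
      ‖Finsupp.linearCombination ℂ e c‖ := by
    intro c
    have h1 : inner ℂ (Finsupp.linearCombination ℂ f c) (Finsupp.linearCombination ℂ f c) =
        inner ℂ (Finsupp.linearCombination ℂ e c) (Finsupp.linearCombination ℂ e c) := by
      simp only [Finsupp.linearCombination_apply, Finsupp.sum, sum_inner, inner_sum,
        inner_smul_left, inner_smul_right, h]
    rw [LinearEquiv.refl_apply, norm_eq_sqrt_re_inner (𝕜 := ℂ), norm_eq_sqrt_re_inner (𝕜 := ℂ), h1]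
  refine ⟨(LinearEquiv.refl ℂ (ι →₀ ℂ)).extendOfIsometry (Finsupp.linearCombination ℂ e)
    (Finsupp.linearCombination ℂ f) hd1 hd2 hn, fun i => ?_⟩
  have := LinearEquiv.extendOfIsometry_eq (LinearEquiv.refl ℂ (ι →₀ ℂ)) _ _ hd1 hd2 hn
    (Finsupp.single i 1)
  simpa using this

theorem tensorVec_smul_smul (a b : ℂ) (φ ψ : Mode) :
    tensorVec (a • φ) (b • ψ) = (a * b) • tensorVec φ ψ := by
  simp only [← tensorVecL_apply, map_smul, smul_apply, smul_smul, mul_comm]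

/-- A unitary with the right values on Gaussian vectors acts as the beam splitter should on
coherent states. -/
theorem beamSplitter_coherent_iff (U : TwoModes ≃ₗᵢ[ℂ] TwoModes) (z w : ℂ) :
    U (tensorVec (coherentState z) (coherentState w)) =
      tensorVec (coherentState ((z - w) / (√2 : ℝ))) (coherentState ((z + w) / (√2 : ℝ))) ↔
    U (tensorVec (gaussVec z) (gaussVec w)) =
      tensorVec (gaussVec ((z - w) / (√2 : ℝ))) (gaussVec ((z + w) / (√2 : ℝ))) := by
  have hpi := Real.pi_pos
  have h2 : ((√2 : ℝ) : ℂ) ^ 2 = 2 := by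
    rw [← Complex.ofReal_pow, Real.sq_sqrt (by norm_num)]; simp
  have hc : ∀ z w : ℂ, ((Real.exp (-(‖z‖ ^ 2 / 2)) : ℂ) *
      (((√(√Real.pi))⁻¹ : ℝ) * Complex.exp (-(z ^ 2 / 2)))) *
      ((Real.exp (-(‖w‖ ^ 2 / 2)) : ℂ) *
      (((√(√Real.pi))⁻¹ : ℝ) * Complex.exp (-(w ^ 2 / 2)))) =
      ((Real.exp (-((‖z‖ ^ 2 + ‖w‖ ^ 2) / 2)) : ℝ) : ℂ) * (((√(√Real.pi))⁻¹ ^ 2 : ℝ) *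
        Complex.exp (-((z ^ 2 + w ^ 2) / 2))) := by
    intro z w
    have e1 : -((‖z‖ ^ 2 + ‖w‖ ^ 2) / 2) = -(‖z‖ ^ 2 / 2) + -(‖w‖ ^ 2 / 2) := by ring
    have e2 : -((z ^ 2 + w ^ 2) / 2) = -(z ^ 2 / 2) + -(w ^ 2 / 2) := by ring
    rw [e1, e2, Complex.exp_add, Real.exp_add]
    push_cast
    ring
  -- The normalizing factor of a product of coherent states depends only on ‖z‖² + ‖w‖² and z² + w².
  -- Both are invariant under the rotation by 45°, so the factor cancels.
  have e1 : ‖(z - w) / (√2 : ℝ)‖ ^ 2 + ‖(z + w) / (√2 : ℝ)‖ ^ 2 = ‖z‖ ^ 2 + ‖w‖ ^ 2 := by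
    have := parallelogram_law_with_norm ℝ z w
    simp only [norm_div, Complex.norm_real, Real.norm_eq_abs, div_pow, sq_abs]
    rw [Real.sq_sqrt (by norm_num)]
    linarith
  have e2 : ((z - w) / (√2 : ℝ)) ^ 2 + ((z + w) / (√2 : ℝ)) ^ 2 = z ^ 2 + w ^ 2 := by
    rw [div_pow, div_pow, h2]; ring
  simp only [coherentState_eq, tensorVec_smul_smul, hc, e1, e2, map_smul]
  refine (smul_right_injective TwoModes ?_).eq_iff
  refine mul_ne_zero ?_ (mul_ne_zero ?_ (Complex.exp_ne_zero _))
  · exact_mod_cast (Real.exp_pos _).ne'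
  · norm_cast; positivity

/-- A Gram entry is π exp(½[(z̄ + z')² + (w̄ + w')²]), and a sum of two squares is invariant under a
real rotation. The rotation maps ℂ² onto itself, so the image family is the same total family. -/
theorem exists_beamSplitter : ∃ U : TwoModes ≃ₗᵢ[ℂ] TwoModes, ∀ z w : ℂ,
    U (tensorVec (gaussVec z) (gaussVec w)) =
      tensorVec (gaussVec ((z - w) / (√2 : ℝ))) (gaussVec ((z + w) / (√2 : ℝ))) := by
  have h2 : ((√2 : ℝ) : ℂ) ^ 2 = 2 := by
    rw [← Complex.ofReal_pow, Real.sq_sqrt (by norm_num)]; simp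
  have h0 : ((√2 : ℝ) : ℂ) ≠ 0 := by norm_num
  have hd := topologicalClosure_span_tensorVec topologicalClosure_span_gaussVec
    topologicalClosure_span_gaussVec
  have hg : ∀ p q : ℂ × ℂ, inner ℂ (tensorVec (gaussVec p.1) (gaussVec p.2))
      (tensorVec (gaussVec q.1) (gaussVec q.2)) =
      inner ℂ (tensorVec (gaussVec ((p.1 - p.2) / (√2 : ℝ))) (gaussVec ((p.1 + p.2) / (√2 : ℝ))))
      (tensorVec (gaussVec ((q.1 - q.2) / (√2 : ℝ))) (gaussVec ((q.1 + q.2) / (√2 : ℝ)))) := by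
    intro p q
    simp only [inner_tensorVec, inner_gaussVec]
    rw [mul_mul_mul_comm, mul_mul_mul_comm _ _ ((√Real.pi : ℝ) : ℂ), ← Complex.exp_add,
      ← Complex.exp_add]
    congr 2
    simp only [map_div₀, Complex.conj_ofReal, map_sub, map_add, ← add_div, div_pow, h2]
    ring
  have hd' : (Submodule.span ℂ (Set.range fun p : ℂ × ℂ =>
      tensorVec (gaussVec ((p.1 - p.2) / (√2 : ℝ)))
        (gaussVec ((p.1 + p.2) / (√2 : ℝ))))).topologicalClosure = ⊤ := by
    rw [← hd]
    congr 2
    refine Function.Surjective.range_comp (g := fun p : ℂ × ℂ =>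
      tensorVec (gaussVec p.1) (gaussVec p.2)) (f := fun p : ℂ × ℂ =>
      ((p.1 - p.2) / ((√2 : ℝ) : ℂ), (p.1 + p.2) / ((√2 : ℝ) : ℂ))) ?_
    rintro ⟨a, b⟩
    refine ⟨((a + b) / (√2 : ℝ), (b - a) / (√2 : ℝ)), ?_⟩
    have h3 : ∀ c : ℂ, 2 * c / (√2 : ℝ) / (√2 : ℝ) = c := fun c => by
      rw [div_div, ← sq, h2]; ring
    refine Prod.ext ?_ ?_
    · refine Eq.trans ?_ (h3 a); ring
    · refine Eq.trans ?_ (h3 b); ring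
  obtain ⟨U, hU⟩ := exists_unitary_of_gram hg hd hd'
  exact ⟨U, fun z w => hU (z, w)⟩

/-- `beamSplitter` is picked by `Classical.epsilon`, so its characterizing property becomes
available only through the existence result. -/
theorem beamSplitter_gaussVec (z w : ℂ) :
    beamSplitter (tensorVec (gaussVec z) (gaussVec w)) =
      tensorVec (gaussVec ((z - w) / (√2 : ℝ))) (gaussVec ((z + w) / (√2 : ℝ))) := by
  obtain ⟨U, hU⟩ := exists_beamSplitter
  have := Classical.epsilon_spec (p := fun U : TwoModes ≃ₗᵢ[ℂ] TwoModes => ∀ z w : ℂ,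
    U (tensorVec (coherentState z) (coherentState w)) =
      tensorVec (coherentState ((z - w) / (√2 : ℝ))) (coherentState ((z + w) / (√2 : ℝ))))
    ⟨U, fun z w => (beamSplitter_coherent_iff U z w).2 (hU z w)⟩
  exact (beamSplitter_coherent_iff _ z w).1 (this z w)

/-! ### Multiplication by indicator functions -/

section Indicator

variable {α : Type*} [MeasurableSpace α] {μ : Measure α}

open Classical in
/-- Multiplication by the indicator function of `X` (`0` if `X` is not measurable). -/
def indicatorOp (μ : Measure α) (X : Set α) : Lp ℂ 2 μ →L[ℂ] Lp ℂ 2 μ :=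
  if hX : MeasurableSet X then
    LinearMap.mkContinuous
      { toFun := fun ψ => ((Lp.memLp ψ).indicator hX).toLp _
        map_add' := fun φ ψ => by
          rw [← MemLp.toLp_add]
          refine MemLp.toLp_congr _ _ ?_
          filter_upwards [Lp.coeFn_add φ ψ] with x hx
          rw [Pi.add_apply, Set.indicator_apply, Set.indicator_apply, Set.indicator_apply, hx]
          split_ifs <;> simp
        map_smul' := fun c ψ => by
          rw [RingHom.id_apply, ← MemLp.toLp_const_smul]
          refine MemLp.toLp_congr _ _ ?_
          filter_upwards [Lp.coeFn_smul c ψ] with x hx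
          rw [Pi.smul_apply, Set.indicator_apply, Set.indicator_apply, hx]
          split_ifs <;> simp } 1
      (fun ψ => by
        rw [one_mul]
        refine Lp.norm_le_norm_of_ae_le ?_
        filter_upwards [((Lp.memLp ψ).indicator hX).coeFn_toLp] with x hx
        change ‖(((Lp.memLp ψ).indicator hX).toLp _ : Lp ℂ 2 μ) x‖ ≤ _
        rw [hx]
        exact norm_indicator_le_norm_self _ _)
  else 0

theorem coeFn_indicatorOp {X : Set α} (hX : MeasurableSet X) (ψ : Lp ℂ 2 μ) :
    indicatorOp μ X ψ =ᵐ[μ] X.indicator ψ := by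
  have : indicatorOp μ X ψ = ((Lp.memLp ψ).indicator hX).toLp _ := by
    simp only [indicatorOp, dif_pos hX]; rfl
  rw [this]
  exact MemLp.coeFn_toLp _

theorem inner_indicatorOp {X : Set α} (hX : MeasurableSet X) (φ ψ : Lp ℂ 2 μ) :
    inner ℂ φ (indicatorOp μ X ψ) = ∫ x in X, inner ℂ (φ x) (ψ x) ∂μ := by
  rw [L2.inner_def, ← integral_indicator hX]
  refine integral_congr_ae ?_
  filter_upwards [coeFn_indicatorOp hX ψ] with x hx
  rw [hx]
  by_cases h : x ∈ X <;> simp [h]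

theorem indicatorOp_mul_self (X : Set α) :
    indicatorOp μ X * indicatorOp μ X = indicatorOp μ X := by
  by_cases hX : MeasurableSet X
  · ext1 ψ
    refine Lp.ext ?_
    filter_upwards [coeFn_indicatorOp hX ψ, coeFn_indicatorOp hX (indicatorOp μ X ψ)] with x h1 h2
    rw [mul_apply_eq_comp, h2, h1]
    by_cases h : x ∈ X <;> simp [h, h1]
  · simp [indicatorOp, hX]

theorem indicatorOp_univ : indicatorOp μ Set.univ = 1 := by
  ext1 ψ
  refine Lp.ext ?_
  filter_upwards [coeFn_indicatorOp MeasurableSet.univ ψ] with x h1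
  rw [h1]
  simp

/-- The canonical projection valued measure `X ↦ 1_X`. -/
def indicatorObservable (μ : Measure α) : Observable α (Lp ℂ 2 μ) where
  toFun := indicatorOp μ
  isPositive X hX := by
    rw [ContinuousLinearMap.isPositive_iff_complex]
    intro ψ
    have h : inner ℂ (indicatorOp μ X ψ) ψ = ((∫ x in X, ‖ψ x‖ ^ 2 ∂μ : ℝ) : ℂ) := by
      rw [← inner_conj_symm, inner_indicatorOp hX, ← integral_conj, ← integral_complex_ofReal]
      congr 1; funext x
      rw [inner_conj_symm, inner_self_eq_norm_sq_to_K]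
      simp
    rw [h]
    exact ⟨rfl, integral_nonneg fun x => by positivity⟩
  map_univ := indicatorOp_univ
  hasSum_iUnion X hX hd φ ψ := by
    simp only [inner_indicatorOp (hX _), inner_indicatorOp (MeasurableSet.iUnion hX)]
    exact hasSum_integral_iUnion hX hd (L2.integrable_inner φ ψ).integrableOn
  not_measurable X hX := by simp [indicatorOp, hX]

end Indicator

/-! ### The two-mode space as a space of functions on the plane -/

/-- `L²(ℝ²)`. -/
abbrev PlaneL2 : Type := Lp ℂ 2 (volume : Measure (ℝ × ℝ))

theorem memLp_prod (φ ψ : Mode) : MemLp (fun p : ℝ × ℝ => φ p.1 * ψ p.2) 2 volume := by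
  have hm : AEStronglyMeasurable (fun p : ℝ × ℝ => φ p.1 * ψ p.2) volume :=
    (Lp.aestronglyMeasurable φ).comp_fst.mul (Lp.aestronglyMeasurable ψ).comp_snd
  rw [memLp_two_iff_integrable_sq_norm hm]
  have h := ((memLp_two_iff_integrable_sq_norm (Lp.aestronglyMeasurable φ)).1 (Lp.memLp φ)).mul_prod
    ((memLp_two_iff_integrable_sq_norm (Lp.aestronglyMeasurable ψ)).1 (Lp.memLp ψ))
  refine h.congr (Filter.Eventually.of_forall fun p => ?_)
  simp [mul_pow]

theorem ae_fst {P : ℝ → Prop} (h : ∀ᵐ x, P x) : ∀ᵐ p : ℝ × ℝ, P p.1 :=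
  Measure.quasiMeasurePreserving_fst.ae h

theorem ae_snd {P : ℝ → Prop} (h : ∀ᵐ x, P x) : ∀ᵐ p : ℝ × ℝ, P p.2 :=
  Measure.quasiMeasurePreserving_snd.ae h

/-- The function `φ(x) ψ(y)`. -/
def prodVec : Mode →ₗ[ℂ] Mode →ₗ[ℂ] PlaneL2 :=
  LinearMap.mk₂ ℂ (fun φ ψ => (memLp_prod φ ψ).toLp _)
    (fun φ φ' ψ => by
      rw [← MemLp.toLp_add]
      refine MemLp.toLp_congr _ _ ?_
      filter_upwards [ae_fst (Lp.coeFn_add φ φ')] with p hp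
      simp only [hp, Pi.add_apply, add_mul])
    (fun c φ ψ => by
      rw [← MemLp.toLp_const_smul]
      refine MemLp.toLp_congr _ _ ?_
      filter_upwards [ae_fst (Lp.coeFn_smul c φ)] with p hp
      simp only [hp, Pi.smul_apply, smul_eq_mul, mul_assoc])
    (fun φ ψ ψ' => by
      rw [← MemLp.toLp_add]
      refine MemLp.toLp_congr _ _ ?_
      filter_upwards [ae_snd (Lp.coeFn_add ψ ψ')] with p hp
      simp only [hp, Pi.add_apply, mul_add])
    (fun c φ ψ => by
      rw [← MemLp.toLp_const_smul]
      refine MemLp.toLp_congr _ _ ?_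
      filter_upwards [ae_snd (Lp.coeFn_smul c ψ)] with p hp
      simp only [hp, Pi.smul_apply, smul_eq_mul, mul_left_comm])

theorem coeFn_prodVec (φ ψ : Mode) : prodVec φ ψ =ᵐ[volume] fun p => φ p.1 * ψ p.2 :=
  (memLp_prod φ ψ).coeFn_toLp

theorem inner_prodVec (φ ψ φ' ψ' : Mode) :
    inner ℂ (prodVec φ ψ) (prodVec φ' ψ') = inner ℂ φ φ' * inner ℂ ψ ψ' := by
  rw [L2.inner_def, L2.inner_def, L2.inner_def, ← integral_prod_mul]
  refine integral_congr_ae ?_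
  filter_upwards [coeFn_prodVec φ ψ, coeFn_prodVec φ' ψ'] with p h1 h2
  rw [h1, h2]
  simp only [RCLike.inner_apply, map_mul]
  ring

theorem inner_lift_prodVec (x y : Mode ⊗[ℂ] Mode) :
    inner ℂ (TensorProduct.lift prodVec x) (TensorProduct.lift prodVec y) = inner ℂ x y := by
  induction x using TensorProduct.induction_on with
  | zero => simp
  | add x x' hx hx' => rw [map_add, inner_add_left, inner_add_left, hx, hx']
  | tmul φ ψ =>
    induction y using TensorProduct.induction_on with
    | zero => simp
    | add y y' hy hy' => rw [map_add, inner_add_right, inner_add_right, hy, hy']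
    | tmul φ' ψ' =>
      rw [TensorProduct.lift.tmul, TensorProduct.lift.tmul, inner_prodVec, TensorProduct.inner_tmul]

theorem norm_lift_prodVec (x : Mode ⊗[ℂ] Mode) : ‖TensorProduct.lift prodVec x‖ = ‖x‖ := by
  rw [norm_eq_sqrt_re_inner (𝕜 := ℂ), norm_eq_sqrt_re_inner (𝕜 := ℂ), inner_lift_prodVec]

/-- The isometry from the two-mode space to `L²(ℝ²)` with `φ ⊗ ψ ↦ φ(x) ψ(y)`. -/
def planeRep : TwoModes →ₗᵢ[ℂ] PlaneL2 where
  toLinearMap := ((TensorProduct.lift prodVec).extendOfNorm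
    (UniformSpace.Completion.toComplL (𝕜 := ℂ) (E := Mode ⊗[ℂ] Mode)).toLinearMap).toLinearMap
  norm_map' t := by
    have hd : DenseRange (UniformSpace.Completion.toComplL (𝕜 := ℂ)
        (E := Mode ⊗[ℂ] Mode)).toLinearMap := UniformSpace.Completion.denseRange_coe
    refine hd.induction_on t ?_ fun x => ?_
    · exact isClosed_eq (by fun_prop) (by fun_prop)
    · change ‖(TensorProduct.lift prodVec).extendOfNorm _ _‖ = _
      rw [LinearMap.extendOfNorm_eq hd ⟨1, fun x => ?_⟩, norm_lift_prodVec]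
      · exact (UniformSpace.Completion.norm_coe x).symm
      · rw [one_mul, norm_lift_prodVec]
        exact (UniformSpace.Completion.norm_coe x).ge

theorem planeRep_tensorVec (φ ψ : Mode) : planeRep (tensorVec φ ψ) = prodVec φ ψ := by
  have hd : DenseRange (UniformSpace.Completion.toComplL (𝕜 := ℂ)
      (E := Mode ⊗[ℂ] Mode)).toLinearMap := UniformSpace.Completion.denseRange_coe
  have := LinearMap.extendOfNorm_eq (f := TensorProduct.lift prodVec) hd ⟨1, fun x => by
    rw [one_mul, norm_lift_prodVec]
    exact (UniformSpace.Completion.norm_coe x).ge⟩ (φ ⊗ₜ ψ)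
  rw [TensorProduct.lift.tmul] at this
  exact this

theorem planeRep_indicator {X Y : Set ℝ} (hX : MeasurableSet X) (hY : MeasurableSet Y)
    (t : TwoModes) :
    planeRep (tensorOp (indicatorOp volume X) (indicatorOp volume Y) t) =
      indicatorOp volume (X ×ˢ Y) (planeRep t) := by
  have h : planeRep.toContinuousLinearMap.comp
      (tensorOp (indicatorOp volume X) (indicatorOp volume Y)) =
      (indicatorOp volume (X ×ˢ Y)).comp planeRep.toContinuousLinearMap := by
    refine ext_tensorVec fun φ ψ => ?_
    change planeRep (tensorOp (indicatorOp volume X) (indicatorOp volume Y) (tensorVec φ ψ)) =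
      indicatorOp volume (X ×ˢ Y) (planeRep (tensorVec φ ψ))
    rw [tensorOp_tensorVec, planeRep_tensorVec, planeRep_tensorVec]
    refine Lp.ext ?_
    filter_upwards [coeFn_indicatorOp (hX.prod hY) (prodVec φ ψ), coeFn_prodVec φ ψ,
      coeFn_prodVec (indicatorOp volume X φ) (indicatorOp volume Y ψ),
      ae_fst (coeFn_indicatorOp hX φ), ae_snd (coeFn_indicatorOp hY ψ)] with p h1 h2 h3 h4 h5
    rw [h1, h3, h4, h5]
    by_cases hx : p.1 ∈ X <;> by_cases hy : p.2 ∈ Y <;>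
      simp [Set.indicator, Set.mem_prod, hx, hy, h2]
  exact DFunLike.congr_fun h t

/-! ### Positive operator measures -/

namespace Observable

variable {α K : Type*} [MeasurableSpace α] [NormedAddCommGroup K] [InnerProductSpace ℂ K]

theorem measure_apply (E : Observable α K) (ψ : K) {X : Set α} (hX : MeasurableSet X) :
    E.measure ψ X = ENNReal.ofReal (inner ℂ ψ (E X ψ)).re :=
  Measure.ofMeasurable_apply X hX

theorem inner_comm (E : Observable α K) {X : Set α} (hX : MeasurableSet X) (φ ψ : K) :
    inner ℂ (E X φ) ψ = inner ℂ φ (E X ψ) :=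
  (E.isPositive X hX).isSymmetric φ ψ

theorem inner_eq_measure (E : Observable α K) (ψ : K) {X : Set α} (hX : MeasurableSet X) :
    inner ℂ ψ (E X ψ) = ((E.measure ψ).real X : ℂ) := by
  have h : 0 ≤ (inner ℂ ψ (E X ψ)).re := (E.isPositive X hX).re_inner_nonneg_right ψ
  rw [Measure.real, E.measure_apply ψ hX, ENNReal.toReal_ofReal h]
  have h2 : starRingEnd ℂ (inner ℂ ψ (E X ψ)) = inner ℂ ψ (E X ψ) := by
    rw [inner_conj_symm, E.inner_comm hX]
  exact (Complex.conj_eq_iff_re.1 h2).symm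

instance isFiniteMeasure_measure (E : Observable α K) (ψ : K) : IsFiniteMeasure (E.measure ψ) :=
  ⟨by rw [E.measure_apply ψ MeasurableSet.univ]; exact ENNReal.ofReal_lt_top⟩

theorem measureReal_univ (E : Observable α K) (ψ : K) : (E.measure ψ).real Set.univ = ‖ψ‖ ^ 2 := by
  have h := E.inner_eq_measure ψ MeasurableSet.univ
  rw [E.map_univ, one_apply_eq_self, inner_self_eq_norm_sq_to_K] at h
  refine Complex.ofReal_injective (h.symm.trans ?_)
  push_cast; rfl

theorem ext_inner_self {S T : K →L[ℂ] K} (h : ∀ ψ, inner ℂ ψ (S ψ) = inner ℂ ψ (T ψ)) : S = T := by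
  refine ContinuousLinearMap.coe_injective ((ext_inner_map _ _).1 fun ψ => ?_)
  rw [← inner_conj_symm, ← inner_conj_symm _ ψ]
  exact congrArg _ (h ψ)

/-- Complex polarization recovers an operator from its quadratic form, and nonmeasurable sets carry
the value 0 by convention. -/
theorem ext_of_measure {E F : Observable α K} (h : ∀ ψ, E.measure ψ = F.measure ψ) : E = F := by
  have : E.toFun = F.toFun := by
    funext X
    by_cases hX : MeasurableSet X
    · refine ext_inner_self fun ψ => ?_
      rw [E.inner_eq_measure ψ hX, F.inner_eq_measure ψ hX, h]
    · rw [E.not_measurable X hX, F.not_measurable X hX]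
  cases E; cases F; cases this; rfl

theorem map_union (E : Observable α K) {X Y : Set α} (hX : MeasurableSet X) (hY : MeasurableSet Y)
    (h : Disjoint X Y) : E (X ∪ Y) = E X + E Y := by
  refine ext_inner_self fun ψ => ?_
  rw [E.inner_eq_measure ψ (hX.union hY), add_apply, inner_add_right,
    E.inner_eq_measure ψ hX, E.inner_eq_measure ψ hY, measureReal_union h hY]
  push_cast; rfl

variable {E : Observable α K}

/-- The sum of the idempotents P = E X and R = E Y is again idempotent, so PR + RP = 0. Multiplying
by P on the left and on the right gives PR = -PRP = RP, whence 2PR = 0. -/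
theorem mul_of_disjoint (hE : ∀ X, E X * E X = E X) {X Y : Set α} (hX : MeasurableSet X) (hY : MeasurableSet Y)
    (h : Disjoint X Y) : E X * E Y = 0 := by
  have h1 := hE (X ∪ Y)
  rw [E.map_union hX hY h, add_mul, mul_add, mul_add, hE, hE] at h1
  have h2 : E X * E Y + E Y * E X = 0 := by
    have : E X * E Y + E Y * E X =
      (E X + E X * E Y + (E Y * E X + E Y)) - (E X + E Y) := by abel
    rw [this, h1, sub_self]
  have h3 : E X * E Y + E X * E Y * E X = 0 := by
    have := congrArg (E X * ·) h2
    simpa only [mul_add, ← mul_assoc, hE, mul_zero] using this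
  have h4 : E X * E Y * E X + E Y * E X = 0 := by
    have := congrArg (· * E X) h2
    simpa only [add_mul, mul_assoc, hE, zero_mul] using this
  have h5 : E X * E Y = E Y * E X := by
    rw [eq_neg_of_add_eq_zero_left h3, eq_neg_of_add_eq_zero_right h4]
  rw [← h5, ← two_smul ℂ] at h2
  exact (smul_eq_zero.1 h2).resolve_left two_ne_zero

theorem mul_eq_inter (hE : ∀ X, E X * E X = E X) {X Y : Set α} (hX : MeasurableSet X) (hY : MeasurableSet Y) :
    E X * E Y = E (X ∩ Y) := by
  have hX' : E X = E (X ∩ Y) + E (X \ Y) := by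
    rw [← E.map_union (hX.inter hY) (hX.diff hY)
      (Set.disjoint_sdiff_right.mono_left Set.inter_subset_right), Set.inter_union_sdiff]
  have hY' : E Y = E (X ∩ Y) + E (Y \ X) := by
    rw [← E.map_union (hX.inter hY) (hY.diff hX)
      (Set.disjoint_sdiff_right.mono_left Set.inter_subset_left), Set.inter_comm,
      Set.inter_union_sdiff]
  rw [hX', add_mul, mul_of_disjoint hE (hX.diff hY) hY Set.disjoint_sdiff_left, add_zero]
  nth_rewrite 1 [hY']
  rw [mul_add, hE, mul_of_disjoint hE (hX.inter hY) (hY.diff hX)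
    (Set.disjoint_sdiff_right.mono_left Set.inter_subset_left), add_zero]

theorem measure_apply_restrict (hE : ∀ X, E X * E X = E X) {A : Set α} (hA : MeasurableSet A) (ψ : K) :
    E.measure (E A ψ) = (E.measure ψ).restrict A := by
  ext X hX
  rw [Measure.restrict_apply hX, E.measure_apply _ hX, E.measure_apply _ (hX.inter hA),
    E.inner_comm hA, ← mul_apply_eq_comp (E X), mul_eq_inter hE hX hA, ← mul_apply_eq_comp,
    mul_eq_inter hE hA (hX.inter hA), Set.inter_comm A, Set.inter_assoc, Set.inter_self]

end Observable

/-! ### Uniqueness of spectral measures -/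

section Spectral

variable {K : Type*} [NormedAddCommGroup K] [InnerProductSpace ℂ K] {T : K →ₗ.[ℂ] K}
  {E : Observable ℝ K}

theorem IsSpectralMeasure.apply_mem_domain (hE : IsSpectralMeasure E T) {A : Set ℝ} (hA : MeasurableSet A) {φ : K}
    (hφ : φ ∈ T.domain) : E A φ ∈ T.domain := by
  rw [hE.2.1] at hφ ⊢
  rw [Observable.measure_apply_restrict hE.1 hA]
  exact hφ.restrict

/-- The measure of such a vector is finite and lives on a bounded interval, where x² is integrable.
-/
theorem IsSpectralMeasure.Icc_mem_domain (hE : IsSpectralMeasure E T) (a b : ℝ) (φ : K) : E (Set.Icc a b) φ ∈ T.domain := by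
  rw [hE.2.1, Observable.measure_apply_restrict hE.1 measurableSet_Icc]
  exact (continuous_pow 2).continuousOn.integrableOn_Icc

theorem IsSpectralMeasure.integrable_id (hE : IsSpectralMeasure E T) (φ : T.domain) :
    Integrable (fun x : ℝ => x) (E.measure (φ : K)) := by
  have h := (hE.2.1 φ).1 φ.2
  refine (h.add (integrable_const 1)).mono' (by fun_prop) (Filter.Eventually.of_forall fun x => ?_)
  simp only [Real.norm_eq_abs, Pi.add_apply]
  nlinarith [sq_abs x, sq_nonneg (|x| - 1)]

/-- `IsSpectralMeasure` gives only diagonal matrix elements of T. For u + w the integral of x splits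
over A and its complement, so the cross terms satisfy ⟨u, Tw⟩ + ⟨w, Tu⟩ = 0; replacing w by iw gives
the same with a minus sign, and both vanish. -/
theorem IsSpectralMeasure.inner_compl (hE : IsSpectralMeasure E T) {A : Set ℝ} (hA : MeasurableSet A) (u w : T.domain)
    (hu : E A u = (u : K)) (hw : E Aᶜ w = (w : K)) : inner ℂ (w : K) (T u) = 0 := by
  have hAc : E A * E Aᶜ = 0 :=
    Observable.mul_of_disjoint hE.1 hA hA.compl disjoint_compl_right
  have hcA : E Aᶜ * E A = 0 :=
    Observable.mul_of_disjoint hE.1 hA.compl hA disjoint_compl_left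
  have key : ∀ w : T.domain, E Aᶜ w = (w : K) →
      inner ℂ (u : K) (T w) + inner ℂ (w : K) (T u) = 0 := by
    intro w hw
    have hEu : E A (u + w : K) = u := by
      rw [map_add, hu, ← hw, ← mul_apply_eq_comp, hAc]
      simp
    have hEw : E Aᶜ (u + w : K) = w := by
      rw [map_add, hw, ← hu, ← mul_apply_eq_comp, hcA]
      simp
    have h1 := hE.2.2 (u + w)
    have h2 := hE.2.2 u
    have h3 := hE.2.2 w
    have h4 : ∫ x, x ∂(E.measure ((u + w : T.domain) : K)) =
        ∫ x, x ∂(E.measure (u : K)) + ∫ x, x ∂(E.measure (w : K)) := by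
      have hu' : E.measure (u : K) = (E.measure ((u + w : T.domain) : K)).restrict A := by
        rw [← Observable.measure_apply_restrict hE.1 hA]
        exact congrArg _ hEu.symm
      have hw' : E.measure (w : K) = (E.measure ((u + w : T.domain) : K)).restrict Aᶜ := by
        rw [← Observable.measure_apply_restrict hE.1 hA.compl]
        exact congrArg _ hEw.symm
      rw [hu', hw']
      exact (integral_add_compl hA (hE.integrable_id (u + w))).symm
    rw [h4, Complex.ofReal_add, ← h2, ← h3, LinearPMap.map_add, Submodule.coe_add, inner_add_left,
      inner_add_right, inner_add_right] at h1
    linear_combination h1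
  have h1 := key w hw
  have h2 := key (Complex.I • w) (by rw [Submodule.coe_smul, map_smul, hw])
  rw [LinearPMap.map_smul, Submodule.coe_smul, inner_smul_left, inner_smul_right,
    Complex.conj_I] at h2
  have h3 : Complex.I * (2 * inner ℂ (w : K) (T u)) = 0 := by
    linear_combination Complex.I * h1 - h2
  simpa using h3

/-- T u is orthogonal to E(Aᶜ)φ for all φ in the dense domain, so its component in the range of
E(Aᶜ) is zero. -/
theorem IsSpectralMeasure.apply_mem_range (hE : IsSpectralMeasure E T) (hT : Dense (T.domain : Set K)) {A : Set ℝ}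
    (hA : MeasurableSet A) (u : T.domain) (hu : E A u = (u : K)) : E A (T u) = T u := by
  have h0 : E Aᶜ (T u) = 0 := by
    refine hT.eq_zero_of_inner_right ℂ fun φ hφ => ?_
    rw [← E.inner_comm hA.compl]
    refine hE.inner_compl hA u ⟨E Aᶜ φ, hE.apply_mem_domain hA.compl hφ⟩ hu ?_
    change E Aᶜ (E Aᶜ φ) = E Aᶜ φ
    rw [← mul_apply_eq_comp, hE.1]
  have h1 := E.map_union hA hA.compl disjoint_compl_right
  rw [Set.union_compl_self, E.map_univ] at h1
  have h2 := DFunLike.congr_fun h1 (T u)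
  rw [add_apply, h0, add_zero] at h2
  exact h2.symm

/-- On the range of `E [c-r, c+r]` the quadratic form of `T - c` is bounded by `r`. -/
theorem IsSpectralMeasure.abs_form_le (hE : IsSpectralMeasure E T) (c : ℝ) {r : ℝ} (u : T.domain)
    (hu : E (Set.Icc (c - r) (c + r)) u = (u : K)) :
    ∃ s : ℝ, |s| ≤ r * ‖(u : K)‖ ^ 2 ∧ inner ℂ (u : K) (T u - (c : ℂ) • (u : K)) = s := by
  have hm : E.measure (u : K) = (E.measure (u : K)).restrict (Set.Icc (c - r) (c + r)) := by
    rw [← Observable.measure_apply_restrict hE.1 measurableSet_Icc, hu]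
  refine ⟨∫ x, (x - c) ∂(E.measure (u : K)), ?_, ?_⟩
  · have h1 : ∀ᵐ x ∂(E.measure (u : K)), ‖x - c‖ ≤ r := by
      rw [hm]
      filter_upwards [ae_restrict_mem measurableSet_Icc] with x hx
      rw [Real.norm_eq_abs, abs_le]
      constructor <;> linarith [hx.1, hx.2]
    have := norm_integral_le_of_norm_le_const h1
    rwa [E.measureReal_univ, Real.norm_eq_abs] at this
  · rw [integral_sub (hE.integrable_id u) (integrable_const _), integral_const, E.measureReal_univ,
      inner_sub_right, hE.2.2, inner_smul_right, inner_self_eq_norm_sq_to_K]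
    push_cast
    simp [mul_comm]

/-- The classical passage from a bound on a real quadratic form to a bound on the operator, by
polarization and the parallelogram law inside the range of E(A), which T - c leaves invariant. -/
theorem IsSpectralMeasure.norm_sub_le (hE : IsSpectralMeasure E T) (hT : Dense (T.domain : Set K)) (c : ℝ) {r : ℝ} (hr : 0 < r)
    (u : T.domain) (hu : E (Set.Icc (c - r) (c + r)) u = (u : K)) :
    E (Set.Icc (c - r) (c + r)) (T u - (c : ℂ) • (u : K)) = T u - (c : ℂ) • (u : K) ∧
      ‖T u - (c : ℂ) • (u : K)‖ ≤ r * ‖(u : K)‖ := by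
  set A := Set.Icc (c - r) (c + r) with hA
  set B : T.domain →ₗ[ℂ] K := T.toFun - (c : ℂ) • T.domain.subtype with hB
  have hBu : ∀ u, B u = T u - (c : ℂ) • (u : K) := fun u => rfl
  have hr1 : ∀ u : T.domain, E A u = (u : K) → E A (B u) = B u := by
    intro u hu
    rw [hBu, map_sub, map_smul, hu, hE.apply_mem_range hT measurableSet_Icc u hu]
  refine ⟨hr1 u hu, ?_⟩
  have hdom : ∀ y, E A y = y → y ∈ T.domain := fun y hy => hy ▸ hE.Icc_mem_domain _ _ y
  -- The partner v = Bu/r is the optimal choice: both ⟨v, Bu⟩ and r‖v‖² equal ‖Bu‖²/r.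
  obtain ⟨v, hvu⟩ : ∃ v : T.domain, (v : K) = ((1 / r : ℝ) : ℂ) • B u :=
    ⟨⟨_, T.domain.smul_mem _ (hdom _ (hr1 u hu))⟩, rfl⟩
  have hv : E A v = (v : K) := by rw [hvu, map_smul, hr1 u hu]
  have hvn : ‖(v : K)‖ = 1 / r * ‖B u‖ := by
    rw [hvu, norm_smul, Complex.norm_real, Real.norm_eq_abs, abs_of_pos (by positivity)]
  have hq : ∀ u : T.domain, E A u = (u : K) → ∃ s : ℝ, |s| ≤ r * ‖(u : K)‖ ^ 2 ∧
      inner ℂ (u : K) (B u) = s := fun u hu => hE.abs_form_le c u hu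
  have hadd : E A (u + v : T.domain) = ((u + v : T.domain) : K) := by
    rw [Submodule.coe_add, map_add, hu, hv]
  have hsub : E A (u - v : T.domain) = ((u - v : T.domain) : K) := by
    rw [Submodule.coe_sub, map_sub, hu, hv]
  have hiadd : E A (u + Complex.I • v : T.domain) = ((u + Complex.I • v : T.domain) : K) := by
    rw [Submodule.coe_add, Submodule.coe_smul, map_add, map_smul, hu, hv]
  obtain ⟨s₁, hs₁, e₁⟩ := hq _ hadd
  obtain ⟨s₂, hs₂, e₂⟩ := hq _ hsub
  obtain ⟨s₃, hs₃, e₃⟩ := hq _ hu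
  obtain ⟨s₄, hs₄, e₄⟩ := hq _ hv
  obtain ⟨s₅, hs₅, e₅⟩ := hq _ hiadd
  have hvB : inner ℂ (v : K) (B u) = ((1 / r * ‖B u‖ ^ 2 : ℝ) : ℂ) := by
    rw [hvu, inner_smul_left, Complex.conj_ofReal, inner_self_eq_norm_sq_to_K]
    push_cast; rfl
  rw [map_add, Submodule.coe_add, inner_add_left, inner_add_right, inner_add_right, e₃, e₄, hvB]
    at e₁
  rw [map_sub, Submodule.coe_sub, inner_sub_left, inner_sub_right, inner_sub_right, e₃, e₄, hvB]
    at e₂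
  rw [map_add, map_smul, Submodule.coe_add, Submodule.coe_smul, inner_add_left, inner_add_right,
    inner_add_right, inner_smul_left, inner_smul_left, inner_smul_right, inner_smul_right, e₃, e₄,
    hvB, Complex.conj_I] at e₅
  generalize inner ℂ (u : K) (B v) = a at e₁ e₂ e₅
  -- Reality of the form at u + iv replaces symmetry of B: it gives Re⟨u, Bv⟩ = ⟨v, Bu⟩.
  have i5 : a.re - 1 / r * ‖B u‖ ^ 2 = 0 := by
    have := congrArg Complex.im e₅
    simp only [Complex.add_im, Complex.mul_im, Complex.ofReal_im, Complex.I_re, Complex.I_im,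
      Complex.ofReal_re, Complex.neg_re, Complex.neg_im, Complex.mul_re] at this
    linarith
  have r1 : s₃ + a.re + (1 / r * ‖B u‖ ^ 2 + s₄) = s₁ := by
    simpa only [Complex.add_re, Complex.ofReal_re] using congrArg Complex.re e₁
  have r2 : s₃ - a.re - (1 / r * ‖B u‖ ^ 2 - s₄) = s₂ := by
    simpa only [Complex.sub_re, Complex.ofReal_re] using congrArg Complex.re e₂
  have hpar := parallelogram_law_with_norm ℂ (u : K) (v : K)
  rw [Submodule.coe_add] at hs₁
  rw [Submodule.coe_sub] at hs₂
  have f1 := (abs_le.1 hs₁).2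
  have f2 := (abs_le.1 hs₂).1
  have g1 : 4 * (1 / r * ‖B u‖ ^ 2) ≤ 2 * r * (‖(u : K)‖ ^ 2 + ‖(v : K)‖ ^ 2) := by
    have : r * ‖(u + v : K)‖ ^ 2 + r * ‖(u - v : K)‖ ^ 2 =
      r * (2 * (‖(u : K)‖ ^ 2 + ‖(v : K)‖ ^ 2)) := by rw [← mul_add, hpar]
    linarith
  have g2 : r * ‖(v : K)‖ ^ 2 = 1 / r * ‖B u‖ ^ 2 := by rw [hvn]; field_simp
  have g3 : 1 / r * ‖B u‖ ^ 2 ≤ r * ‖(u : K)‖ ^ 2 := by linarith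
  have g4 : ‖B u‖ ^ 2 ≤ (r * ‖(u : K)‖) ^ 2 := by
    have := mul_le_mul_of_nonneg_left g3 hr.le
    rw [← mul_assoc, mul_one_div_cancel hr.ne', one_mul] at this
    linarith [mul_pow r ‖(u : K)‖ 2]
  exact (pow_le_pow_iff_left₀ (norm_nonneg _) (by positivity) two_ne_zero).1 g4

end Spectral

/-! ### The quadrature operators as multiplication operators -/

theorem derivative_hermite_succ (n : ℕ) :
    derivative (hermite (n + 1)) = ((n : ℤ[X]) + 1) * hermite n := by
  induction n with
  | zero => simp
  | succ n ih =>
    rw [hermite_succ (n + 1), derivative_sub, derivative_mul, derivative_X, ih]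
    have h : derivative (((n : ℤ[X]) + 1) * hermite n) =
        ((n : ℤ[X]) + 1) * derivative (hermite n) := by
      rw [derivative_mul]; simp
    rw [h, hermite_succ n]
    push_cast
    ring

/-- The three-term recurrence of the Hermite functions. -/
theorem mul_hermiteFun (n : ℕ) (x : ℝ) :
    x * hermiteFun n x = (1 / √2) * (√((n : ℝ) + 1) * hermiteFun (n + 1) x +
      √(n : ℝ) * hermiteFun (n - 1) x) := by
  have hpi := Real.pi_pos
  have h2 : √2 * √2 = (2 : ℝ) := Real.mul_self_sqrt (by norm_num)
  have h20 : (√2 : ℝ) ≠ 0 := by positivity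
  have hf : ∀ n : ℕ, √((n + 1).factorial * √Real.pi) =
      √((n : ℝ) + 1) * √(n.factorial * √Real.pi) := by
    intro n
    rw [← Real.sqrt_mul (by positivity), Nat.factorial_succ]
    congr 1; push_cast; ring
  have hx : x = 1 / √2 * (√2 * x) := by field_simp
  -- At n = 0 the truncated index n - 1 is harmless, since its coefficient √n vanishes.
  rcases n with _ | n
  · have h1 := hf 0
    simp only [Nat.cast_zero, zero_add, Real.sqrt_one, one_mul, Real.sqrt_zero, zero_mul,
      add_zero] at h1 ⊢
    rw [hermiteFun, hermiteFun, h1]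
    simp only [hermite_one, hermite_zero, aeval_X, map_one]
    nth_rewrite 1 [hx]
    ring
  · have e : √2 * x * aeval (√2 * x) (hermite (n + 1)) =
        aeval (√2 * x) (hermite (n + 2)) + ((n : ℝ) + 1) * aeval (√2 * x) (hermite n) := by
      rw [hermite_succ (n + 1), derivative_hermite_succ]
      simp
    have hs : √((n : ℝ) + 1) ≠ 0 := by positivity
    have hs2 : √((n : ℝ) + 1) * √((n : ℝ) + 1) = (n : ℝ) + 1 :=
      Real.mul_self_sqrt (by positivity)
    have ht : √(((n + 1 : ℕ) : ℝ) + 1) ≠ 0 := by positivity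
    have hp : √(n.factorial * √Real.pi) ≠ 0 := by positivity
    nth_rewrite 1 [hx]
    rw [Nat.add_sub_cancel]
    unfold hermiteFun
    rw [hf (n + 1), hf n]
    push_cast at ht ⊢
    field_simp
    rw [e]
    linear_combination -(aeval (√2 * x) (hermite n)) * hs2

/-- The graph of the maximal multiplication operator `ψ(x) ↦ x ψ(x)`. -/
def positionGraph : Submodule ℂ (Mode × Mode) where
  carrier := {p | p.2 =ᵐ[volume] fun x : ℝ => (x : ℂ) * p.1 x}
  zero_mem' := by
    filter_upwards [Lp.coeFn_zero ℂ 2 (volume : Measure ℝ)] with x hx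
    simp
  add_mem' := by
    intro p q hp hq
    filter_upwards [hp, hq, Lp.coeFn_add p.1 q.1, Lp.coeFn_add p.2 q.2] with x h1 h2 h3 h4
    rw [Prod.fst_add, Prod.snd_add, h3, h4, Pi.add_apply, Pi.add_apply, h1, h2, mul_add]
  smul_mem' := by
    intro c p hp
    filter_upwards [hp, Lp.coeFn_smul c p.1, Lp.coeFn_smul c p.2] with x h1 h2 h3
    rw [Prod.smul_fst, Prod.smul_snd, h2, h3, Pi.smul_apply, Pi.smul_apply, h1, smul_eq_mul,
      smul_eq_mul, mul_left_comm]

theorem mem_positionGraph {p : Mode × Mode} :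
    p ∈ positionGraph ↔ p.2 =ᵐ[volume] fun x : ℝ => (x : ℂ) * p.1 x := Iff.rfl

/-- Along a subsequence the first components converge almost everywhere, hence so do their products
with x, and these identify the L² limit of the second components. -/
theorem isClosed_positionGraph : IsClosed (positionGraph : Set (Mode × Mode)) := by
  refine IsSeqClosed.isClosed fun u p hu hp => ?_
  have h1 : Filter.Tendsto (fun n => (u n).1) Filter.atTop (nhds p.1) :=
    (continuous_fst.tendsto p).comp hp
  have h2 : Filter.Tendsto (fun n => (u n).2) Filter.atTop (nhds p.2) :=
    (continuous_snd.tendsto p).comp hp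
  obtain ⟨ns, hns, h3⟩ := (tendstoInMeasure_of_tendsto_Lp h1).exists_seq_tendsto_ae
  refine ae_eq_of_tendsto_Lp (h2.comp hns.tendsto_atTop) ?_
  have h4 : ∀ᵐ x : ℝ, ∀ n, (u n).2 x = (x : ℂ) * (u n).1 x := ae_all_iff.2 fun n => hu n
  filter_upwards [h3, h4] with x h5 h6
  simp only [Function.comp_apply, h6]
  exact h5.const_mul _

/-- The graph of the multiplication operator in the representation rotated by `R(θ)`. -/
def rotatedGraph (θ : ℝ) : Submodule ℂ (Mode × Mode) :=
  positionGraph.comap ((phaseShifter (-θ)).toLinearEquiv.toLinearMap.prodMap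
    (phaseShifter (-θ)).toLinearEquiv.toLinearMap)

theorem mem_rotatedGraph {θ : ℝ} {p : Mode × Mode} : p ∈ rotatedGraph θ ↔
    phaseShifter (-θ) p.2 =ᵐ[volume] fun x : ℝ => (x : ℂ) * phaseShifter (-θ) p.1 x := Iff.rfl

theorem mk_mem_rotatedGraph {θ : ℝ} {ψ χ : Mode} : (ψ, χ) ∈ rotatedGraph θ ↔
    (phaseShifter (-θ) ψ, phaseShifter (-θ) χ) ∈ positionGraph := Iff.rfl

theorem isClosed_rotatedGraph (θ : ℝ) : IsClosed (rotatedGraph θ : Set (Mode × Mode)) := by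
  refine isClosed_positionGraph.preimage (f := fun p : Mode × Mode =>
    (phaseShifter (-θ) p.1, phaseShifter (-θ) p.2)) ?_
  fun_prop

theorem rotatedGraph_snd_eq {θ : ℝ} {ψ χ χ' : Mode} (h : (ψ, χ) ∈ rotatedGraph θ)
    (h' : (ψ, χ') ∈ rotatedGraph θ) : χ = χ' :=
  (phaseShifter (-θ)).injective (Lp.ext ((mem_rotatedGraph.1 h).trans (mem_rotatedGraph.1 h').symm))

/-- Both 1 and |x| are at most |x + i|. Approximating χ + iψ therefore approximates ψ and χ
simultaneously. -/
theorem norm_le_of_mem_rotatedGraph {θ : ℝ} {ψ χ : Mode} (h : (ψ, χ) ∈ rotatedGraph θ) :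
    ‖ψ‖ ≤ ‖χ + Complex.I • ψ‖ ∧ ‖χ‖ ≤ ‖χ + Complex.I • ψ‖ := by
  have h1 : phaseShifter (-θ) (χ + Complex.I • ψ) =ᵐ[volume]
      fun x : ℝ => ((x : ℂ) + Complex.I) * phaseShifter (-θ) ψ x := by
    rw [map_add, map_smul]
    filter_upwards [Lp.coeFn_add (phaseShifter (-θ) χ) (Complex.I • phaseShifter (-θ) ψ),
      Lp.coeFn_smul Complex.I (phaseShifter (-θ) ψ), mem_rotatedGraph.1 h] with x h2 h3 h4
    rw [h2, Pi.add_apply, h3, h4, Pi.smul_apply, smul_eq_mul, add_mul]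
  have hx : ∀ x : ℝ, 1 ≤ ‖(x : ℂ) + Complex.I‖ ∧ ‖(x : ℂ)‖ ≤ ‖(x : ℂ) + Complex.I‖ := fun x => by
    constructor
    · simpa using Complex.abs_im_le_norm ((x : ℂ) + Complex.I)
    · simpa using Complex.abs_re_le_norm ((x : ℂ) + Complex.I)
  rw [← (phaseShifter (-θ)).norm_map ψ, ← (phaseShifter (-θ)).norm_map χ,
    ← (phaseShifter (-θ)).norm_map (χ + Complex.I • ψ)]
  constructor
  · refine Lp.norm_le_norm_of_ae_le ?_
    filter_upwards [h1] with x h2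
    rw [h2, norm_mul]
    exact le_mul_of_one_le_left (norm_nonneg _) (hx x).1
  · refine Lp.norm_le_norm_of_ae_le ?_
    filter_upwards [h1, mem_rotatedGraph.1 h] with x h2 h3
    rw [h2, norm_mul, h3, norm_mul]
    exact mul_le_mul_of_nonneg_right (hx x).2 (norm_nonneg _)

/-- The operator `(exp(iθ) a* + exp(-iθ) a)/√2` on finite linear combinations of number states. -/
abbrev preQuadrature (θ : ℝ) : Mode →ₗ.[ℂ] Mode :=
  (1 / √2 : ℂ) • (Complex.exp (Complex.I * θ) • creation +
    Complex.exp (-(Complex.I * θ)) • annihilation)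

theorem mem_domain_preQuadrature {θ : ℝ} {ψ : Mode} :
    ψ ∈ (preQuadrature θ).domain ↔ ψ ∈ Submodule.span ℂ (Set.range numberState) := by
  change ψ ∈ Submodule.span ℂ (Set.range numberState) ⊓ Submodule.span ℂ (Set.range numberState) ↔ _
  rw [inf_idem]

/-- R(-θ) shifts the phases of |n ± 1⟩ relative to |n⟩ by e^{∓iθ}, cancelling the coefficients
e^{±iθ}; what is left is the three-term recurrence. -/
theorem numberState_mem_rotatedGraph (θ : ℝ) (n : ℕ) :
    (numberState n, (1 / √2 : ℂ) • (Complex.exp (Complex.I * θ) •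
      ((√((n : ℝ) + 1) : ℂ) • numberState (n + 1)) + Complex.exp (-(Complex.I * θ)) •
      ((√(n : ℝ) : ℂ) • numberState (n - 1)))) ∈ rotatedGraph θ := by
  have hpos : (numberState n, (1 / √2 : ℂ) • ((√((n : ℝ) + 1) : ℂ) • numberState (n + 1) +
      (√(n : ℝ) : ℂ) • numberState (n - 1))) ∈ positionGraph := by
    rw [mem_positionGraph]
    have hc : ∀ n, numberState n =ᵐ[volume] fun x => (hermiteFun n x : ℂ) :=
      fun n => (memLp_hermiteFun n).coeFn_toLp
    filter_upwards [Lp.coeFn_smul (1 / √2 : ℂ) ((√((n : ℝ) + 1) : ℂ) • numberState (n + 1) +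
      (√(n : ℝ) : ℂ) • numberState (n - 1)), Lp.coeFn_add ((√((n : ℝ) + 1) : ℂ) •
      numberState (n + 1)) ((√(n : ℝ) : ℂ) • numberState (n - 1)),
      Lp.coeFn_smul (√((n : ℝ) + 1) : ℂ) (numberState (n + 1)),
      Lp.coeFn_smul (√(n : ℝ) : ℂ) (numberState (n - 1)), hc n, hc (n + 1), hc (n - 1)]
      with x h1 h2 h3 h4 h5 h6 h7
    rw [h1, Pi.smul_apply, h2, Pi.add_apply, h3, h4, Pi.smul_apply, Pi.smul_apply, h5, h6, h7,
      ← Complex.ofReal_mul, mul_hermiteFun]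
    push_cast
    simp
  have h2 := positionGraph.smul_mem (Complex.exp (Complex.I * (-θ : ℝ) * n)) hpos
  rw [mk_mem_rotatedGraph]
  convert! h2 using 1
  rw [Prod.smul_mk, phaseShifter_numberState]
  congr 1
  rw [map_smul, map_add, map_smul, map_smul, map_smul, map_smul, phaseShifter_numberState,
    phaseShifter_numberState, smul_comm (Complex.exp (Complex.I * (-θ : ℝ) * n))]
  congr 1
  rw [smul_add]
  congr 1
  · have e : Complex.exp (Complex.I * θ) * Complex.exp (Complex.I * (-θ : ℝ) * (n + 1 : ℕ)) =
        Complex.exp (Complex.I * (-θ : ℝ) * n) := by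
      rw [← Complex.exp_add]
      congr 1
      push_cast; ring
    rw [smul_smul, smul_smul, smul_smul]
    congr 1
    linear_combination (√((n : ℝ) + 1) : ℂ) * e
  · rcases n with _ | n
    · simp
    have e : Complex.exp (-(Complex.I * θ)) * Complex.exp (Complex.I * (-θ : ℝ) * n) =
        Complex.exp (Complex.I * (-θ : ℝ) * (n + 1 : ℕ)) := by
      rw [← Complex.exp_add]
      congr 1
      push_cast; ring
    rw [smul_smul, smul_smul, smul_smul, Nat.add_sub_cancel]
    congr 1
    linear_combination (√((n + 1 : ℕ) : ℝ) : ℂ) * e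

theorem graph_preQuadrature_le (θ : ℝ) : (preQuadrature θ).graph ≤ rotatedGraph θ := by
  let c : Submodule.span ℂ (Set.range numberState) →ₗ[ℂ] Mode := creation.toFun
  let a : Submodule.span ℂ (Set.range numberState) →ₗ[ℂ] Mode := annihilation.toFun
  let L : Submodule.span ℂ (Set.range numberState) →ₗ[ℂ] Mode × Mode :=
    (Submodule.span ℂ (Set.range numberState)).subtype.prod
      ((1 / √2 : ℂ) • (Complex.exp (Complex.I * θ) • c + Complex.exp (-(Complex.I * θ)) • a))
  have hL : (rotatedGraph θ).comap L = ⊤ := by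
    rw [eq_top_iff, ← finiteBasis.span_eq, Submodule.span_le]
    rintro _ ⟨n, rfl⟩
    have h1 : ((finiteBasis n : Submodule.span ℂ (Set.range numberState)) : Mode) =
        numberState n :=
      congrArg Subtype.val (Module.Basis.span_apply orthonormal_numberState.linearIndependent n)
    have h2 : c (finiteBasis n) = (√((n : ℝ) + 1) : ℂ) • numberState (n + 1) :=
      finiteBasis.constr_basis _ _ _
    have h3 : a (finiteBasis n) = (√(n : ℝ) : ℂ) • numberState (n - 1) :=
      finiteBasis.constr_basis _ _ _
    have := numberState_mem_rotatedGraph θ n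
    rw [← h1, ← h2, ← h3] at this
    exact this
  rintro ⟨a, b⟩ hab
  obtain ⟨y, h1, h2⟩ := (LinearPMap.mem_graph_iff _).1 hab
  have hy : (y : Mode) ∈ Submodule.span ℂ (Set.range numberState) :=
    mem_domain_preQuadrature.1 y.2
  have h3 : L ⟨y, hy⟩ ∈ rotatedGraph θ := by
    have : (⟨y, hy⟩ : Submodule.span ℂ (Set.range numberState)) ∈ (rotatedGraph θ).comap L :=
      hL ▸ Submodule.mem_top
    exact this
  have h4 : L ⟨y, hy⟩ = (a, b) := Prod.ext h1 h2
  rwa [h4] at h3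

/-- The vector `p(x) exp(-x²/2)`. -/
def polyVec (p : ℝ[X]) : Mode := (memLp_poly_gauss p).toLp _

theorem coeFn_polyVec (p : ℝ[X]) : polyVec p =ᵐ[volume]
    fun x => ((p.eval x * Real.exp (-(x ^ 2 / 2)) : ℝ) : ℂ) :=
  (memLp_poly_gauss p).coeFn_toLp

/-- The rescaled Hermite polynomials contain one polynomial of each degree, so they span. This puts
all polynomials times the Gaussian into the domain of the unclosed quadrature. -/
theorem polyVec_mem_span (p : ℝ[X]) : polyVec p ∈ Submodule.span ℂ (Set.range numberState) := by
  have hp : p ∈ Submodule.span ℝ (Set.range hermiteSeq) := by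
    rw [hermiteSeq.span fun i =>
      isUnit_iff_ne_zero.2 (leadingCoeff_ne_zero.2 (hermiteSeq.ne_zero i))]
    exact Submodule.mem_top
  induction hp using Submodule.span_induction with
  | mem q hq =>
    obtain ⟨n, rfl⟩ := hq
    have h : polyVec (hermiteSeq n) =
        ((√(n.factorial * √Real.pi) : ℝ) : ℂ) • numberState n := by
      refine Lp.ext ?_
      filter_upwards [coeFn_polyVec (hermiteSeq n), (memLp_hermiteFun n).coeFn_toLp,
        Lp.coeFn_smul ((√(n.factorial * √Real.pi) : ℝ) : ℂ) (numberState n)] with x h1 h2 h3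
      have hpi := Real.pi_pos
      have hc : √(n.factorial * √Real.pi) ≠ 0 := by positivity
      rw [h1, h3, Pi.smul_apply, numberState, h2, smul_eq_mul, ← Complex.ofReal_mul, hermiteFun,
        ← mul_assoc, mul_inv_cancel₀ hc, one_mul, eval_hermiteSeq]
    rw [h]
    exact Submodule.smul_mem _ _ (Submodule.subset_span ⟨n, rfl⟩)
  | zero =>
    have h : polyVec 0 = 0 := by
      refine Lp.ext ?_
      filter_upwards [coeFn_polyVec 0, Lp.coeFn_zero ℂ 2 (volume : Measure ℝ)] with x h1 h2
      rw [h1, h2]; simp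
    rw [h]; exact Submodule.zero_mem _
  | add q r _ _ hq hr =>
    have h : polyVec (q + r) = polyVec q + polyVec r := by
      refine Lp.ext ?_
      filter_upwards [coeFn_polyVec (q + r), coeFn_polyVec q, coeFn_polyVec r,
        Lp.coeFn_add (polyVec q) (polyVec r)] with x h1 h2 h3 h4
      rw [h1, h4, Pi.add_apply, h2, h3, eval_add]; push_cast; ring
    rw [h]; exact Submodule.add_mem _ hq hr
  | smul c q _ hq =>
    have h : polyVec (c • q) = (c : ℂ) • polyVec q := by
      refine Lp.ext ?_
      filter_upwards [coeFn_polyVec (c • q), coeFn_polyVec q,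
        Lp.coeFn_smul (c : ℂ) (polyVec q)] with x h1 h2 h3
      rw [h1, h3, Pi.smul_apply, h2, eval_smul]; push_cast; simp [mul_assoc]
    rw [h]; exact Submodule.smul_mem _ _ hq

theorem polyVec_mem_positionGraph (p : ℝ[X]) : (polyVec p, polyVec (X * p)) ∈ positionGraph := by
  rw [mem_positionGraph]
  filter_upwards [coeFn_polyVec p, coeFn_polyVec (X * p)] with x h1 h2
  rw [h1, h2, eval_mul, eval_X]; push_cast; ring

theorem phaseShifter_mem_span (θ : ℝ) {ψ : Mode}
    (h : ψ ∈ Submodule.span ℂ (Set.range numberState)) :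
    phaseShifter θ ψ ∈ Submodule.span ℂ (Set.range numberState) := by
  induction h using Submodule.span_induction with
  | mem x hx =>
    obtain ⟨n, rfl⟩ := hx
    rw [phaseShifter_numberState]
    exact Submodule.smul_mem _ _ (Submodule.subset_span ⟨n, rfl⟩)
  | zero => simp
  | add x y _ _ hx hy => rw [map_add]; exact Submodule.add_mem _ hx hy
  | smul c x _ hx => rw [map_smul]; exact Submodule.smul_mem _ _ hx

/-- The domain is known, and the unclosed graph lies inside `rotatedGraph θ`, which is
single-valued; the image is thereby forced to be multiplication by x. -/
theorem polyVec_mem_graph (θ : ℝ) (p : ℝ[X]) :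
    (phaseShifter θ (polyVec p), phaseShifter θ (polyVec (X * p))) ∈ (preQuadrature θ).graph := by
  have hd : phaseShifter θ (polyVec p) ∈ (preQuadrature θ).domain :=
    mem_domain_preQuadrature.2 (phaseShifter_mem_span θ (polyVec_mem_span p))
  have h1 := (preQuadrature θ).mem_graph ⟨_, hd⟩
  have h2 : (phaseShifter θ (polyVec p), phaseShifter θ (polyVec (X * p))) ∈ rotatedGraph θ := by
    rw [mk_mem_rotatedGraph, phaseShifter_neg_phaseShifter, phaseShifter_neg_phaseShifter]
    exact polyVec_mem_positionGraph p
  rwa [rotatedGraph_snd_eq (graph_preQuadrature_le θ h1) h2] at h1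

/-- A square integrable function all whose moments against `(x + i) exp(-x²/2)` vanish is zero. -/
theorem eq_zero_of_shifted_moments (f : Mode) (hf : ∀ n : ℕ, ∫ x : ℝ,
    (x : ℂ) ^ n * (((x : ℂ) + Complex.I) * ((Real.exp (-(x ^ 2 / 2)) : ℝ) * f x)) = 0) : f = 0 := by
  have h2 : √2 * √2 = (2 : ℝ) := Real.mul_self_sqrt (by norm_num)
  have h20 : (√2 : ℝ) ≠ 0 := by positivity
  have hb : ∀ y : ℝ, ‖((√2 * y : ℝ) : ℂ) + Complex.I‖ * Real.exp (-(y ^ 2 / 2)) ≤ 2 := by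
    intro y
    have h3 : ‖((√2 * y : ℝ) : ℂ) + Complex.I‖ ≤ √2 * |y| + 1 := by
      refine (norm_add_le _ _).trans ?_
      rw [Complex.norm_real, Complex.norm_I, Real.norm_eq_abs, abs_mul, abs_of_pos (by positivity)]
    have h4 : y ^ 2 / 2 + 1 ≤ Real.exp (y ^ 2 / 2) := Real.add_one_le_exp _
    rw [Real.exp_neg, ← div_eq_mul_inv, div_le_iff₀ (Real.exp_pos _)]
    nlinarith [sq_nonneg (√2 * |y| - 1), sq_abs y]
  -- Substituting x = √2 y splits exp(-x²/2) into two factors exp(-y²/2). One absorbs the growth of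
  -- x + i and keeps the function square integrable; the other is the weight required by
  -- `eq_zero_of_moments`.
  have hm : MemLp (fun y : ℝ => (((√2 * y : ℝ) : ℂ) + Complex.I) *
      ((Real.exp (-(y ^ 2 / 2)) : ℝ) * f (√2 * y))) 2 volume := by
    refine (memLp_dilation h20 f).of_le_mul (c := 2) ?_ (Filter.Eventually.of_forall fun y => ?_)
    · refine AEStronglyMeasurable.mul (Continuous.aestronglyMeasurable (by fun_prop)) ?_
      exact (Continuous.aestronglyMeasurable (by fun_prop)).mul
        (memLp_dilation h20 f).aestronglyMeasurable
    · rw [← mul_assoc, norm_mul, norm_mul, Complex.norm_real, Real.norm_eq_abs,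
        abs_of_pos (Real.exp_pos _)]
      exact mul_le_mul_of_nonneg_right (hb y) (norm_nonneg _)
  have h0 : hm.toLp _ = 0 := by
    refine eq_zero_of_moments _ fun n => ?_
    have h3 : ∫ y : ℝ, (y : ℂ) ^ n * ((Real.exp (-(y ^ 2 / 2)) : ℝ) * (hm.toLp _ : Mode) y) =
        ∫ y : ℝ, (fun x : ℝ => (1 / √2 : ℂ) ^ n * ((x : ℂ) ^ n * (((x : ℂ) + Complex.I) *
          ((Real.exp (-(x ^ 2 / 2)) : ℝ) * f x)))) (√2 * y) := by
      refine integral_congr_ae ?_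
      filter_upwards [hm.coeFn_toLp] with y hy
      rw [hy]
      have e1 : ((Real.exp (-((√2 * y) ^ 2 / 2)) : ℝ) : ℂ) =
          (Real.exp (-(y ^ 2 / 2)) : ℝ) * (Real.exp (-(y ^ 2 / 2)) : ℝ) := by
        rw [← Complex.ofReal_mul, ← Real.exp_add]
        congr 2
        linear_combination (-(y ^ 2) / 2) * h2
      have e2 : (y : ℂ) ^ n = (1 / √2 : ℂ) ^ n * (((√2 * y : ℝ) : ℂ)) ^ n := by
        rw [← mul_pow]
        congr 1
        have : ((√2 : ℝ) : ℂ) ≠ 0 := by exact_mod_cast h20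
        push_cast
        field_simp
      simp only [e1, e2]
      ring
    have h4 := Measure.integral_comp_mul_left (fun x : ℝ => (1 / √2 : ℂ) ^ n * ((x : ℂ) ^ n *
      (((x : ℂ) + Complex.I) * ((Real.exp (-(x ^ 2 / 2)) : ℝ) * f x)))) √2
    refine h3.trans (h4.trans ?_)
    rw [integral_const_mul, hf n]
    simp
  have h1 : ∀ᵐ y : ℝ, f (√2 * y) = 0 := by
    have h4 := hm.coeFn_toLp
    rw [h0] at h4
    filter_upwards [h4, Lp.coeFn_zero ℂ 2 (volume : Measure ℝ)] with y h5 h6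
    rw [h6] at h5
    have h7 : ((√2 * y : ℝ) : ℂ) + Complex.I ≠ 0 := fun h => by
      simpa using congrArg Complex.im h
    have h8 : ((Real.exp (-(y ^ 2 / 2)) : ℝ) : ℂ) ≠ 0 := by exact_mod_cast (Real.exp_pos _).ne'
    have h9 := h5.symm
    rw [Pi.zero_apply] at h9
    exact (mul_eq_zero.1 ((mul_eq_zero.1 h9).resolve_left h7)).resolve_left h8
  rw [Lp.eq_zero_iff_ae_eq_zero]
  filter_upwards [ae_dilation (inv_ne_zero h20) h1] with x hx
  rwa [mul_inv_cancel_left₀ h20] at hx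

/-- A vector f orthogonal to the range of Q_θ + i is orthogonal to the rotated functions (x + i) xⁿ
exp(-x²/2). The conjugate of R(-θ)f then has vanishing shifted moments, so f = 0. -/
theorem dense_range_preQuadrature (θ : ℝ) (χ : Mode) {ε : ℝ} (hε : 0 < ε) :
    ∃ p ∈ (preQuadrature θ).graph, ‖p.2 + Complex.I • p.1 - χ‖ < ε := by
  set L : Mode × Mode →ₗ[ℂ] Mode :=
    LinearMap.snd ℂ Mode Mode + Complex.I • LinearMap.fst ℂ Mode Mode
  have hd : ((preQuadrature θ).graph.map L).topologicalClosure = ⊤ := by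
    rw [Submodule.topologicalClosure_eq_top_iff, Submodule.eq_bot_iff]
    intro f hf
    have hz : star (phaseShifter (-θ) f) = 0 := by
      refine eq_zero_of_shifted_moments _ fun n => ?_
      have h1 : inner ℂ f (phaseShifter θ (polyVec (X * X ^ n)) +
          Complex.I • phaseShifter θ (polyVec (X ^ n))) = 0 :=
        (Submodule.mem_orthogonal' _ _).1 hf _ ⟨_, polyVec_mem_graph θ (X ^ n), rfl⟩
      rw [← map_smul, ← map_add, ← (phaseShifter (-θ)).inner_map_map,
        phaseShifter_neg_phaseShifter, L2.inner_def] at h1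
      rw [← h1]
      refine integral_congr_ae ?_
      filter_upwards [Lp.coeFn_star (phaseShifter (-θ) f), coeFn_polyVec (X * X ^ n),
        coeFn_polyVec (X ^ n), Lp.coeFn_add (polyVec (X * X ^ n)) (Complex.I • polyVec (X ^ n)),
        Lp.coeFn_smul Complex.I (polyVec (X ^ n))] with x h2 h3 h4 h5 h6
      rw [h2, h5, Pi.add_apply, h6, Pi.smul_apply, h3, h4, Pi.star_apply, RCLike.inner_apply]
      simp only [eval_mul, eval_X, eval_pow, smul_eq_mul]
      push_cast
      change _ * (_ * (_ * starRingEnd ℂ _)) = _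
      ring
    have hz' : phaseShifter (-θ) f = 0 := conjugation.map_eq_zero_iff.1 hz
    exact (phaseShifter (-θ)).map_eq_zero_iff.1 hz'
  have hχ : χ ∈ closure (((preQuadrature θ).graph.map L : Submodule ℂ Mode) : Set Mode) := by
    have : χ ∈ ((preQuadrature θ).graph.map L).topologicalClosure := hd ▸ Submodule.mem_top
    exact this
  obtain ⟨_, ⟨p, hp, rfl⟩, h⟩ := Metric.mem_closure_iff.1 hχ ε hε
  refine ⟨p, hp, ?_⟩
  rw [dist_eq_norm, norm_sub_rev] at h
  exact h

/-- The quadrature operator is the maximal multiplication operator in the rotated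
representation. -/
theorem graph_quadrature (θ : ℝ) : (quadrature θ).graph = rotatedGraph θ := by
  have hg : ∀ p ∈ rotatedGraph θ, p.1 = 0 → p.2 = 0 := by
    rintro ⟨a, b⟩ hp rfl
    exact rotatedGraph_snd_eq hp (rotatedGraph θ).zero_mem
  have hG := Submodule.toLinearPMap_graph_eq (rotatedGraph θ) hg
  -- The maximal multiplication operator is a closed extension.
  have hc : (preQuadrature θ).IsClosable := by
    refine LinearPMap.isClosable_iff_exists_closed_extension.2
      ⟨(rotatedGraph θ).toLinearPMap, ?_, LinearPMap.le_of_le_graph ?_⟩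
    · rw [LinearPMap.IsClosed, hG]; exact isClosed_rotatedGraph θ
    · rw [hG]; exact graph_preQuadrature_le θ
  change (preQuadrature θ).closure.graph = _
  rw [← hc.graph_closure_eq_closure_graph]
  refine le_antisymm (Submodule.topologicalClosure_minimal _ (graph_preQuadrature_le θ)
    (isClosed_rotatedGraph θ)) ?_
  rintro ⟨ψ, χ⟩ hp
  refine Metric.mem_closure_iff.2 fun ε hε => ?_
  -- The difference of the two graph elements lies in `rotatedGraph θ`, so closeness of b + ia to χ
  -- + iψ controls both components.
  obtain ⟨⟨a, b⟩, hab, h⟩ := dense_range_preQuadrature θ (χ + Complex.I • ψ) hε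
  refine ⟨(a, b), hab, ?_⟩
  have h1 := norm_le_of_mem_rotatedGraph
    ((rotatedGraph θ).sub_mem (graph_preQuadrature_le θ hab) hp)
  have e : b - χ + Complex.I • (a - ψ) = b + Complex.I • a - (χ + Complex.I • ψ) := by
    rw [smul_sub]; abel
  rw [e] at h1
  rw [dist_comm, Prod.dist_eq, max_lt_iff, dist_eq_norm, dist_eq_norm]
  exact ⟨h1.1.trans_lt h, h1.2.trans_lt h⟩

/-! ### The spectral measures of the quadrature operators -/

theorem indicatorObservable_measure {α : Type*} [MeasurableSpace α] (μ : Measure α)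
    (ψ : Lp ℂ 2 μ) :
    (indicatorObservable μ).measure ψ = μ.withDensity fun x => ENNReal.ofReal (‖ψ x‖ ^ 2) := by
  ext X hX
  have hi : Integrable (fun x => ‖ψ x‖ ^ 2) μ :=
    (memLp_two_iff_integrable_sq_norm (Lp.aestronglyMeasurable ψ)).1 (Lp.memLp ψ)
  rw [Observable.measure_apply _ _ hX, withDensity_apply _ hX,
    ← ofReal_integral_eq_lintegral_ofReal hi.integrableOn
      (Filter.Eventually.of_forall fun x => by positivity)]
  congr 1
  change (inner ℂ ψ (indicatorOp μ X ψ)).re = _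
  rw [inner_indicatorOp hX]
  have : ∫ x in X, inner ℂ (ψ x) (ψ x) ∂μ = ((∫ x in X, ‖ψ x‖ ^ 2 ∂μ : ℝ) : ℂ) := by
    rw [← integral_complex_ofReal]
    congr 1; funext x
    rw [inner_self_eq_norm_sq_to_K]; simp
  rw [this, Complex.ofReal_re]

/-- Transport of an observable along a unitary operator. -/
def Observable.conj {α K : Type*} [MeasurableSpace α] [NormedAddCommGroup K]
    [InnerProductSpace ℂ K] (E : Observable α K) (U : K ≃ₗᵢ[ℂ] K) : Observable α K where
  toFun X := (U : K →L[ℂ] K).comp ((E X).comp (U.symm : K →L[ℂ] K))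
  isPositive X hX := by
    have h := E.isPositive X hX
    have hi : ∀ φ ψ, inner ℂ (U (E X (U.symm φ))) ψ = inner ℂ (E X (U.symm φ)) (U.symm ψ) := by
      intro φ ψ
      rw [← U.inner_map_map _ (U.symm ψ), U.apply_symm_apply]
    rw [ContinuousLinearMap.isPositive_iff_complex] at h ⊢
    intro ψ
    have h2 := h (U.symm ψ)
    rw [← hi] at h2
    exact h2
  map_univ := by
    ext1 ψ
    change U (E Set.univ (U.symm ψ)) = ψ
    rw [E.map_univ]
    exact U.apply_symm_apply ψ
  hasSum_iUnion X hX hd φ ψ := by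
    have h := E.hasSum_iUnion X hX hd (U.symm φ) (U.symm ψ)
    have hi : ∀ X, inner ℂ φ (U (E X (U.symm ψ))) = inner ℂ (U.symm φ) (E X (U.symm ψ)) := by
      intro X
      rw [← U.inner_map_map (U.symm φ), U.apply_symm_apply]
    simp only [← hi] at h
    exact h
  not_measurable X hX := by
    rw [E.not_measurable X hX]; simp

theorem Observable.conj_apply {α K : Type*} [MeasurableSpace α] [NormedAddCommGroup K]
    [InnerProductSpace ℂ K] (E : Observable α K) (U : K ≃ₗᵢ[ℂ] K) (X : Set α) (ψ : K) :
    E.conj U X ψ = U (E X (U.symm ψ)) := rfl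

theorem Observable.conj_measure {α K : Type*} [MeasurableSpace α] [NormedAddCommGroup K]
    [InnerProductSpace ℂ K] (E : Observable α K) (U : K ≃ₗᵢ[ℂ] K) (ψ : K) :
    (E.conj U).measure ψ = E.measure (U.symm ψ) := by
  ext X hX
  rw [Observable.measure_apply _ _ hX, Observable.measure_apply _ _ hX, E.conj_apply,
    ← U.inner_map_map (U.symm ψ), U.apply_symm_apply]

/-- The spectral measure of `Q_θ`: multiplication by indicator functions, rotated by `R(θ)`. -/
def quadratureObservable (θ : ℝ) : Observable ℝ Mode :=
  (indicatorObservable volume).conj (phaseShifter θ)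

theorem quadratureObservable_apply (θ : ℝ) (X : Set ℝ) (ψ : Mode) :
    quadratureObservable θ X ψ =
      phaseShifter θ (indicatorOp volume X (phaseShifter (-θ) ψ)) := by
  rw [← phaseShifter_symm]; rfl

theorem quadratureObservable_mul_self (θ : ℝ) (X : Set ℝ) :
    quadratureObservable θ X * quadratureObservable θ X = quadratureObservable θ X := by
  ext1 ψ
  rw [mul_apply_eq_comp, quadratureObservable_apply, quadratureObservable_apply,
    phaseShifter_neg_phaseShifter, ← mul_apply_eq_comp, indicatorOp_mul_self]

theorem measure_quadratureObservable (θ : ℝ) (ψ : Mode) : (quadratureObservable θ).measure ψ =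
    volume.withDensity fun x => ENNReal.ofReal (‖phaseShifter (-θ) ψ x‖ ^ 2) := by
  rw [quadratureObservable, Observable.conj_measure, indicatorObservable_measure, phaseShifter_symm]

/-- After rotation the measure of ψ has density |ψ'|², where ψ' = R(-θ)ψ. Integrability of x² is
then square integrability of xψ', which is the domain of the maximal multiplication operator. -/
theorem isSpectralMeasure_quadratureObservable (θ : ℝ) :
    IsSpectralMeasure (quadratureObservable θ) (quadrature θ) := by
  have hae : ∀ ψ : Mode, AEMeasurable (fun x => ENNReal.ofReal (‖ψ x‖ ^ 2)) volume := fun ψ =>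
    ((Lp.aestronglyMeasurable ψ).norm.aemeasurable.pow_const 2).ennreal_ofReal
  refine ⟨quadratureObservable_mul_self θ, fun ψ => ?_, fun ψ => ?_⟩
  · rw [measure_quadratureObservable, integrable_withDensity_iff_integrable_smul₀' (hae _)
      (Filter.Eventually.of_forall fun x => ENNReal.ofReal_lt_top), LinearPMap.mem_domain_iff,
      graph_quadrature]
    set ψ' := phaseShifter (-θ) ψ with hψ'
    have hm : AEStronglyMeasurable (fun x : ℝ => (x : ℂ) * ψ' x) volume :=
      (Continuous.aestronglyMeasurable (by fun_prop)).mul (Lp.aestronglyMeasurable ψ')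
    have e : (fun x : ℝ => (ENNReal.ofReal (‖ψ' x‖ ^ 2)).toReal • x ^ 2) =
        fun x : ℝ => ‖(x : ℂ) * ψ' x‖ ^ 2 := by
      funext x
      rw [ENNReal.toReal_ofReal (by positivity), norm_mul, mul_pow, Complex.norm_real,
        Real.norm_eq_abs, sq_abs, smul_eq_mul, mul_comm]
    rw [e, ← memLp_two_iff_integrable_sq_norm hm]
    constructor
    · rintro ⟨χ, hχ⟩
      exact (memLp_congr_ae (mem_rotatedGraph.1 hχ)).1 (Lp.memLp _)
    · intro h
      refine ⟨phaseShifter θ (h.toLp _), ?_⟩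
      rw [mk_mem_rotatedGraph, phaseShifter_neg_phaseShifter]
      exact h.coeFn_toLp
  · rw [measure_quadratureObservable, integral_withDensity_eq_integral_toReal_smul₀ (hae _)
      (Filter.Eventually.of_forall fun x => ENNReal.ofReal_lt_top)]
    have hg : ((ψ : Mode), quadrature θ ψ) ∈ rotatedGraph θ := by
      rw [← graph_quadrature]; exact LinearPMap.mem_graph _ ψ
    rw [← (phaseShifter (-θ)).inner_map_map, L2.inner_def, ← integral_complex_ofReal]
    refine integral_congr_ae ?_
    filter_upwards [mem_rotatedGraph.1 hg] with x hx
    rw [hx, ENNReal.toReal_ofReal (by positivity), RCLike.inner_apply, mul_assoc, Complex.mul_conj']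
    rw [smul_eq_mul, mul_comm]
    push_cast
    rfl

theorem dense_domain_quadrature (θ : ℝ) : Dense ((quadrature θ).domain : Set Mode) := by
  have h : Dense (Submodule.span ℂ (Set.range numberState) : Set Mode) :=
    Submodule.dense_iff_topologicalClosure_eq_top.2 topologicalClosure_span_numberState
  refine h.mono fun ψ hψ => ?_
  exact (LinearPMap.le_closure (preQuadrature θ)).1 (mem_domain_preQuadrature.2 hψ)

/-! ### Uniqueness of the spectral measure of a quadrature operator -/

section Uniqueness

variable {θ : ℝ} {E : Observable ℝ Mode}

/-- Applying Q_θ - c stays in the range of E[c-r, c+r] and costs at most a factor r, while in the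
rotated representation it multiplies by x - c. -/
theorem IsSpectralMeasure.exists_iterate (hE : IsSpectralMeasure E (quadrature θ)) (c : ℝ) {r : ℝ}
    (hr : 0 < r) {ψ : Mode} (hψ : E (Set.Icc (c - r) (c + r)) ψ = ψ) (n : ℕ) :
    ∃ χ : Mode, E (Set.Icc (c - r) (c + r)) χ = χ ∧ ‖χ‖ ≤ r ^ n * ‖ψ‖ ∧
      phaseShifter (-θ) χ =ᵐ[volume] fun x : ℝ => ((x - c : ℝ) : ℂ) ^ n * phaseShifter (-θ) ψ x := by
  induction n with
  | zero => exact ⟨ψ, hψ, by simp, by simp⟩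
  | succ n ih =>
    obtain ⟨χ, h1, h2, h3⟩ := ih
    have hd : χ ∈ (quadrature θ).domain := h1 ▸ hE.Icc_mem_domain _ _ χ
    obtain ⟨h4, h5⟩ := hE.norm_sub_le (dense_domain_quadrature θ) c hr ⟨χ, hd⟩ h1
    refine ⟨_, h4, h5.trans ?_, ?_⟩
    · rw [pow_succ', mul_assoc]
      exact mul_le_mul_of_nonneg_left h2 hr.le
    · have hg : (χ, quadrature θ ⟨χ, hd⟩) ∈ rotatedGraph θ := by
        rw [← graph_quadrature]; exact LinearPMap.mem_graph _ ⟨χ, hd⟩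
      rw [map_sub, map_smul]
      filter_upwards [h3, mem_rotatedGraph.1 hg, Lp.coeFn_sub (phaseShifter (-θ)
        (quadrature θ ⟨χ, hd⟩)) ((c : ℂ) • phaseShifter (-θ) χ),
        Lp.coeFn_smul (c : ℂ) (phaseShifter (-θ) χ)] with x h6 h7 h8 h9
      rw [h8, Pi.sub_apply, h7, h9, Pi.smul_apply, h6, smul_eq_mul]
      push_cast
      ring

/-- Mass where |x - c| ≥ s > r would make the n-th iterate grow like sⁿ, against the bound rⁿ‖ψ‖.
The values s = r + 1/(m+1) exhaust the complement of the interval. -/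
theorem IsSpectralMeasure.ae_eq_zero (hE : IsSpectralMeasure E (quadrature θ)) (c : ℝ) {r : ℝ}
    (hr : 0 < r) {ψ : Mode} (hψ : E (Set.Icc (c - r) (c + r)) ψ = ψ) :
    ∀ᵐ x : ℝ, x ∉ Set.Icc (c - r) (c + r) → phaseShifter (-θ) ψ x = 0 := by
  set ψ' := phaseShifter (-θ) ψ with hψ'
  have hS : ∀ m : ℕ, MeasurableSet {x : ℝ | r + 1 / ((m : ℝ) + 1) ≤ |x - c|} := fun m =>
    measurableSet_le measurable_const (by fun_prop)
  have key : ∀ m : ℕ, indicatorOp volume {x : ℝ | r + 1 / ((m : ℝ) + 1) ≤ |x - c|} ψ' = 0 := by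
    intro m
    set s := r + 1 / ((m : ℝ) + 1) with hs
    have hrs : r < s := by rw [hs]; linarith [show 0 < 1 / ((m : ℝ) + 1) by positivity]
    have hs0 : 0 < s := hr.trans hrs
    have hle : ∀ n : ℕ, ‖indicatorOp volume {x : ℝ | s ≤ |x - c|} ψ'‖ ≤ (r / s) ^ n * ‖ψ‖ := by
      intro n
      obtain ⟨χ, -, h2, h3⟩ := hE.exists_iterate c hr hψ n
      have h4 : ‖((s ^ n : ℝ) : ℂ) • indicatorOp volume {x : ℝ | s ≤ |x - c|} ψ'‖ ≤
          ‖phaseShifter (-θ) χ‖ := by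
        refine Lp.norm_le_norm_of_ae_le ?_
        filter_upwards [h3, Lp.coeFn_smul ((s ^ n : ℝ) : ℂ)
          (indicatorOp volume {x : ℝ | s ≤ |x - c|} ψ'), coeFn_indicatorOp (hS m) ψ']
          with x h5 h6 h7
        rw [h5, h6, Pi.smul_apply, h7, smul_eq_mul, norm_mul, norm_mul, Complex.norm_real, norm_pow,
          norm_pow, Complex.norm_real, Real.norm_eq_abs, Real.norm_eq_abs, abs_of_pos hs0]
        by_cases hx : x ∈ {x : ℝ | s ≤ |x - c|}
        · rw [Set.indicator_of_mem hx]
          exact mul_le_mul_of_nonneg_right (pow_le_pow_left₀ hs0.le hx n) (norm_nonneg _)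
        · rw [Set.indicator_of_notMem hx, norm_zero, mul_zero]
          positivity
      rw [norm_smul, Complex.norm_real, Real.norm_eq_abs, abs_of_pos (by positivity),
        LinearIsometryEquiv.norm_map] at h4
      rw [div_pow, div_mul_eq_mul_div, le_div_iff₀ (by positivity), mul_comm]
      exact h4.trans h2
    have hlim : Filter.Tendsto (fun n : ℕ => (r / s) ^ n * ‖ψ‖) Filter.atTop (nhds (0 * ‖ψ‖)) :=
      (tendsto_pow_atTop_nhds_zero_of_lt_one (by positivity) ((div_lt_one hs0).2 hrs)).mul_const _
    rw [zero_mul] at hlim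
    exact norm_le_zero_iff.1 (ge_of_tendsto' hlim hle)
  have hall : ∀ᵐ x : ℝ, ∀ m : ℕ, r + 1 / ((m : ℝ) + 1) ≤ |x - c| → ψ' x = 0 := by
    rw [ae_all_iff]
    intro m
    filter_upwards [coeFn_indicatorOp (hS m) ψ', Lp.coeFn_zero ℂ 2 (volume : Measure ℝ)]
      with x h1 h2 hx
    rw [key m, h2, Set.indicator_of_mem (by exact hx)] at h1
    exact h1.symm
  filter_upwards [hall] with x hx hxA
  have h1 : r < |x - c| := by
    by_contra hcon
    have := abs_le.1 (not_lt.1 hcon)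
    exact hxA ⟨by linarith, by linarith⟩
  obtain ⟨m, hm⟩ := exists_nat_one_div_lt (sub_pos.2 h1)
  exact hx m (by linarith)

/-- The two spectral measures are mutually disjoint on `X` and the complement of `Y ⊇ X`. -/
theorem IsSpectralMeasure.quadratureObservable_mul_eq_zero
    (hE : IsSpectralMeasure E (quadrature θ)) {X : ℕ → Set ℝ} {c : ℕ → ℝ} {Y : Set ℝ}
    (hX : ∀ n, MeasurableSet (X n)) (hd : Pairwise (Function.onFun Disjoint X))
    (hXc : ∀ n, X n ⊆ Set.Icc (c n - 1 / 2) (c n + 1 / 2)) (hY : MeasurableSet Y)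
    (hYc : ∀ n, Disjoint Y (Set.Icc (c n - 1 / 2) (c n + 1 / 2))) :
    quadratureObservable θ Y * E (⋃ n, X n) = 0 := by
  -- Each piece lies in one unit interval, where `IsSpectralMeasure.ae_eq_zero` applies with r =
  -- 1/2; weak countable additivity then sums the pieces.
  have h0 : ∀ n ψ, quadratureObservable θ Y (E (X n) ψ) = 0 := by
    intro n ψ
    have h1 : E (Set.Icc (c n - 1 / 2) (c n + 1 / 2)) (E (X n) ψ) = E (X n) ψ := by
      rw [← mul_apply_eq_comp, Observable.mul_eq_inter hE.1 measurableSet_Icc (hX n),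
        Set.inter_eq_right.2 (hXc n)]
    have h2 := hE.ae_eq_zero (c n) (by norm_num) h1
    have h3 : indicatorOp volume Y (phaseShifter (-θ) (E (X n) ψ)) = 0 := by
      refine Lp.ext ?_
      filter_upwards [h2, coeFn_indicatorOp hY (phaseShifter (-θ) (E (X n) ψ)),
        Lp.coeFn_zero ℂ 2 (volume : Measure ℝ)] with x h4 h5 h6
      rw [h5, h6]
      by_cases hx : x ∈ Y
      · rw [Set.indicator_of_mem hx]
        exact h4 (Set.disjoint_left.1 (hYc n) hx)
      · rw [Set.indicator_of_notMem hx]; rfl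
    rw [quadratureObservable_apply, h3, map_zero]
  ext1 ψ
  refine ext_inner_left ℂ fun φ => ?_
  have h1 := E.hasSum_iUnion X hX hd (quadratureObservable θ Y φ) ψ
  simp only [(quadratureObservable θ).inner_comm hY, h0, inner_zero_right] at h1
  rw [mul_apply_eq_comp, zero_apply, inner_zero_right]
  exact h1.unique hasSum_zero

/-- Half-lines are disjoint unions of unit intervals, so E on one side of a point and F on the other
multiply to zero. This forces E(-∞, a] = F(-∞, a]E(-∞, a] = F(-∞, a], and half-lines determine
finite measures. -/
theorem IsSpectralMeasure.eq_quadratureObservable (hE : IsSpectralMeasure E (quadrature θ)) :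
    E = quadratureObservable θ := by
  set F := quadratureObservable θ with hF
  have hFm : ∀ X, F X * F X = F X := quadratureObservable_mul_self θ
  have hfloor : ∀ t : ℝ, 0 ≤ t → ∃ n : ℕ, (n : ℝ) ≤ t ∧ t < n + 1 := fun t ht =>
    ⟨⌊t⌋₊, Nat.floor_le ht, Nat.lt_floor_add_one t⟩
  have hsep : ∀ {i j : ℕ}, i ≠ j → (i : ℝ) + 1 ≤ j ∨ (j : ℝ) + 1 ≤ i := by
    intro i j hij
    rcases lt_or_gt_of_ne hij with h | h
    · left; exact_mod_cast h
    · right; exact_mod_cast h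
  have hIic : ∀ a : ℝ, F (Set.Ioi a) * E (Set.Iic a) = 0 := by
    intro a
    have hU : Set.Iic a = ⋃ n : ℕ, Set.Ioc (a - n - 1) (a - n) := by
      ext x
      simp only [Set.mem_Iic, Set.mem_iUnion, Set.mem_Ioc]
      constructor
      · intro hx
        obtain ⟨n, h1, h2⟩ := hfloor (a - x) (by linarith)
        exact ⟨n, by linarith, by linarith⟩
      · rintro ⟨n, -, h⟩
        linarith [Nat.cast_nonneg (α := ℝ) n]
    rw [hU]
    refine hE.quadratureObservable_mul_eq_zero (c := fun n : ℕ => a - n - 1 / 2)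
      (fun n => measurableSet_Ioc) ?_ ?_ measurableSet_Ioi ?_
    · intro i j hij
      refine Set.disjoint_left.2 fun x hi hj => ?_
      rcases hsep hij with h | h <;> linarith [hi.1, hi.2, hj.1, hj.2]
    · intro n x hx
      constructor <;> linarith [hx.1, hx.2]
    · intro n
      refine Set.disjoint_left.2 fun x hx hx' => ?_
      have h1 : a < x := hx
      linarith [hx'.2, Nat.cast_nonneg (α := ℝ) n]
  have hIci : ∀ a : ℝ, F (Set.Iio a) * E (Set.Ici a) = 0 := by
    intro a
    have hU : Set.Ici a = ⋃ n : ℕ, Set.Ico (a + n) (a + n + 1) := by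
      ext x
      simp only [Set.mem_Ici, Set.mem_iUnion, Set.mem_Ico]
      constructor
      · intro hx
        obtain ⟨n, h1, h2⟩ := hfloor (x - a) (by linarith)
        exact ⟨n, by linarith, by linarith⟩
      · rintro ⟨n, h, -⟩
        linarith [Nat.cast_nonneg (α := ℝ) n]
    rw [hU]
    refine hE.quadratureObservable_mul_eq_zero (c := fun n : ℕ => a + n + 1 / 2)
      (fun n => measurableSet_Ico) ?_ ?_ measurableSet_Iio ?_
    · intro i j hij
      refine Set.disjoint_left.2 fun x hi hj => ?_
      rcases hsep hij with h | h <;> linarith [hi.1, hi.2, hj.1, hj.2]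
    · intro n x hx
      constructor <;> linarith [hx.1, hx.2]
    · intro n
      refine Set.disjoint_left.2 fun x hx hx' => ?_
      have h1 : x < a := hx
      linarith [hx'.1, Nat.cast_nonneg (α := ℝ) n]
  -- The support lemma works with closed intervals, so `hIci` reaches only the open half-line; the
  -- endpoint is Lebesgue null and carries no mass of F.
  have hnull : ∀ a : ℝ, F (Set.Iic a) = F (Set.Iio a) := by
    intro a
    ext1 ψ
    rw [hF, quadratureObservable_apply, quadratureObservable_apply]
    congr 1
    refine Lp.ext ?_
    have h0 : ∀ᵐ x : ℝ, x ≠ a := by simp [ae_iff]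
    filter_upwards [coeFn_indicatorOp measurableSet_Iic (phaseShifter (-θ) ψ),
      coeFn_indicatorOp measurableSet_Iio (phaseShifter (-θ) ψ), h0] with x h1 h2 h3
    rw [h1, h2]
    simp only [Set.indicator, Set.mem_Iic, Set.mem_Iio, h3.le_iff_lt]
  have hEF : ∀ a : ℝ, E (Set.Iic a) = F (Set.Iic a) := by
    intro a
    have hsplit : ∀ G : Observable ℝ Mode, G (Set.Iic a) + G (Set.Ioi a) = 1 := fun G => by
      rw [← G.map_union measurableSet_Iic measurableSet_Ioi
        (Set.disjoint_left.2 fun x h1 h2 => (not_le.2 (show a < x from h2)) h1), Set.Iic_union_Ioi, G.map_univ]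
    have h1 : E (Set.Iic a) = F (Set.Iic a) * E (Set.Iic a) := by
      have := congrArg (· * E (Set.Iic a)) (hsplit F)
      simp only [add_mul, hIic a, add_zero, one_mul] at this
      exact this.symm
    have h2 : F (Set.Iic a) * E (Set.Ioi a) = 0 := by
      have h3 : E (Set.Ici a) * E (Set.Ioi a) = E (Set.Ioi a) := by
        rw [Observable.mul_eq_inter hE.1 measurableSet_Ici measurableSet_Ioi,
          Set.inter_eq_right.2 Set.Ioi_subset_Ici_self]
      rw [hnull, ← h3, ← mul_assoc, hIci, zero_mul]
    have h3 : F (Set.Iic a) = F (Set.Iic a) * E (Set.Iic a) := by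
      have := congrArg (F (Set.Iic a) * ·) (hsplit E)
      simp only [mul_add, h2, add_zero, mul_one] at this
      exact this.symm
    rw [h1, ← h3]
  refine Observable.ext_of_measure fun ψ => Measure.ext_of_Iic _ _ fun a => ?_
  rw [Observable.measure_apply _ _ measurableSet_Iic, Observable.measure_apply _ _ measurableSet_Iic,
    hEF]

end Uniqueness

theorem spectralMeasure_quadrature (θ : ℝ) (X : Set ℝ) :
    spectralMeasure (quadrature θ) X = quadratureObservable θ X := by
  have h : ∃ E : Observable ℝ Mode, IsSpectralMeasure E (quadrature θ) :=
    ⟨_, isSpectralMeasure_quadratureObservable θ⟩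
  rw [spectralMeasure, dif_pos h, h.choose_spec.eq_quadratureObservable]

/-! ### The unitary operator `V_θ` -/

theorem coeFn_dilation {k : ℝ} (hk : k ≠ 0) (ψ : Mode) :
    dilation k ψ =ᵐ[volume] fun x => ψ (k * x) := by
  rw [dilation, dif_pos hk]
  exact (memLp_dilation hk ψ).coeFn_toLp

theorem one_add_cos_pos {θ : ℝ} (hθ : θ ∈ Set.Ioo (-Real.pi) 0 ∪ Set.Ioo 0 Real.pi) :
    0 < 1 + Real.cos θ := by
  have h : Real.cos θ ≠ -1 := by
    intro h
    have h1 : |θ| < Real.pi := by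
      rcases hθ with h | h
      · rw [abs_lt]; exact ⟨h.1, by linarith [h.2, Real.pi_pos]⟩
      · rw [abs_lt]; exact ⟨by linarith [h.1, Real.pi_pos], h.2⟩
    have h2 := Real.cos_lt_cos_of_nonneg_of_le_pi (abs_nonneg θ) le_rfl h1
    rw [Real.cos_pi, Real.cos_abs] at h2
    exact h2.ne' h
  have := lt_of_le_of_ne (Real.neg_one_le_cos θ) h.symm
  linarith

theorem sin_ne_zero_of_mem {θ : ℝ} (hθ : θ ∈ Set.Ioo (-Real.pi) 0 ∪ Set.Ioo 0 Real.pi) :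
    Real.sin θ ≠ 0 := by
  rcases hθ with h | h
  · exact (Real.sin_neg_of_neg_of_neg_pi_lt h.2 h.1).ne
  · exact (Real.sin_pos_of_pos_of_lt_pi h.1 h.2).ne'

/-- By (1 - cos θ)(1 + cos θ) = sin²θ, the dilation factor of A_θ is the square of its scalar
prefactor; this is why A_θ preserves norms. -/
theorem sqrt_div_eq {θ : ℝ} (hθ : θ ∈ Set.Ioo (-Real.pi) 0 ∪ Set.Ioo 0 Real.pi) :
    √((1 - Real.cos θ) / (1 + Real.cos θ)) = |Real.sin θ| / (1 + Real.cos θ) := by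
  have h := one_add_cos_pos hθ
  rw [Real.sqrt_eq_iff_mul_self_eq_of_pos (div_pos (abs_pos.2 (sin_ne_zero_of_mem hθ)) h),
    div_mul_div_comm, abs_mul_abs_self, div_eq_div_iff (by positivity) (by positivity)]
  linear_combination (1 + Real.cos θ) * Real.sin_sq_add_cos_sq θ

theorem coeFn_squeeze {θ : ℝ} (hθ : θ ∈ Set.Ioo (-Real.pi) 0 ∪ Set.Ioo 0 Real.pi) (ψ : Mode) :
    squeeze θ ψ =ᵐ[volume] fun x => ((√(|Real.sin θ| / (1 + Real.cos θ)) : ℝ) : ℂ) *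
      ψ (|Real.sin θ| / (1 + Real.cos θ) * x) := by
  have hk : 0 < |Real.sin θ| / (1 + Real.cos θ) :=
    div_pos (abs_pos.2 (sin_ne_zero_of_mem hθ)) (one_add_cos_pos hθ)
  rw [squeeze, sqrt_div_eq hθ]
  filter_upwards [coeFn_dilation hk.ne' ψ, Lp.coeFn_smul
    ((√(|Real.sin θ| / (1 + Real.cos θ)) : ℝ) : ℂ)
    (dilation (|Real.sin θ| / (1 + Real.cos θ)) ψ)] with x h1 h2
  rw [smul_apply, h2, Pi.smul_apply, h1, smul_eq_mul]

theorem inner_squeeze_squeeze {θ : ℝ} (hθ : θ ∈ Set.Ioo (-Real.pi) 0 ∪ Set.Ioo 0 Real.pi)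
    (φ ψ : Mode) : inner ℂ (squeeze θ φ) (squeeze θ ψ) = inner ℂ φ ψ := by
  rw [inner_eq_integral (coeFn_squeeze hθ φ) (coeFn_squeeze hθ ψ),
    inner_eq_integral (Filter.EventuallyEq.refl _ φ) (Filter.EventuallyEq.refl _ ψ)]
  set k := |Real.sin θ| / (1 + Real.cos θ)
  have hk : 0 < k := div_pos (abs_pos.2 (sin_ne_zero_of_mem hθ)) (one_add_cos_pos hθ)
  have hk2 : ((√k : ℝ) : ℂ) * ((√k : ℝ) : ℂ) = (k : ℝ) := by
    rw [← Complex.ofReal_mul, Real.mul_self_sqrt hk.le]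
  have e : (fun x : ℝ => ((√k : ℝ) : ℂ) * ψ (k * x) * starRingEnd ℂ (((√k : ℝ) : ℂ) * φ (k * x))) =
      fun x : ℝ => (k : ℂ) * (fun y => ψ y * starRingEnd ℂ (φ y)) (k * x) := by
    funext x
    rw [map_mul, Complex.conj_ofReal]
    linear_combination (ψ (k * x) * starRingEnd ℂ (φ (k * x))) * hk2
  rw [e, integral_const_mul, Measure.integral_comp_mul_left (fun y => ψ y * starRingEnd ℂ (φ y)),
    abs_of_pos (inv_pos.2 hk), Complex.real_smul, ← mul_assoc, ← Complex.ofReal_mul,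
    mul_inv_cancel₀ hk.ne', Complex.ofReal_one, one_mul]

theorem tiltUnitary_apply (θ : ℝ) (ψ : Mode) : tiltUnitary θ ψ =
    phaseShifter (if 0 < θ then (θ - Real.pi) / 2 else (θ + Real.pi) / 2)
      (squeeze θ (phaseShifter (θ / 2) ψ)) := rfl

theorem norm_tiltUnitary_apply {θ : ℝ} (hθ : θ ∈ Set.Ioo (-Real.pi) 0 ∪ Set.Ioo 0 Real.pi)
    (ψ : Mode) : ‖tiltUnitary θ ψ‖ = ‖ψ‖ := by
  rw [tiltUnitary_apply, LinearIsometryEquiv.norm_map,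
    (LinearMap.norm_map_iff_inner_map_map (squeeze θ)).2 (inner_squeeze_squeeze hθ),
    LinearIsometryEquiv.norm_map]

theorem inner_squeeze_gaussVec {θ : ℝ} (hθ : θ ∈ Set.Ioo (-Real.pi) 0 ∪ Set.Ioo 0 Real.pi)
    (v ζ : ℂ) : inner ℂ (squeeze θ (gaussVec v)) (gaussVec ζ) =
      (√(Real.pi * |Real.sin θ|) : ℝ) * Complex.exp ((1 + Real.cos θ : ℝ) / 2 *
        ((|Real.sin θ| / (1 + Real.cos θ) : ℝ) * starRingEnd ℂ v + ζ) ^ 2) := by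
  have hc := one_add_cos_pos hθ
  have hs := abs_pos.2 (sin_ne_zero_of_mem hθ)
  set k := |Real.sin θ| / (1 + Real.cos θ) with hkdef
  have hk : 0 < k := div_pos hs hc
  have h1 : squeeze θ (gaussVec v) =ᵐ[volume] fun x => ((√k : ℝ) : ℂ) * gaussFun v (k * x) := by
    filter_upwards [coeFn_squeeze hθ (gaussVec v), ae_dilation hk.ne' (coeFn_gaussVec v)]
      with x h2 h3
    rw [h2, h3]
  -- Here k = |tan(θ/2)|, and this is the half-angle identity.
  have hk2 : 1 + k ^ 2 = 2 / (1 + Real.cos θ) := by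
    rw [hkdef, div_pow, sq_abs, Real.sin_sq]
    field_simp
    ring
  have hsq : √k * √(2 * Real.pi / (1 + k ^ 2)) = √(Real.pi * |Real.sin θ|) := by
    rw [← Real.sqrt_mul hk.le, hk2, hkdef]
    congr 1
    field_simp
  rw [inner_eq_integral h1 (coeFn_gaussVec ζ)]
  simp only [map_mul, Complex.conj_ofReal, mul_left_comm _ ((√k : ℝ) : ℂ)]
  rw [integral_const_mul, integral_gaussFun_mul_conj, ← mul_assoc, ← Complex.ofReal_mul, hsq, hk2]
  congr 2
  push_cast
  have : (1 + Complex.cos θ : ℂ) ≠ 0 := by exact_mod_cast hc.ne'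
  field_simp

/-- The two definitions of V_θ lead to one formula: they differ by the sign ε of sin θ, which
multiplies both terms of a square. The argument is conjugated in advance because V_θ will be applied
after C. -/
theorem inner_tiltUnitary_gaussVec {θ : ℝ} (hθ : θ ∈ Set.Ioo (-Real.pi) 0 ∪ Set.Ioo 0 Real.pi)
    (u z : ℂ) : inner ℂ (tiltUnitary θ (gaussVec (starRingEnd ℂ u))) (gaussVec z) =
      (√(Real.pi * |Real.sin θ|) : ℝ) * Complex.exp (
        u ^ 2 / 2 * (1 - Complex.exp (-(θ * Complex.I))) +
        z ^ 2 / 2 * (1 + Complex.exp (-(θ * Complex.I))) +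
        Complex.exp (-(θ * Complex.I)) * ((1 - Real.cos θ) / 2 * u ^ 2 +
          Complex.I * Real.sin θ * u * z - (1 + Real.cos θ) / 2 * z ^ 2)) := by
  have hc : ((1 + Real.cos θ : ℝ) : ℂ) ≠ 0 := by exact_mod_cast (one_add_cos_pos hθ).ne'
  set β := if 0 < θ then (θ - Real.pi) / 2 else (θ + Real.pi) / 2 with hβ
  set h := Complex.exp (-(θ / 2 * Complex.I)) with hh
  set e := Complex.exp (-(θ * Complex.I)) with he
  have hhe : h ^ 2 = e := by rw [hh, he, ← Complex.exp_nat_mul]; congr 1; push_cast; ring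
  -- The shift by ∓π/2 in the outer phase shifter supplies the factor εi, with the same ε that
  -- removes the absolute value from sin θ.
  obtain ⟨ε, hε1, hε2, hε3⟩ : ∃ ε : ℝ, ε ^ 2 = 1 ∧ |Real.sin θ| = ε * Real.sin θ ∧
      Complex.exp (Complex.I * (-β : ℝ)) = ε * Complex.I * h := by
    rcases hθ with ht | ht
    · refine ⟨-1, by norm_num, ?_, ?_⟩
      · rw [abs_of_neg (Real.sin_neg_of_neg_of_neg_pi_lt ht.2 ht.1)]; ring
      · rw [hβ, if_neg (not_lt.2 ht.2.le), hh]
        have : Complex.I * ((-((θ + Real.pi) / 2) : ℝ) : ℂ) =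
            -(θ / 2 * Complex.I) + -(Real.pi / 2 * Complex.I) := by push_cast; ring
        rw [this, Complex.exp_add, Complex.exp_neg (Real.pi / 2 * Complex.I),
          Complex.exp_pi_div_two_mul_I, Complex.inv_I]
        push_cast; ring
    · refine ⟨1, by norm_num, ?_, ?_⟩
      · rw [abs_of_pos (Real.sin_pos_of_pos_of_lt_pi ht.1 ht.2)]; ring
      · rw [hβ, if_pos ht.1, hh]
        have : Complex.I * ((-((θ - Real.pi) / 2) : ℝ) : ℂ) =
            -(θ / 2 * Complex.I) + Real.pi / 2 * Complex.I := by push_cast; ring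
        rw [this, Complex.exp_add, Complex.exp_pi_div_two_mul_I]
        push_cast; ring
  have hεc : (ε : ℂ) ^ 2 = 1 := by exact_mod_cast hε1
  have hE2 : Complex.exp (2 * Complex.I * (-β : ℝ)) = -e := by
    have : 2 * Complex.I * ((-β : ℝ) : ℂ) = (2 : ℕ) * (Complex.I * (-β : ℝ)) := by push_cast; ring
    rw [this, Complex.exp_nat_mul, hε3, ← hhe]
    linear_combination (Complex.I ^ 2 * h ^ 2) * hεc + h ^ 2 * Complex.I_sq
  have hE3 : starRingEnd ℂ (Complex.exp (Complex.I * (θ / 2 : ℝ)) * starRingEnd ℂ u) = h * u := by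
    rw [map_mul, Complex.conj_conj, ← Complex.exp_conj, hh]
    congr 2
    simp only [map_mul, Complex.conj_I, Complex.conj_ofReal]
    push_cast; ring
  have hE1 : starRingEnd ℂ (Complex.exp (starRingEnd ℂ u ^ 2 / 2 *
      (1 - Complex.exp (2 * Complex.I * (θ / 2 : ℝ))))) = Complex.exp (u ^ 2 / 2 * (1 - e)) := by
    rw [← Complex.exp_conj]
    congr 1
    simp only [map_mul, map_div₀, map_pow, Complex.conj_conj, map_sub, map_one, ← Complex.exp_conj,
      he]
    simp only [Complex.conj_I, Complex.conj_ofReal, map_ofNat]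
    congr 3
    push_cast; ring
  rw [tiltUnitary_apply, inner_phaseShifter_left, phaseShifter_gaussVec, phaseShifter_gaussVec,
    map_smul, inner_smul_left, inner_smul_right, inner_squeeze_gaussVec hθ, hE1, hE2, hE3, hε3, hε2]
  have hcomb : ∀ a b c r : ℂ, Complex.exp a * (Complex.exp b * (r * Complex.exp c)) =
      r * Complex.exp (a + b + c) := fun a b c r => by
    rw [Complex.exp_add, Complex.exp_add]; ring
  rw [hcomb, sub_neg_eq_add]
  congr 3
  have hcs : (Real.sin θ : ℂ) ^ 2 + (Real.cos θ : ℂ) ^ 2 = 1 := by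
    exact_mod_cast Real.sin_sq_add_cos_sq θ
  set c := Real.cos θ
  set s := Real.sin θ
  -- m = tan(θ/2); the relations m(1 + c) = s and ms = 1 - c eliminate the quotient and leave a
  -- polynomial identity.
  obtain ⟨m, hm⟩ : ∃ m : ℂ, m = s / ((1 + c : ℝ) : ℂ) := ⟨_, rfl⟩
  have hm1 : m * (1 + c) = s := by
    rw [hm]; push_cast at hc ⊢; exact div_mul_cancel₀ _ hc
  have hm2 : m * s = 1 - c := by
    refine mul_right_cancel₀ hc ?_
    push_cast
    linear_combination (s : ℂ) * hm1 + hcs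
  have hm3 : ((ε * s / (1 + c) : ℝ) : ℂ) = ε * m := by
    rw [hm]; push_cast; ring
  rw [hm3, ← hhe]
  push_cast
  linear_combination ((1 + c) / 2 * h ^ 2 * (m * u + Complex.I * z) ^ 2) * hεc +
    (h ^ 2 * m * u ^ 2 / 2 + h ^ 2 * Complex.I * u * z) * hm1 + (h ^ 2 * u ^ 2 / 2) * hm2 +
    ((1 + c) / 2 * h ^ 2 * z ^ 2) * Complex.I_sq

/-! ### The two-mode measurement in the coordinate representation -/

theorem tensorOp_one_one : tensorOp 1 1 = 1 :=
  ext_tensorVec fun φ ψ => by rw [tensorOp_tensorVec]; rfl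

theorem adjoint_phaseShifter (θ : ℝ) :
    ContinuousLinearMap.adjoint (phaseShifter θ : Mode →L[ℂ] Mode) =
      (phaseShifter (-θ) : Mode →L[ℂ] Mode) := by
  refine (ContinuousLinearMap.eq_adjoint_iff _ _).2 (fun φ ψ => ?_) |>.symm
  have := inner_phaseShifter_left (-θ) φ ψ
  rw [neg_neg] at this
  exact this

/-- The isometry that diagonalizes `U* (Q ⊗ Q_θ) U`. -/
def homodyneRep (θ : ℝ) : TwoModes →L[ℂ] PlaneL2 :=
  planeRep.toContinuousLinearMap.comp
    ((tensorOp 1 (phaseShifter (-θ) : Mode →L[ℂ] Mode)).comp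
      (beamSplitter : TwoModes →L[ℂ] TwoModes))

theorem homodyneRep_apply (θ : ℝ) (t : TwoModes) : homodyneRep θ t =
    planeRep (tensorOp 1 (phaseShifter (-θ) : Mode →L[ℂ] Mode) (beamSplitter t)) := rfl

theorem inner_homodyneRep (θ : ℝ) (s t : TwoModes) :
    inner ℂ (homodyneRep θ s) (homodyneRep θ t) = inner ℂ s t := by
  have h : (tensorOp 1 (phaseShifter θ : Mode →L[ℂ] Mode)) *
      (tensorOp 1 (phaseShifter (-θ) : Mode →L[ℂ] Mode)) = 1 := by
    rw [tensorOp_mul, ← tensorOp_one_one, one_mul]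
    congr 1
    ext1 ψ
    have := phaseShifter_neg_phaseShifter (-θ) ψ
    rw [neg_neg] at this
    exact this
  rw [homodyneRep_apply, homodyneRep_apply, LinearIsometry.inner_map_map,
    ← ContinuousLinearMap.adjoint_inner_right, adjoint_tensorOp, adjoint_phaseShifter, neg_neg,
    show ContinuousLinearMap.adjoint (1 : Mode →L[ℂ] Mode) = 1 from star_one _,
    ← mul_apply_eq_comp, h]
  exact beamSplitter.inner_map_map s t

/-- The beam splitter keeps Gaussian products Gaussian, and R(-θ) multiplies the second parameter by
e^{-iθ}. The √2 in `gaussFun` cancels the beam splitter's 1/√2 in the linear terms. -/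
theorem homodyneRep_gaussVec (θ : ℝ) (z u : ℂ) :
    homodyneRep θ (tensorVec (gaussVec z) (gaussVec u)) =ᵐ[volume] fun p : ℝ × ℝ =>
      Complex.exp (-((p.1 : ℂ) ^ 2 + (p.2 : ℂ) ^ 2) / 2 + (z - u) * p.1 +
        Complex.exp (-(θ * Complex.I)) * (z + u) * p.2 +
        (z + u) ^ 2 * (1 - Complex.exp (-(θ * Complex.I)) ^ 2) / 4) := by
  have h2 : ((√2 : ℝ) : ℂ) * ((√2 : ℝ) : ℂ) = 2 := by
    rw [← Complex.ofReal_mul, Real.mul_self_sqrt (by norm_num)]; norm_num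
  have h20 : ((√2 : ℝ) : ℂ) ≠ 0 := fun h => by simp [h] at h2
  have e1 : Complex.exp (Complex.I * (-θ : ℝ)) = Complex.exp (-(θ * Complex.I)) := by
    congr 1; push_cast; ring
  have e2 : Complex.exp (2 * Complex.I * (-θ : ℝ)) = Complex.exp (-(θ * Complex.I)) ^ 2 := by
    rw [← Complex.exp_nat_mul]; congr 1; push_cast; ring
  rw [homodyneRep_apply, beamSplitter_gaussVec, tensorOp_tensorVec, planeRep_tensorVec]
  change prodVec (gaussVec _) (phaseShifter (-θ) (gaussVec _)) =ᵐ[volume] _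
  rw [phaseShifter_gaussVec, map_smul, e1, e2]
  set e := Complex.exp (-(θ * Complex.I))
  filter_upwards [Lp.coeFn_smul (Complex.exp (((z + u) / (√2 : ℝ)) ^ 2 / 2 * (1 - e ^ 2)))
    (prodVec (gaussVec ((z - u) / (√2 : ℝ))) (gaussVec (e * ((z + u) / (√2 : ℝ))))),
    coeFn_prodVec (gaussVec ((z - u) / (√2 : ℝ))) (gaussVec (e * ((z + u) / (√2 : ℝ)))),
    ae_fst (coeFn_gaussVec ((z - u) / (√2 : ℝ))),
    ae_snd (coeFn_gaussVec (e * ((z + u) / (√2 : ℝ))))] with p h3 h4 h5 h6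
  rw [h3, Pi.smul_apply, h4, h5, h6, gaussFun, gaussFun, smul_eq_mul, ← Complex.exp_add,
    ← Complex.exp_add]
  congr 1
  field_simp
  have h2' : ((√2 : ℝ) : ℂ) ^ 2 = 2 := by rw [sq, h2]
  simp only [h2']
  ring

/-- The phase relating the Weyl and the coordinate representation. -/
def homodynePhase (θ : ℝ) (p : ℝ × ℝ) : ℝ :=
  (p.1 ^ 2 - ((p.2 - p.1 * Real.cos θ) / Real.sin θ) ^ 2) * Real.sin θ * Real.cos θ / 2 -
    p.1 * ((p.2 - p.1 * Real.cos θ) / Real.sin θ) * Real.cos θ ^ 2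

/-- The computation that explains V_θ: up to `homodynePhase` and a constant, this overlap is the
function found in `homodyneRep_gaussVec`. The argument √2 p reflects the rescaling of outcomes by
1/√2. -/
theorem inner_tiltedWeyl_gaussVec {θ : ℝ}
    (hθ : θ ∈ Set.Ioo (-Real.pi) 0 ∪ Set.Ioo 0 Real.pi) (z u : ℂ) (p : ℝ × ℝ) :
    inner ℂ (tiltedWeyl θ (√2 • p) (tiltUnitary θ (conjugation (gaussVec u)))) (gaussVec z) =
      (√(Real.pi * |Real.sin θ|) : ℝ) * Complex.exp (homodynePhase θ p * Complex.I) *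
      Complex.exp (-((p.1 : ℂ) ^ 2 + (p.2 : ℂ) ^ 2) / 2 + (z - u) * p.1 +
        Complex.exp (-(θ * Complex.I)) * (z + u) * p.2 +
        (z + u) ^ 2 * (1 - Complex.exp (-(θ * Complex.I)) ^ 2) / 4) := by
  obtain ⟨x, y⟩ := p
  have hs := sin_ne_zero_of_mem hθ
  -- In the coordinates (x, r) = f_θ⁻¹(x, y) no division by sin θ remains.
  obtain ⟨r, hr⟩ : ∃ r : ℝ, r = (y - x * Real.cos θ) / Real.sin θ := ⟨_, rfl⟩
  have hy : y = r * Real.sin θ + x * Real.cos θ := by rw [hr]; field_simp; ring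
  have h2 : ((√2 : ℝ) : ℂ) ^ 2 = 2 := by
    rw [← Complex.ofReal_pow, Real.sq_sqrt (by norm_num)]; norm_num
  have h20 : ((√2 : ℝ) : ℂ) ≠ 0 := fun h => by simp [h] at h2
  have ht : tiltInv θ (√2 • (x, y)) = (√2 * x, √2 * r) := by
    rw [hr]
    ext
    · simp [tiltInv]
    · simp only [tiltInv, Prod.smul_mk, smul_eq_mul]; ring
  have he : Complex.exp (-(θ * Complex.I)) = Real.cos θ - Real.sin θ * Complex.I := by
    rw [← neg_mul, Complex.exp_mul_I]; simp; ring
  have hcs : (Real.sin θ : ℂ) ^ 2 + (Real.cos θ : ℂ) ^ 2 = 1 := by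
    exact_mod_cast Real.sin_sq_add_cos_sq θ
  rw [tiltedWeyl, ht, ← ContinuousLinearMap.adjoint_inner_right, adjoint_weyl, weyl_gaussVec,
    conjugation_gaussVec, inner_smul_right, inner_tiltUnitary_gaussVec hθ, mul_left_comm,
    ← Complex.exp_add, mul_assoc _ (Complex.exp (homodynePhase θ (x, y) * Complex.I)),
    ← Complex.exp_add]
  have hz : z + (((-(√2 * x, √2 * r) : ℝ × ℝ).1 : ℝ) + Complex.I *
      ((-(√2 * x, √2 * r) : ℝ × ℝ).2 : ℝ)) / (√2 : ℝ) = z - (x + Complex.I * r) := by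
    simp only [Prod.neg_mk]
    push_cast
    field_simp
    ring
  rw [hz, homodynePhase, ← hr, he, hy]
  congr 2
  simp only [Prod.neg_mk]
  push_cast
  push_cast at h2 hcs
  generalize Complex.cos θ = c at *
  generalize Complex.sin θ = s at *
  generalize ((√2 : ℝ) : ℂ) = q at *
  -- With e^{-iθ} = c - is both exponents are polynomials, equal modulo q² = 2, i² = -1 and s² + c²
  -- = 1.
  linear_combination (-(1 / 2) * Complex.I * x * r - x ^ 2 / 2 + x * z) * h2 +
    (r ^ 2 / 2 - s * c * r * u - c ^ 2 * r ^ 2 / 2 - s ^ 2 * z * u / 2 + s ^ 2 * x * u +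
      Complex.I * s ^ 2 * r * u - s * c * r * z + s * c * x * r + Complex.I * s * c * r ^ 2 / 2 +
      s ^ 2 * z ^ 2 / 4 + s ^ 2 * u ^ 2 / 4) * Complex.I_sq +
    (r ^ 2 / 2 + Complex.I * r * z + z * u / 2 - x * u - z ^ 2 / 4 - u ^ 2 / 4) * hcs

/-- Two pointwise, respectively mean-square, continuous linear functionals that agree almost
everywhere on a total family agree almost everywhere. -/
theorem ae_eq_of_total {E α ι : Type*} [NormedAddCommGroup E] [NormedSpace ℂ E]
    [MeasurableSpace α] {μ : Measure α} {e : ι → E}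
    (he : (Submodule.span ℂ (Set.range e)).topologicalClosure = ⊤) (T : E →L[ℂ] Lp ℂ 2 μ)
    (Λ : α → E →L[ℂ] ℂ) (h : ∀ i, T (e i) =ᵐ[μ] fun p => Λ p (e i)) (φ : E) :
    T φ =ᵐ[μ] fun p => Λ p φ := by
  let S : Submodule ℂ E :=
    { carrier := {φ | T φ =ᵐ[μ] fun p => Λ p φ}
      add_mem' := fun {φ ψ} hφ hψ => by
        change T (φ + ψ) =ᵐ[μ] fun p => Λ p (φ + ψ)
        rw [map_add]
        filter_upwards [hφ, hψ, Lp.coeFn_add (T φ) (T ψ)] with p h1 h2 h3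
        rw [h3, Pi.add_apply, h1, h2, map_add]
      zero_mem' := by
        change T 0 =ᵐ[μ] fun p => Λ p 0
        rw [map_zero]
        filter_upwards [Lp.coeFn_zero ℂ 2 μ] with p h1
        rw [h1, map_zero]; rfl
      smul_mem' := fun c φ hφ => by
        change T (c • φ) =ᵐ[μ] fun p => Λ p (c • φ)
        rw [map_smul]
        filter_upwards [hφ, Lp.coeFn_smul c (T φ)] with p h1 h2
        rw [h2, Pi.smul_apply, h1, map_smul] }
  have hS : IsClosed (S : Set E) := by
    refine isSeqClosed_iff_isClosed.1 fun f g hf hg => ?_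
    refine ae_eq_of_tendsto_Lp ((T.continuous.tendsto g).comp hg) ?_
    have h1 : ∀ᵐ p ∂μ, ∀ n, T (f n) p = Λ p (f n) := ae_all_iff.2 fun n => hf n
    filter_upwards [h1] with p h2
    simp only [Function.comp_apply, h2]
    exact ((Λ p).continuous.tendsto g).comp hg
  have hle : (Submodule.span ℂ (Set.range e)).topologicalClosure ≤ S :=
    Submodule.topologicalClosure_minimal _ (Submodule.span_le.2 (by rintro _ ⟨i, rfl⟩; exact h i)) hS
  rw [he] at hle
  exact hle (Submodule.mem_top (x := φ))

theorem inner_conjugation_left (φ ψ : Mode) :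
    inner ℂ (conjugation φ) ψ = inner ℂ (conjugation ψ) φ := by
  change inner ℂ (star φ : Mode) ψ = inner ℂ (star ψ : Mode) φ
  rw [inner_eq_integral (Lp.coeFn_star φ) (Filter.EventuallyEq.refl _ ψ),
    inner_eq_integral (Lp.coeFn_star ψ) (Filter.EventuallyEq.refl _ φ)]
  congr 1
  funext x
  simp [mul_comm]

/-- The antilinearity of C cancels that of the first slot. In the form ⟨·, w⟩ the dependence on w is
a continuous linear functional, as `ae_eq_of_total` requires. -/
theorem inner_tiltedWeyl_tiltUnitary_conjugation (θ : ℝ) (p : ℝ × ℝ) (φ w : Mode) :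
    inner ℂ (tiltedWeyl θ p (tiltUnitary θ (conjugation w))) φ =
      inner ℂ (conjugation (ContinuousLinearMap.adjoint (tiltUnitary θ)
        (ContinuousLinearMap.adjoint (tiltedWeyl θ p) φ))) w := by
  rw [← ContinuousLinearMap.adjoint_inner_right, ← ContinuousLinearMap.adjoint_inner_right,
    inner_conjugation_left]

/-- The matrix elements of the tilted Weyl operators in the coordinate representation. -/
theorem homodyneRep_tensorVec {θ : ℝ} (hθ : θ ∈ Set.Ioo (-Real.pi) 0 ∪ Set.Ioo 0 Real.pi)
    (φ w : Mode) : homodyneRep θ (tensorVec φ w) =ᵐ[volume] fun p : ℝ × ℝ =>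
      ((√(Real.pi * |Real.sin θ|) : ℝ) * Complex.exp (homodynePhase θ p * Complex.I))⁻¹ *
        inner ℂ (tiltedWeyl θ (√2 • p) (tiltUnitary θ (conjugation w))) φ := by
  have hc : ∀ p, ((√(Real.pi * |Real.sin θ|) : ℝ) : ℂ) *
      Complex.exp (homodynePhase θ p * Complex.I) ≠ 0 := fun p => by
    refine mul_ne_zero ?_ (Complex.exp_ne_zero _)
    have := abs_pos.2 (sin_ne_zero_of_mem hθ)
    exact_mod_cast (Real.sqrt_pos.2 (by positivity)).ne'
  have h1 : ∀ z u, homodyneRep θ (tensorVec (gaussVec z) (gaussVec u)) =ᵐ[volume]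
      fun p : ℝ × ℝ =>
      ((√(Real.pi * |Real.sin θ|) : ℝ) * Complex.exp (homodynePhase θ p * Complex.I))⁻¹ *
        inner ℂ (tiltedWeyl θ (√2 • p) (tiltUnitary θ (conjugation (gaussVec u)))) (gaussVec z) := by
    intro z u
    filter_upwards [homodyneRep_gaussVec θ z u] with p hp
    rw [hp, inner_tiltedWeyl_gaussVec hθ, inv_mul_cancel_left₀ (hc p)]
  -- Density is used in φ for Gaussian w, and afterwards in w for fixed φ. The exceptional null set
  -- may depend on both vectors.
  have h2 : ∀ u, ∀ φ, homodyneRep θ (tensorVec φ (gaussVec u)) =ᵐ[volume] fun p : ℝ × ℝ =>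
      ((√(Real.pi * |Real.sin θ|) : ℝ) * Complex.exp (homodynePhase θ p * Complex.I))⁻¹ *
        inner ℂ (tiltedWeyl θ (√2 • p) (tiltUnitary θ (conjugation (gaussVec u)))) φ := fun u =>
    ae_eq_of_total topologicalClosure_span_gaussVec
      ((homodyneRep θ).comp (tensorVecL.flip (gaussVec u)))
      (fun p => ((√(Real.pi * |Real.sin θ|) : ℝ) *
        Complex.exp (homodynePhase θ p * Complex.I) : ℂ)⁻¹ •
        innerSL ℂ (tiltedWeyl θ (√2 • p) (tiltUnitary θ (conjugation (gaussVec u)))))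
      (fun z => h1 z u)
  simp only [inner_tiltedWeyl_tiltUnitary_conjugation] at h2 ⊢
  exact ae_eq_of_total topologicalClosure_span_gaussVec ((homodyneRep θ).comp (tensorVecL φ))
    (fun p => ((√(Real.pi * |Real.sin θ|) : ℝ) *
      Complex.exp (homodynePhase θ p * Complex.I) : ℂ)⁻¹ •
      innerSL ℂ (conjugation (ContinuousLinearMap.adjoint (tiltUnitary θ)
        (ContinuousLinearMap.adjoint (tiltedWeyl θ (√2 • p)) φ)))) (fun u => h2 u φ) w

/-! ### Construction of the observable -/

theorem integral_norm_sq {α : Type*} [MeasurableSpace α] {μ : Measure α} (f : Lp ℂ 2 μ) :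
    ∫ p, ‖f p‖ ^ 2 ∂μ = ‖f‖ ^ 2 := by
  have h : inner ℂ f f = ((∫ p, ‖f p‖ ^ 2 ∂μ : ℝ) : ℂ) := by
    rw [L2.inner_def, ← integral_complex_ofReal]
    congr 1; funext x
    rw [inner_self_eq_norm_sq_to_K]; simp
  rw [inner_self_eq_norm_sq_to_K] at h
  refine Complex.ofReal_injective (h.symm.trans ?_)
  push_cast; rfl

/-- Termwise integration of a square summable series of inner products. -/
theorem integrable_and_hasSum_inner_indicatorOp {α : Type*} [MeasurableSpace α] {μ : Measure α}
    {f g : ℕ → Lp ℂ 2 μ} (hf : Summable fun l => ‖f l‖ ^ 2) (hg : Summable fun l => ‖g l‖ ^ 2)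
    {F : α → ℂ} (hF : ∀ᵐ p ∂μ, HasSum (fun l => inner ℂ (f l p) (g l p)) (F p)) :
    Integrable F μ ∧ ∀ X, MeasurableSet X →
      HasSum (fun l => inner ℂ (f l) (indicatorOp μ X (g l))) (∫ x in X, F x ∂μ) := by
  have hint : ∀ l, Integrable (fun p => inner ℂ (f l p) (g l p)) μ := fun l =>
    L2.integrable_inner (f l) (g l)
  have hsq : ∀ f : Lp ℂ 2 μ, Integrable (fun p => ‖f p‖ ^ 2) μ := fun f =>
    (memLp_two_iff_integrable_sq_norm (Lp.aestronglyMeasurable f)).1 (Lp.memLp f)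
  -- This L¹ bound is summable in l; it yields integrability of F and termwise integration over
  -- every measurable set.
  have hle : ∀ l, ∫ p, ‖(inner ℂ (f l p) (g l p) : ℂ)‖ ∂μ ≤ ‖f l‖ ^ 2 + ‖g l‖ ^ 2 := by
    intro l
    rw [← integral_norm_sq, ← integral_norm_sq, ← integral_add (hsq _) (hsq _)]
    refine integral_mono (hint l).norm ((hsq _).add (hsq _)) fun p => ?_
    refine (norm_inner_le_norm _ _).trans ?_
    nlinarith [sq_nonneg (‖f l p‖ - ‖g l p‖), sq_nonneg ‖f l p‖, sq_nonneg ‖g l p‖]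
  have hsum : Summable fun l => ∫ p, ‖(inner ℂ (f l p) (g l p) : ℂ)‖ ∂μ :=
    Summable.of_nonneg_of_le (fun l => integral_nonneg fun p => norm_nonneg _) hle (hf.add hg)
  have hFint : Integrable F μ := by
    constructor
    · refine aestronglyMeasurable_of_tendsto_ae Filter.atTop
        (f := fun n p => ∑ l ∈ Finset.range n, inner ℂ (f l p) (g l p)) (fun n => ?_) ?_
      · exact (integrable_finsetSum _ fun l _ => hint l).aestronglyMeasurable
      · filter_upwards [hF] with p hp
        exact hp.tendsto_sum_nat
    · have h1 : ∫⁻ p, ∑' l, ‖(inner ℂ (f l p) (g l p) : ℂ)‖ₑ ∂μ < ⊤ := by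
        rw [lintegral_tsum fun l => (hint l).aestronglyMeasurable.enorm]
        simp only [← ofReal_integral_norm_eq_lintegral_enorm (hint _)]
        exact hsum.tsum_ofReal_lt_top
      refine lt_of_le_of_lt (lintegral_mono_ae ?_) h1
      filter_upwards [hF] with p hp
      rw [← hp.tsum_eq]
      exact enorm_tsum_le_tsum_enorm
  refine ⟨hFint, fun X hX => ?_⟩
  have h2 := hasSum_integral_of_summable_integral_norm (μ := μ.restrict X)
    (fun l => (hint l).integrableOn)
    (Summable.of_nonneg_of_le (fun l => integral_nonneg fun p => norm_nonneg _)
      (fun l => setIntegral_le_integral (hint l).norm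
        (Filter.Eventually.of_forall fun p => norm_nonneg _)) hsum)
  simp only [← inner_indicatorOp hX] at h2
  rwa [integral_congr_ae ((ae_restrict_of_ae hF).mono fun p hp => hp.tsum_eq)] at h2

theorem indicatorOp_of_not_measurable {α : Type*} [MeasurableSpace α] {μ : Measure α} {X : Set α}
    (hX : ¬ MeasurableSet X) : indicatorOp μ X = 0 := dif_neg hX

theorem norm_indicatorOp_le {α : Type*} [MeasurableSpace α] {μ : Measure α} (X : Set α) :
    ‖indicatorOp μ X‖ ≤ 1 := by
  by_cases hX : MeasurableSet X
  · refine ContinuousLinearMap.opNorm_le_bound _ zero_le_one fun ψ => ?_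
    rw [one_mul]
    refine Lp.norm_le_norm_of_ae_le ?_
    filter_upwards [coeFn_indicatorOp hX ψ] with x hx
    rw [hx]
    exact norm_indicator_le_norm_self _ _
  · rw [indicatorOp_of_not_measurable hX]; simp

/-- The map `φ ↦ φ ⊗ w`, in the representation `homodyneRep`. -/
def homodyneSlice (θ : ℝ) (w : Mode) : Mode →L[ℂ] PlaneL2 :=
  (homodyneRep θ).comp (tensorVecL.flip w)

theorem homodyneSlice_apply (θ : ℝ) (w φ : Mode) :
    homodyneSlice θ w φ = homodyneRep θ (tensorVec φ w) := rfl

theorem inner_homodyneSlice (θ : ℝ) (w φ ψ : Mode) :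
    inner ℂ (homodyneSlice θ w φ) (homodyneSlice θ w ψ) = ((‖w‖ ^ 2 : ℝ) : ℂ) * inner ℂ φ ψ := by
  rw [homodyneSlice_apply, homodyneSlice_apply, inner_homodyneRep, inner_tensorVec, mul_comm,
    inner_self_eq_norm_sq_to_K]
  push_cast; rfl

theorem norm_homodyneSlice_apply (θ : ℝ) (w φ : Mode) :
    ‖homodyneSlice θ w φ‖ = ‖φ‖ * ‖w‖ := by
  have h := inner_homodyneSlice θ w φ φ
  rw [inner_self_eq_norm_sq_to_K, inner_self_eq_norm_sq_to_K] at h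
  have h2 : ‖homodyneSlice θ w φ‖ ^ 2 = (‖φ‖ * ‖w‖) ^ 2 := by
    rw [mul_pow, mul_comm]
    refine Complex.ofReal_injective (Eq.trans ?_ (h.trans ?_)) <;> (push_cast; rfl)
  exact (pow_left_inj₀ (norm_nonneg _) (by positivity) two_ne_zero).1 h2

theorem norm_homodyneSlice_le (θ : ℝ) (w : Mode) : ‖homodyneSlice θ w‖ ≤ ‖w‖ :=
  ContinuousLinearMap.opNorm_le_bound _ (norm_nonneg _) fun φ => by
    rw [norm_homodyneSlice_apply, mul_comm]

/-- The operator `∑ₗ ⟨· ⊗ wₗ| U* (Q ⊗ Q_θ)(Z/√2) U |· ⊗ wₗ⟩`. -/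
def homodyneOp (θ : ℝ) (w : ℕ → Mode) (Z : Set (ℝ × ℝ)) : Mode →L[ℂ] Mode :=
  ∑' l, (ContinuousLinearMap.adjoint (homodyneSlice θ (w l))).comp
    ((indicatorOp volume ((fun p : ℝ × ℝ => √2 • p) ⁻¹' Z)).comp (homodyneSlice θ (w l)))

/-- Each term of the defining series has norm at most ‖w_l‖², so the series converges in operator
norm and matrix elements sum termwise. -/
theorem hasSum_homodyneOp (θ : ℝ) {w : ℕ → Mode} (hw : Summable fun l => ‖w l‖ ^ 2)
    (Z : Set (ℝ × ℝ)) (φ ψ : Mode) :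
    HasSum (fun l => inner ℂ (homodyneSlice θ (w l) φ)
      (indicatorOp volume ((fun p : ℝ × ℝ => √2 • p) ⁻¹' Z) (homodyneSlice θ (w l) ψ)))
      (inner ℂ φ (homodyneOp θ w Z ψ)) := by
  have hs : Summable fun l => (ContinuousLinearMap.adjoint (homodyneSlice θ (w l))).comp
      ((indicatorOp volume ((fun p : ℝ × ℝ => √2 • p) ⁻¹' Z)).comp (homodyneSlice θ (w l))) := by
    refine Summable.of_norm_bounded hw fun l => ?_
    refine (ContinuousLinearMap.opNorm_comp_le _ _).trans ?_
    rw [LinearIsometryEquiv.norm_map, sq]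
    refine mul_le_mul (norm_homodyneSlice_le θ _) ?_ (norm_nonneg _) (norm_nonneg _)
    refine (ContinuousLinearMap.opNorm_comp_le _ _).trans ?_
    rw [← one_mul ‖w l‖]
    exact mul_le_mul (norm_indicatorOp_le _) (norm_homodyneSlice_le θ _) (norm_nonneg _) zero_le_one
  have h := (hs.hasSum.mapL (ContinuousLinearMap.apply ℂ Mode ψ)).mapL (innerSL ℂ φ)
  refine h.congr_fun fun l => ?_
  exact (ContinuousLinearMap.adjoint_inner_right (homodyneSlice θ (w l)) _ _).symm

theorem measurableSet_preimage_sqrt_two {Z : Set (ℝ × ℝ)} :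
    MeasurableSet ((fun p : ℝ × ℝ => √2 • p) ⁻¹' Z) ↔ MeasurableSet Z :=
  (MeasurableEquiv.smul₀ (√2 : ℝ) (by positivity)).measurableSet_preimage

/-- The generating density, in the coordinate representation. -/
theorem hasSum_inner_homodyneSlice {θ : ℝ} (hθ : θ ∈ Set.Ioo (-Real.pi) 0 ∪ Set.Ioo 0 Real.pi)
    {w : ℕ → Mode} {S : Mode →L[ℂ] Mode}
    (hS : IsEnsemble S fun l => tiltUnitary θ (conjugation (w l))) (φ ψ : Mode) :
    ∀ᵐ p : ℝ × ℝ, HasSum (fun l => inner ℂ (homodyneSlice θ (w l) φ p) (homodyneSlice θ (w l) ψ p))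
      (((1 / (Real.pi * |Real.sin θ|) : ℝ) : ℂ) * inner ℂ φ
        ((tiltedWeyl θ (√2 • p) * S * ContinuousLinearMap.adjoint (tiltedWeyl θ (√2 • p))) ψ)) := by
  have h1 : ∀ φ, ∀ᵐ p : ℝ × ℝ, ∀ l, homodyneSlice θ (w l) φ p =
      ((√(Real.pi * |Real.sin θ|) : ℝ) * Complex.exp (homodynePhase θ p * Complex.I))⁻¹ *
        inner ℂ (tiltedWeyl θ (√2 • p) (tiltUnitary θ (conjugation (w l)))) φ := fun φ =>
    ae_all_iff.2 fun l => homodyneRep_tensorVec hθ φ (w l)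
  filter_upwards [h1 φ, h1 ψ] with p h2 h3
  have h4 := ((hS.conj (tiltedWeyl θ (√2 • p))).2 φ ψ).mul_left
    ((1 / (Real.pi * |Real.sin θ|) : ℝ) : ℂ)
  refine h4.congr_fun fun l => ?_
  rw [h2, h3, RCLike.inner_apply, map_mul, inner_conj_symm]
  -- Only the modulus of the scalar enters the density; `homodynePhase` drops out here.
  have h5 : ((√(Real.pi * |Real.sin θ|) : ℝ) * Complex.exp (homodynePhase θ p * Complex.I))⁻¹ *
      starRingEnd ℂ ((√(Real.pi * |Real.sin θ|) : ℝ) *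
        Complex.exp (homodynePhase θ p * Complex.I))⁻¹ =
      ((1 / (Real.pi * |Real.sin θ|) : ℝ) : ℂ) := by
    rw [Complex.mul_conj', norm_inv, norm_mul, Complex.norm_exp_ofReal_mul_I, mul_one,
      Complex.norm_real, Real.norm_eq_abs, abs_of_nonneg (Real.sqrt_nonneg _), ← Complex.ofReal_pow,
      inv_pow, Real.sq_sqrt (by have := Real.pi_pos; positivity), one_div]
  rw [← h5]
  ring

/-- The slice densities are integrated term by term. The substitution z = √2 p has Jacobian 2 in the
plane and turns 1/(π|sin θ|) into 1/(2π|sin θ|). -/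
theorem inner_homodyneOp {θ : ℝ} (hθ : θ ∈ Set.Ioo (-Real.pi) 0 ∪ Set.Ioo 0 Real.pi)
    {w : ℕ → Mode} (hw : Summable fun l => ‖w l‖ ^ 2) {S : Mode →L[ℂ] Mode}
    (hS : IsEnsemble S fun l => tiltUnitary θ (conjugation (w l))) (φ ψ : Mode) :
    Integrable (fun z => inner ℂ φ
      ((tiltedWeyl θ z * S * ContinuousLinearMap.adjoint (tiltedWeyl θ z)) ψ)) volume ∧
    ∀ Z, MeasurableSet Z → inner ℂ φ (homodyneOp θ w Z ψ) =
      ((1 / (2 * Real.pi * |Real.sin θ|) : ℝ) : ℂ) * ∫ z in Z, inner ℂ φ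
        ((tiltedWeyl θ z * S * ContinuousLinearMap.adjoint (tiltedWeyl θ z)) ψ) := by
  have hsum : ∀ φ, Summable fun l => ‖homodyneSlice θ (w l) φ‖ ^ 2 := fun φ => by
    simp only [norm_homodyneSlice_apply, mul_pow]
    exact hw.mul_left _
  obtain ⟨h1, h2⟩ := integrable_and_hasSum_inner_indicatorOp (hsum φ) (hsum ψ)
    (hasSum_inner_homodyneSlice hθ hS φ ψ)
  have hpos : 0 < Real.pi * |Real.sin θ| :=
    mul_pos Real.pi_pos (abs_pos.2 (sin_ne_zero_of_mem hθ))
  have hne : ((1 / (Real.pi * |Real.sin θ|) : ℝ) : ℂ) ≠ 0 := by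
    exact_mod_cast (one_div_pos.2 hpos).ne'
  have h20 : (0 : ℝ) < √2 := by positivity
  refine ⟨?_, fun Z hZ => ?_⟩
  · rw [integrable_const_mul_iff (isUnit_iff_ne_zero.2 hne)] at h1
    exact (integrable_comp_smul_iff volume _ h20.ne').1 h1
  · have h3 := h2 _ (measurableSet_preimage_sqrt_two.2 hZ)
    rw [(hasSum_homodyneOp θ hw Z φ ψ).unique h3, integral_const_mul,
      Measure.setIntegral_comp_smul_of_pos volume (fun z => inner ℂ φ
        ((tiltedWeyl θ z * S * ContinuousLinearMap.adjoint (tiltedWeyl θ z)) ψ)) _ h20]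
    have h4 : √2 • ((fun p : ℝ × ℝ => √2 • p) ⁻¹' Z) = Z := by
      rw [Set.preimage_smul₀ h20.ne', smul_inv_smul₀ h20.ne']
    rw [h4, Module.finrank_prod, Module.finrank_self, Real.sq_sqrt (by norm_num), Complex.real_smul,
      ← mul_assoc, ← Complex.ofReal_mul]
    congr 2
    field_simp

/-- The high-amplitude limit observable of a parameter field with ensemble `w`. -/
def homodyneObservable {θ : ℝ} (hθ : θ ∈ Set.Ioo (-Real.pi) 0 ∪ Set.Ioo 0 Real.pi)
    {w : ℕ → Mode} (hw : HasSum (fun l => ‖w l‖ ^ 2) 1) {S : Mode →L[ℂ] Mode}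
    (hS : IsEnsemble S fun l => tiltUnitary θ (conjugation (w l))) :
    Observable (ℝ × ℝ) Mode where
  toFun := homodyneOp θ w
  isPositive Z hZ := by
    rw [ContinuousLinearMap.isPositive_iff_complex]
    intro ψ
    have h := hasSum_homodyneOp θ hw.summable Z ψ ψ
    have hm := measurableSet_preimage_sqrt_two.2 hZ
    have e : ∀ l, inner ℂ (homodyneSlice θ (w l) ψ)
        (indicatorOp volume ((fun p : ℝ × ℝ => √2 • p) ⁻¹' Z) (homodyneSlice θ (w l) ψ)) =
        ((((indicatorObservable volume).measure (homodyneSlice θ (w l) ψ)).real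
          ((fun p : ℝ × ℝ => √2 • p) ⁻¹' Z) : ℝ) : ℂ) := fun l =>
      (indicatorObservable volume).inner_eq_measure _ hm
    simp only [e] at h
    have h2 := Complex.hasSum_re h
    simp only [Complex.ofReal_re] at h2
    have h3 : inner ℂ ψ (homodyneOp θ w Z ψ) =
        ((inner ℂ ψ (homodyneOp θ w Z ψ)).re : ℂ) := h.unique (Complex.hasSum_ofReal.2 h2)
    have h4 : inner ℂ (homodyneOp θ w Z ψ) ψ = ((inner ℂ ψ (homodyneOp θ w Z ψ)).re : ℂ) := by
      rw [← inner_conj_symm, h3, Complex.conj_ofReal, Complex.ofReal_re]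
    rw [h4]
    simpa using h2.nonneg fun l => measureReal_nonneg
  map_univ := by
    ext1 ψ
    refine ext_inner_left ℂ fun φ => ?_
    have h := hasSum_homodyneOp θ hw.summable Set.univ φ ψ
    rw [Set.preimage_univ, indicatorOp_univ] at h
    simp only [one_apply_eq_self, inner_homodyneSlice] at h
    -- Each slice is an isometry scaled by ‖w_l‖, so normalization is exactly the total weight 1 of
    -- the ensemble.
    have h2 := (Complex.hasSum_ofReal.2 hw).mul_right (inner ℂ φ ψ)
    rw [Complex.ofReal_one, one_mul] at h2
    exact h.unique h2
  hasSum_iUnion Z hZ hd φ ψ := by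
    obtain ⟨h1, h2⟩ := inner_homodyneOp hθ hw.summable hS φ ψ
    rw [h2 _ (MeasurableSet.iUnion hZ)]
    simp only [h2 _ (hZ _)]
    exact (hasSum_integral_iUnion hZ hd h1.integrableOn).mul_left _
  not_measurable Z hZ := by
    rw [homodyneOp, indicatorOp_of_not_measurable (mt measurableSet_preimage_sqrt_two.1 hZ)]
    simp

/-! ### The generating operator -/

theorem inner_conjugation_right (φ ψ : Mode) :
    inner ℂ φ (conjugation ψ) = inner ℂ ψ (conjugation φ) := by
  rw [← inner_conj_symm, inner_conjugation_left, inner_conj_symm]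

theorem IsEnsemble.conjugate {ι : Type*} {σ : Mode →L[ℂ] Mode} {w : ι → Mode}
    (h : IsEnsemble σ w) : IsEnsemble (conjugate σ) fun l => conjugation (w l) := by
  refine ⟨by simpa only [LinearIsometryEquiv.norm_map] using h.1, fun x y => ?_⟩
  change HasSum _ (inner ℂ x (conjugation (σ (conjugation y))))
  rw [inner_conjugation_right, ← inner_conj_symm]
  refine ((h.2 (conjugation x) (conjugation y)).map (starRingEnd ℂ)
    Complex.continuous_conj).congr_fun fun l => ?_
  rw [Function.comp_apply, map_mul, inner_conj_symm, inner_conj_symm, inner_conjugation_right x,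
    inner_conjugation_left (w l)]

theorem IsEnsemble.generator {ι : Type*} {σ : Mode →L[ℂ] Mode} {w : ι → Mode}
    (h : IsEnsemble σ w) (θ : ℝ) :
    IsEnsemble (generator θ σ) fun l => tiltUnitary θ (conjugation (w l)) :=
  h.conjugate.conj (tiltUnitary θ)

/-! ### Covariance -/

theorem tiltInv_add (θ : ℝ) (a b : ℝ × ℝ) : tiltInv θ (a + b) = tiltInv θ a + tiltInv θ b := by
  ext
  · rfl
  · simp only [tiltInv, Prod.snd_add, Prod.fst_add]; ring

/-- Tilted Weyl operators compose additively up to a unimodular scalar, because f_θ⁻¹ is additive;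
the scalar cancels between the two sides of S. -/
theorem inner_conj_tiltedWeyl (θ : ℝ) (S : Mode →L[ℂ] Mode) (z z₀ : ℝ × ℝ) (φ ψ : Mode) :
    inner ℂ (ContinuousLinearMap.adjoint (tiltedWeyl θ z₀) φ)
      ((tiltedWeyl θ z * S * ContinuousLinearMap.adjoint (tiltedWeyl θ z))
        (ContinuousLinearMap.adjoint (tiltedWeyl θ z₀) ψ)) =
    inner ℂ φ ((tiltedWeyl θ (z + z₀) * S *
      ContinuousLinearMap.adjoint (tiltedWeyl θ (z + z₀))) ψ) := by
  obtain ⟨c, hc, h⟩ : ∃ c : ℂ, ‖c‖ = 1 ∧ ∀ χ : Mode,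
      ContinuousLinearMap.adjoint (tiltedWeyl θ z)
        (ContinuousLinearMap.adjoint (tiltedWeyl θ z₀) χ) =
      c • ContinuousLinearMap.adjoint (tiltedWeyl θ (z + z₀)) χ := by
    simp only [tiltedWeyl, adjoint_weyl, weyl_weyl_apply, tiltInv_add, neg_add]
    refine ⟨_, ?_, fun χ => rfl⟩
    rw [mul_comm]
    exact_mod_cast Complex.norm_exp_ofReal_mul_I _
  have e : ∀ (z : ℝ × ℝ) (φ ψ : Mode), inner ℂ φ ((tiltedWeyl θ z * S *
      ContinuousLinearMap.adjoint (tiltedWeyl θ z)) ψ) =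
      inner ℂ (ContinuousLinearMap.adjoint (tiltedWeyl θ z) φ)
        (S (ContinuousLinearMap.adjoint (tiltedWeyl θ z) ψ)) := fun z φ ψ => by
    rw [ContinuousLinearMap.adjoint_inner_left]; rfl
  rw [e, e, h, h, map_smul, inner_smul_left, inner_smul_right, ← mul_assoc, Complex.conj_mul', hc]
  simp

/-- Conjugating the density translates its argument, and Lebesgue measure is translation invariant.
-/
theorem IsGeneratedBy.isCovariant {θ : ℝ} {S : Mode →L[ℂ] Mode} {E : Observable (ℝ × ℝ) Mode}
    (h : IsGeneratedBy θ S E) : IsCovariant θ E := by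
  intro Z hZ z₀
  have hemb : MeasurableEmbedding fun w : ℝ × ℝ => w + z₀ := measurableEmbedding_addRight z₀
  ext1 ψ
  refine ext_inner_left ℂ fun φ => ?_
  rw [(h _ (hemb.measurableSet_image.2 hZ) φ ψ).2,
    (measurePreserving_add_right volume z₀).setIntegral_image_emb hemb]
  simp only [← inner_conj_tiltedWeyl]
  rw [← (h Z hZ _ _).2, ContinuousLinearMap.adjoint_inner_left]
  rfl

/-! ### The high-amplitude limit -/

theorem phaseShifter_zero (ψ : Mode) : phaseShifter 0 ψ = ψ := by
  have h : (phaseShifter 0 : Mode →L[ℂ] Mode) = ContinuousLinearMap.id ℂ Mode := by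
    refine ContinuousLinearMap.ext_on (s := Set.range numberState)
      (Submodule.dense_iff_topologicalClosure_eq_top.2 topologicalClosure_span_numberState) ?_
    rintro _ ⟨n, rfl⟩
    change phaseShifter 0 (numberState n) = numberState n
    rw [phaseShifter_numberState]
    simp
  exact DFunLike.congr_fun h ψ

/-- Both spectral measures are indicator multiplications up to rotation. The rotation in the second
mode is absorbed into `homodyneRep`, leaving one indicator on the plane. -/
theorem inner_tensorOp_spectralMeasure (θ : ℝ) {X Y : Set ℝ} (hX : MeasurableSet X)
    (hY : MeasurableSet Y) (t : TwoModes) :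
    inner ℂ (beamSplitter t) (tensorOp (spectralMeasure (quadrature 0) X)
      (spectralMeasure (quadrature θ) Y) (beamSplitter t)) =
    inner ℂ (homodyneRep θ t) (indicatorOp volume (X ×ˢ Y) (homodyneRep θ t)) := by
  have h1 : spectralMeasure (quadrature 0) X = 1 * indicatorOp volume X * 1 := by
    ext1 ψ
    rw [spectralMeasure_quadrature, quadratureObservable_apply, neg_zero, phaseShifter_zero,
      phaseShifter_zero]
    rfl
  have h2 : spectralMeasure (quadrature θ) Y = (phaseShifter θ : Mode →L[ℂ] Mode) *
      indicatorOp volume Y * (phaseShifter (-θ) : Mode →L[ℂ] Mode) := by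
    ext1 ψ
    rw [spectralMeasure_quadrature, quadratureObservable_apply]
    rfl
  have h3 : ContinuousLinearMap.adjoint (tensorOp 1 (phaseShifter (-θ) : Mode →L[ℂ] Mode)) =
      tensorOp 1 (phaseShifter θ : Mode →L[ℂ] Mode) := by
    rw [adjoint_tensorOp, adjoint_phaseShifter, neg_neg,
      show ContinuousLinearMap.adjoint (1 : Mode →L[ℂ] Mode) = 1 from star_one _]
  rw [h1, h2, ← tensorOp_mul, ← tensorOp_mul, mul_apply_eq_comp, mul_apply_eq_comp, ← h3,
    ContinuousLinearMap.adjoint_inner_right, homodyneRep_apply, ← planeRep_indicator hX hY,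
    LinearIsometry.inner_map_map]

/-- With ρ = A², the two-mode state has the product ensemble A|k⟩ ⊗ B|l⟩. Summing over l for fixed k
gives the quadratic form of the observable at A|k⟩; the remaining sum over k is the trace against ρ.
-/
theorem isHighAmplitudeLimit_homodyneObservable {θ : ℝ}
    (hθ : θ ∈ Set.Ioo (-Real.pi) 0 ∪ Set.Ioo 0 Real.pi) {B : Mode →L[ℂ] Mode}
    (hB : IsSelfAdjoint B) (hw : HasSum (fun l => ‖B (numberState l)‖ ^ 2) 1)
    {S : Mode →L[ℂ] Mode}
    (hS : IsEnsemble S fun l => tiltUnitary θ (conjugation (B (numberState l)))) :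
    IsHighAmplitudeLimit θ (B * B) (homodyneObservable hθ hw hS) := by
  intro ρ hρ X Y hX hY
  obtain ⟨A, hA, rfl⟩ := exists_root hρ.1
  obtain ⟨h1, h2⟩ := hρ.summable_root hA rfl numberBasis
  rw [coe_numberBasis] at h1 h2
  have hpre : (fun p : ℝ × ℝ => √2 • p) ⁻¹' (X ×ˢ Y) =
      ((1 / √2 : ℝ) • X) ×ˢ ((1 / √2 : ℝ) • Y) := by
    have h20 : (√2 : ℝ) ≠ 0 := by positivity
    ext p
    simp only [Set.mem_preimage, Set.mem_prod, one_div, Set.mem_inv_smul_set_iff₀ h20]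
    rfl
  have hm : ∀ {X : Set ℝ}, MeasurableSet X → MeasurableSet ((1 / √2 : ℝ) • X) := fun h =>
    h.const_smul₀ _
  have h3 := h1.trace_mul (homodyneObservable hθ hw hS (X ×ˢ Y))
  have h4 := ((isEnsemble_tensorOp hA hB h2.summable hw.summable).conj
    (beamSplitter : TwoModes →L[ℂ] TwoModes)).trace_mul
    (tensorOp (spectralMeasure (quadrature 0) ((1 / √2 : ℝ) • X))
      (spectralMeasure (quadrature θ) ((1 / √2 : ℝ) • Y)))
  have h5 : ∀ k, HasSum (fun l => inner ℂ
      (beamSplitter (tensorVec (A (numberState k)) (B (numberState l))))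
      (tensorOp (spectralMeasure (quadrature 0) ((1 / √2 : ℝ) • X))
        (spectralMeasure (quadrature θ) ((1 / √2 : ℝ) • Y))
        (beamSplitter (tensorVec (A (numberState k)) (B (numberState l))))))
      (inner ℂ (A (numberState k))
        (homodyneObservable hθ hw hS (X ×ˢ Y) (A (numberState k)))) := by
    intro k
    have h := hasSum_homodyneOp θ hw.summable (X ×ˢ Y) (A (numberState k)) (A (numberState k))
    refine h.congr_fun fun l => ?_
    rw [inner_tensorOp_spectralMeasure θ (hm hX) (hm hY), hpre]
    rfl
  exact h3.unique (h4.prod_fiberwise h5)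

/-- Testing with rank-one states fixes the quadratic form at unit vectors, hence at all vectors by
scaling. Finite measures on the plane are determined by rectangles. -/
theorem IsHighAmplitudeLimit.unique {θ : ℝ} {σ : Mode →L[ℂ] Mode} {E F : Observable (ℝ × ℝ) Mode}
    (hE : IsHighAmplitudeLimit θ σ E) (hF : IsHighAmplitudeLimit θ σ F) : E = F := by
  have hunit : ∀ X Y : Set ℝ, MeasurableSet X → MeasurableSet Y → ∀ ψ : Mode, ‖ψ‖ = 1 →
      inner ℂ ψ (E (X ×ˢ Y) ψ) = inner ℂ ψ (F (X ×ˢ Y) ψ) := by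
    intro X Y hX hY ψ hψ
    have h := (hE _ (isState_rankOne hψ) X Y hX hY).trans
      (hF _ (isState_rankOne hψ) X Y hX hY).symm
    have e : ∀ G : Mode →L[ℂ] Mode,
        trace (InnerProductSpace.rankOne ℂ ψ ψ * G) = inner ℂ ψ (G ψ) := fun G =>
      ((isEnsemble_rankOne ψ).trace_mul G).unique (hasSum_unique _)
    rwa [e, e] at h
  refine Observable.ext_of_measure fun ψ => Measure.ext_prod fun {X Y} hX hY => ?_
  rw [Observable.measure_apply _ _ (hX.prod hY), Observable.measure_apply _ _ (hX.prod hY)]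
  rcases eq_or_ne ψ 0 with rfl | hψ
  · simp
  · have hn : ((‖ψ‖ : ℝ) : ℂ) ≠ 0 := by exact_mod_cast norm_ne_zero_iff.2 hψ
    have h := hunit X Y hX hY (((‖ψ‖ : ℝ) : ℂ)⁻¹ • ψ) (by
      rw [norm_smul, norm_inv, Complex.norm_real, norm_norm,
        inv_mul_cancel₀ (norm_ne_zero_iff.2 hψ)])
    simp only [map_smul, inner_smul_left, inner_smul_right] at h
    have hc : starRingEnd ℂ (((‖ψ‖ : ℝ) : ℂ)⁻¹) ≠ 0 := by simpa using hψ
    rw [mul_left_cancel₀ hc (mul_left_cancel₀ (inv_ne_zero hn) h)]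

end EightPort

end

/-! ### The high-amplitude limit as a covariant observable -/

theorem mainTheorem1 (θ : ℝ) (hθ : θ ∈ Set.Ioo (-Real.pi) 0 ∪ Set.Ioo 0 Real.pi)
    (σ : EightPort.Mode →L[ℂ] EightPort.Mode) (hσ : EightPort.IsState σ) :
    EightPort.IsState (EightPort.generator θ σ) ∧
    ∃ E : EightPort.Observable (ℝ × ℝ) EightPort.Mode,
      (∀ E' : EightPort.Observable (ℝ × ℝ) EightPort.Mode,
        EightPort.IsHighAmplitudeLimit θ σ E' ↔ E' = E) ∧
      EightPort.IsCovariant θ E ∧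
      EightPort.IsGeneratedBy θ (EightPort.generator θ σ) E := by
  obtain ⟨B, hB, rfl⟩ := EightPort.exists_root hσ.1
  obtain ⟨h1, h2⟩ := hσ.summable_root hB rfl EightPort.numberBasis
  rw [EightPort.coe_numberBasis] at h1 h2
  have hS := h1.generator θ
  have hlim := EightPort.isHighAmplitudeLimit_homodyneObservable hθ hB h2 hS
  have hgen : EightPort.IsGeneratedBy θ (EightPort.generator θ (B * B))
      (EightPort.homodyneObservable hθ h2 hS) := by
    intro Z hZ φ ψ
    obtain ⟨h3, h4⟩ := EightPort.inner_homodyneOp hθ h2.summable hS φ ψ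
    exact ⟨h3.integrableOn, h4 Z hZ⟩
  refine ⟨hS.isState ?_, _, fun E' => ⟨fun h => h.unique hlim, fun h => h ▸ hlim⟩,
    hgen.isCovariant, hgen⟩
  simpa only [EightPort.norm_tiltUnitary_apply hθ, LinearIsometryEquiv.norm_map] using h2
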